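/- Fix an integer $e\ge 2$. **Blocks.** A charged bipartition is a pair $(\boldsymbol\lambda,\boldsymbol a)$ with $\boldsymbol\lambda=(\lambda^{(1)},\lambda^{(2)})$ a bipartition and $\boldsymbol a=(a_1,a_2)\in\mathbb Z^2$ (the bicharge). The node $(r,c,k)$ of $\boldsymbol\lambda$ has residue $c-r+a_k \bmod e$. Write $(\boldsymbol\lambda,\boldsymbol a)\sim(\boldsymbol\mu,\boldsymbol a')$ if $\boldsymbol a=\boldsymbol a'$ and the multisets of residues of the nodes agree. A (combinatorial) block is an equivalence class of $\sim$; let $\mathscr B$ be the set of blocks. The number $|\boldsymbol\lambda|$ is constant on a block $B$, and is denoted $n(B)$. **Core blocks.** A bicore is a bipartition without removable $e$-rim hooks. Removing $e$-rim hooks repeatedly from $\boldsymbol\lambda$ gives a bicore $\bar{\boldsymbol\lambda}$; let $h(\boldsymbol\lambda)$ be the number of hooks removed. For a block $B$ let $h(B)=\max\{h(\boldsymbol\lambda) : (\boldsymbol\lambda,\boldsymbol a)\in B\}$; the core block of $B$ is $\{(\bar{\boldsymbol\lambda},\boldsymbol a) : (\boldsymbol\lambda,\boldsymbol a)\in B,\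 h(\boldsymbol\lambda)=h(B)\}$. The $\beta$-set of a partition $\lambda$ for the charge $a$ is $\beta_a(\lambda)=\{\lambda_r-r+a : r\ge1\}$. For $0\le i<e$ and $k\in\{1,2\}$ let $b_{ik}=b_{ik}(\boldsymbol\lambda,\boldsymbol a)$ be such that $i+e\,b_{ik}$ is the largest element of $\beta_{a_k}(\lambda^{(k)})$ congruent to $i$ mod $e$. Let $\mathscr C$ be the set of blocks $C$ consisting of bicores for which there is $(b_0,\dots,b_{e-1})\in\mathbb Z^e$ with $b_{ik}\in\{b_i,b_i+1\}$ for all $i,k$ and all $(\boldsymbol\lambda,\boldsymbol a)\in C$. For $h\ge0$ let $\mathscr B_h=\{B\in\mathscr B : h(B)=h\}$, and let $\mathscr B^\circ_h$ be the set of those $B\in\mathscr B_h$ whose core block lies in $\mathscr C$. **Equivalences.** For $0\le i<e$ let $\Phi_i(\boldsymbol\lambda,\boldsymbol a)$ be the charged bipartition with the same bicharge whose two $\beta$-sets are obtained from those of $(\boldsymbol\lambda,\boldsymbol a)$ by exchanging the positions $b-1$ and $b$ for every $b\equiv i \pmod e$. Write $B\to_{\rm Sc}B'$ if for some $i$ no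 bipartition in $B$ has an addable node of residue $i$ and $B'=\Phi_i(B)$; let $\equiv_{\rm Sc}$ be the equivalence relation on $\mathscr B$ generated by $\to_{\rm Sc}$. Write $B\equiv_{\rm Sh}B'$ if the bicharges $\boldsymbol a,\boldsymbol a'$ of $B,B'$ satisfy $a_1-a_2\equiv a'_1-a'_2\pmod e$ and $B'=\{(\boldsymbol\lambda,\boldsymbol a') : (\boldsymbol\lambda,\boldsymbol a)\in B\}$. Let $\equiv_{\rm S}$ be the equivalence relation generated by $\equiv_{\rm Sc}$ and $\equiv_{\rm Sh}$. **Parameters.** For $t=(t_0,\dots,t_{e-1})\in\mathbb Z^e$ let $I_t=\{i : t_i \text{ odd}\}$, ordered by $i\prec j$ iff $t_i<t_j$, or $t_i=t_j$ and $i<j$. Let $\mathscr T$ be the set of triples $(t,n,p)$ with $n,p\in\mathbb Z_{\ge0}$ and $n+p=|I_t|$. For $T=(t,n,p)\in\mathscr T$ let $I^-$ consist of the $n$ smallest elements of $I_t$ and $I^+=I_t\setminus I^-$, and let $\phi(T)$ be the block containing the charged bicore with $b_{i1}=b_{i2}=t_i/2$ for $i\notin I_t$, $(b_{i1},b_{i2})=(\frac{t_i+1}2,\frac{t_i-1}2)$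 for $i\in I^-$, and $(b_{i1},b_{i2})=(\frac{t_i-1}2,\frac{t_i+1}2)$ for $i\in I^+$. For $B$ with core block in $\mathscr C$, $\psi(B)=T$ means that the core block of $B$ is $\phi(T)$. **Minimality.** Let $T=(t,n,p)\in\mathscr T$ and $h\ge0$. With indices mod $e$, put $d_i=2$ if $\min\{n,p\}>0$ and $t_{i-1},t_i$ are both odd, and $d_i=0$ otherwise. $T$ is *$h$-Scopes-minimal* if, for $1\le i\le e-1$, $t_i=t_{i-1}$ or $t_i-t_{i-1}<2h+d_i$, and moreover $t_0=t_{e-1}+2$ or $t_0-t_{e-1}<2h+2+d_0$. Consider the condition (N): if $p>0$ then $n>0$, and if $p=0$ then $n<e$. $T$ is *Type 1 $h$-minimal* if it is $h$-Scopes-minimal, (N) holds, $\min\{t_0,t_1,\dots,t_{e-1}\}\in\{1,2\}$ and $\sum_i t_i\equiv p-n\pmod{2e}$. $T$ is *Type 2 $h$-minimal* if it is $h$-Scopes-minimal, (N) holds, $t_0\in\{1,2\}$, and $t_i\ge1$ for $1\le i\le e-1$. **Theorem.** Let $h\ge0$. Every $B\in\mathscr B^\circ_h$ has a unique parameter $\psi(B)\in\mathscr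 T$, and: 1. $\{B\in\mathscr B^\circ_h : \psi(B)\text{ is Type 1 }h\text{-minimal}\}$ is a complete set of representatives of the $\equiv_{\rm S}$-classes of $\mathscr B_h$. 2. $\{B\in\mathscr B^\circ_h : \psi(B)\text{ is Type 2 }h\text{-minimal}\}$ is a complete set of representatives of the $\equiv_{\rm S}$-classes of $\mathscr B_h$. 3. Hence for $m=1,2$ the $\equiv_{\rm S}$-classes of $\mathscr B_h$ are in bijection with the Type $m$ $h$-minimal $T\in\mathscr T$: for each such $T$ there is a unique $D\in\mathscr B^\circ_h$ with $\psi(D)=T$, and $T$ corresponds to the class of $D$. 4. $\{B\in\mathscr B^\circ_h : \psi(B)\text{ is }h\text{-Scopes-minimal}\}$ is a complete set of representatives of the $\equiv_{\rm Sc}$-classes of $\mathscr B^\circ_h$. 5. Every $\equiv_{\rm Sc}$-class in $\mathscr B$ contains a unique block $B$ (its Scopes-minimal block) such that $n(B)\le n(B')$ for all $B'$ in the class. Parts 1 and 3 (for Type 1) also hold if, in the definition of Type 1 $h$-minimal, $\min\{t_0,t_1,\dots,t_{e-1}\}$ is replaced by $\min\{t_1,\dots,t_{e-1}\}$. -/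

import Mathlib

/-!
# Combinatorial blocks of bipartitions, Scopes and shift equivalence

Throughout `e` is a natural number, of interest for `2 ≤ e`.  Rows, columns and the two
components of a bipartition are numbered from `0`, so the residue `c - r + a` of a node is the same
as with numbering from `1`.
-/

namespace CombBlock

/-! ### Bipartitions, bicharges, residues -/

/-- A bipartition: a pair of partitions, each given by its Young diagram. -/
abbrev Bipartition : Type := Fin 2 → YoungDiagram

/-- A bicharge `(a₁, a₂)`. -/
abbrev Bicharge : Type := Fin 2 → ℤ

/-- A charged bipartition `(λ, a)`, equivalently a pair of abacus configurations. -/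
abbrev Charged : Type := Bipartition × Bicharge

/-- The size `|λ|` of a bipartition. -/
def size (l : Bipartition) : ℕ := ∑ k, (l k).card

/-- The residue `c - r + a` modulo `e` of the node `(r, c)` for the charge `a`. -/
def residue (e : ℕ) (a : ℤ) (x : ℕ × ℕ) : ZMod e := (((x.2 : ℤ) - (x.1 : ℤ) + a : ℤ) : ZMod e)

/-- The multiset of the residues of all nodes of a charged bipartition. -/
def residues (e : ℕ) (x : Charged) : Multiset (ZMod e) :=
  ∑ k, (x.1 k).cells.val.map (residue e (x.2 k))

/-- `(λ, a) ∼ (μ, a')` if `a = a'` and the residue multisets agree. -/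
def sim (e : ℕ) : Setoid Charged where
  r x y := x.2 = y.2 ∧ residues e x = residues e y
  iseqv :=
    { refl := fun _ => ⟨rfl, rfl⟩
      symm := fun h => ⟨h.1.symm, h.2.symm⟩
      trans := fun h h' => ⟨h.1.trans h'.1, h.2.trans h'.2⟩ }

/-- Combinatorial blocks: the equivalence classes of `∼`. -/
abbrev Block (e : ℕ) : Type := {B : Set Charged // B ∈ (sim e).classes}

/-! ### Rim hooks, bicores, core blocks -/

/-- The two nodes share an edge. -/
def Adjacent (x y : ℕ × ℕ) : Prop :=
  (x.1 = y.1 ∧ (x.2 + 1 = y.2 ∨ y.2 + 1 = x.2)) ∨ (x.2 = y.2 ∧ (x.1 + 1 = y.1 ∨ y.1 + 1 = x.1))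

/-- The rim of a Young diagram: the nodes `(r, c)` such that `(r + 1, c + 1)` is not a node. -/
def rim (l : YoungDiagram) : Set (ℕ × ℕ) := {x | x ∈ l ∧ (x.1 + 1, x.2 + 1) ∉ l}

/-- The set of nodes `S` is connected. -/
def NodesConnected (S : Finset (ℕ × ℕ)) : Prop :=
  ∀ x ∈ S, ∀ y ∈ S, Relation.ReflTransGen (fun u v => Adjacent u v ∧ v ∈ S) x y

/-- `m` is obtained from the partition `l` by removing one `e`-rim hook. -/
def RemovesHook (e : ℕ) (l m : YoungDiagram) : Prop :=
  ∃ S : Finset (ℕ × ℕ), (S : Set (ℕ × ℕ)) ⊆ rim l ∧ NodesConnected S ∧ S.card = e ∧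
    m.cells = l.cells \ S

/-- `m` is obtained from the bipartition `l` by removing one `e`-rim hook. -/
def RemovesBiHook (e : ℕ) (l m : Bipartition) : Prop :=
  ∃ k, RemovesHook e (l k) (m k) ∧ ∀ j, j ≠ k → m j = l j

/-- A bicore has no removable `e`-rim hook. -/
def IsBicore (e : ℕ) (l : Bipartition) : Prop := ∀ m, ¬ RemovesBiHook e l m

/-- `HookChain e w l m`: removing `w` successive `e`-rim hooks from `l` yields `m`. -/
inductive HookChain (e : ℕ) : ℕ → Bipartition → Bipartition → Prop
  | nil (l : Bipartition) : HookChain e 0 l l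
  | cons {w : ℕ} {l m n : Bipartition} :
      RemovesBiHook e l m → HookChain e w m n → HookChain e (w + 1) l n

/-- `κ` is the bicore obtained from `l` by repeatedly removing `e`-rim hooks, and `w` hooks are
removed in the process. -/
def ReducesTo (e w : ℕ) (l κ : Bipartition) : Prop := HookChain e w l κ ∧ IsBicore e κ

/-- The number `h(B)`: the maximum over `(λ, a) ∈ B` of the number of `e`-rim hooks removed in
passing from `λ` to its bicore. -/
def HasHooks (e : ℕ) (B : Block e) (h : ℕ) : Prop :=
  IsGreatest {w : ℕ | ∃ x ∈ B.1, ∃ κ, ReducesTo e w x.1 κ} h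

/-- The core block of `B`: all `(κ, a)` with `κ` the bicore of some `(λ, a) ∈ B` from which
`h(B)` hooks can be removed. -/
def coreBlock (e : ℕ) (B : Block e) : Set Charged :=
  {y | ∃ x ∈ B.1, ∃ h, HasHooks e B h ∧ ReducesTo e h x.1 y.1 ∧ y.2 = x.2}

/-! ### The abacus -/

/-- The `β`-set of the partition `l` for the charge `a`. -/
def betaSet (a : ℤ) (l : YoungDiagram) : Set ℤ :=
  Set.range fun r : ℕ => (l.rowLen r : ℤ) - ((r : ℤ) + 1) + a

/-- The row of the last bead on runner `i` of the `k`-th abacus of `(λ, a)`.  (The set of bead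
positions on a runner is non-empty and bounded above, so the supremum is a maximum.) -/
noncomputable def lastRow (e : ℕ) (x : Charged) (i : Fin e) (k : Fin 2) : ℤ :=
  (sSup {b : ℤ | b ∈ betaSet (x.2 k) (x.1 k) ∧ b ≡ (i : ℕ) [ZMOD e]} - (i : ℕ)) / e

/-- The core blocks that have a base tuple. -/
def baseCores (e : ℕ) : Set (Set Charged) :=
  {C | C ∈ (sim e).classes ∧ (∀ x ∈ C, IsBicore e x.1) ∧
    ∃ b : Fin e → ℤ, ∀ x ∈ C, ∀ i k, lastRow e x i k = b i ∨ lastRow e x i k = b i + 1}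

/-- The blocks `B` with `h(B) = h`. -/
def blocksH (e h : ℕ) : Set (Block e) := {B | HasHooks e B h}

/-- The blocks `B` with `h(B) = h` whose core block has a base tuple. -/
def circBlocksH (e h : ℕ) : Set (Block e) := {B | HasHooks e B h ∧ coreBlock e B ∈ baseCores e}

/-! ### Scopes and shift equivalence -/

/-- The effect on a `β`-set of swapping the positions `b - 1` and `b` for all `b ≡ i` mod `e`. -/
def swapBeads (e : ℕ) (i : Fin e) (X : Set ℤ) : Set ℤ :=
  {b | (¬ b ≡ (i : ℕ) - 1 [ZMOD e] ∧ ¬ b ≡ (i : ℕ) [ZMOD e] ∧ b ∈ X) ∨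
    (b ≡ (i : ℕ) [ZMOD e] ∧ b - 1 ∈ X) ∨ (b ≡ (i : ℕ) - 1 [ZMOD e] ∧ b + 1 ∈ X)}

/-- `y = Φᵢ(x)`. -/
def IsSwap (e : ℕ) (i : Fin e) (x y : Charged) : Prop :=
  y.2 = x.2 ∧ ∀ k, betaSet (x.2 k) (y.1 k) = swapBeads e i (betaSet (x.2 k) (x.1 k))

/-- `(λ, a)` has an addable `i`-node. -/
def HasAddable (e : ℕ) (i : Fin e) (x : Charged) : Prop :=
  ∃ k, ∃ n : ℕ × ℕ, n ∉ x.1 k ∧ residue e (x.2 k) n = ((i : ℕ) : ZMod e) ∧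
    ∃ m : YoungDiagram, m.cells = insert n (x.1 k).cells

/-- The Scopes move `B →_{Scᵢ} B'` for some `0 ≤ i < e`: no element of `B` has an addable
`i`-node, and `B' = Φᵢ(B)`. -/
def ScopesMove (e : ℕ) (B B' : Block e) : Prop :=
  ∃ i : Fin e, (∀ x ∈ B.1, ¬ HasAddable e i x) ∧ B'.1 = {y | ∃ x ∈ B.1, IsSwap e i x y}

/-- Shift equivalence: `B` and `B'` have bicharges `a`, `a'` with
`a₁ - a₂ ≡ a'₁ - a'₂` mod `e`, and `B' = {(λ, a') | (λ, a) ∈ B}`. -/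
def ShiftEquiv (e : ℕ) (B B' : Block e) : Prop :=
  ∃ a a' : Bicharge, (∀ x ∈ B.1, x.2 = a) ∧ (∀ y ∈ B'.1, y.2 = a') ∧
    a 0 - a 1 ≡ a' 0 - a' 1 [ZMOD e] ∧ B'.1 = {y | ∃ x ∈ B.1, y = (x.1, a')}

/-- The equivalence relation generated by Scopes moves. -/
def ScopesEquiv (e : ℕ) : Block e → Block e → Prop := Relation.EqvGen (ScopesMove e)

/-- The equivalence relation generated by Scopes equivalence and shift equivalence. -/
def SEquiv (e : ℕ) : Block e → Block e → Prop :=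
  Relation.EqvGen fun B B' => ScopesEquiv e B B' ∨ ShiftEquiv e B B'

/-! ### The parametrising set -/

/-- `I_t`: the indices at which `t` is odd. -/
def oddIdx {e : ℕ} (t : Fin e → ℤ) : Finset (Fin e) := Finset.univ.filter fun i => Odd (t i)

/-- The triples `(t, n, p)` with `n + p = |I_t|`. -/
structure Triple (e : ℕ) where
  /-- the sequence `t` -/
  t : Fin e → ℤ
  /-- the number `n` -/
  n : ℕ
  /-- the number `p` -/
  p : ℕ
  card_eq : n + p = (oddIdx t).card

/-- `i ≺ j` if `t i < t j`, or `t i = t j` and `i < j`. -/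
def Prec {e : ℕ} (t : Fin e → ℤ) (i j : Fin e) : Prop := t i < t j ∨ (t i = t j ∧ i < j)

/-- `I⁻`: the `n` smallest elements of `I_t` for `≺`. -/
def IMinus {e : ℕ} (T : Triple e) : Set (Fin e) :=
  {i | i ∈ oddIdx T.t ∧ {j | j ∈ oddIdx T.t ∧ Prec T.t j i}.ncard < T.n}

/-- `I⁺ = I_t \ I⁻`. -/
def IPlus {e : ℕ} (T : Triple e) : Set (Fin e) := {i | i ∈ oddIdx T.t ∧ i ∉ IMinus T}

/-- `x = φ*(T)`: the charged bicore with the prescribed last beads (all divisions are exact). -/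
def IsPhiStar (e : ℕ) (T : Triple e) (x : Charged) : Prop :=
  IsBicore e x.1 ∧
    (∀ i, i ∉ oddIdx T.t → ∀ k, lastRow e x i k = T.t i / 2) ∧
    (∀ i ∈ IMinus T, lastRow e x i 0 = (T.t i + 1) / 2 ∧ lastRow e x i 1 = (T.t i - 1) / 2) ∧
    (∀ i ∈ IPlus T, lastRow e x i 0 = (T.t i - 1) / 2 ∧ lastRow e x i 1 = (T.t i + 1) / 2)

/-- `φ(T)`: the `∼`-class of `φ*(T)`. -/
def phi (e : ℕ) (T : Triple e) : Set Charged := {y | ∃ x, IsPhiStar e T x ∧ sim e x y}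

/-- `ψ(B) = T`: the core block of `B` is `φ(T)`. -/
def IsPsi (e : ℕ) (B : Block e) (T : Triple e) : Prop := coreBlock e B = phi e T

/-! ### Minimality -/

/-- The number `dᵢ`, where `u = tᵢ₋₁` and `v = tᵢ`. -/
def dTerm (n p : ℕ) (u v : ℤ) : ℤ := if 0 < min n p ∧ Odd u ∧ Odd v then 2 else 0

/-- `T` is `h`-Scopes-minimal. In the first clause `j = i - 1`; in the second `i = 0` and
`j = e - 1`. -/
def ScopesMinimal {e : ℕ} (h : ℕ) (T : Triple e) : Prop :=
  (∀ i j : Fin e, (i : ℕ) = (j : ℕ) + 1 →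
    T.t i = T.t j ∨ T.t i - T.t j < 2 * h + dTerm T.n T.p (T.t j) (T.t i)) ∧
  (∀ i j : Fin e, (i : ℕ) = 0 → (j : ℕ) + 1 = e →
    T.t i = T.t j + 2 ∨ T.t i - T.t j < 2 * h + 2 + dTerm T.n T.p (T.t j) (T.t i))

/-- If `p > 0` then `n > 0`, and if `p = 0` then `n < e`. -/
def NormalCharge {e : ℕ} (T : Triple e) : Prop := (0 < T.p → 0 < T.n) ∧ (T.p = 0 → T.n < e)

/-- `T` is Type 1 `h`-minimal. -/
def Type1Minimal {e : ℕ} (h : ℕ) (T : Triple e) : Prop :=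
  ScopesMinimal h T ∧ NormalCharge T ∧
  (∃ m : ℤ, (m = 1 ∨ m = 2) ∧ IsLeast {u | ∃ i : Fin e, T.t i = u} m) ∧
  (∑ i, T.t i) ≡ (T.p : ℤ) - (T.n : ℤ) [ZMOD 2 * e]

/-- The variant of Type 1 `h`-minimality in which the minimum omits `t₀`. -/
def Type1MinimalAlt {e : ℕ} (h : ℕ) (T : Triple e) : Prop :=
  ScopesMinimal h T ∧ NormalCharge T ∧
  (∃ m : ℤ, (m = 1 ∨ m = 2) ∧ IsLeast {u | ∃ i : Fin e, 1 ≤ (i : ℕ) ∧ T.t i = u} m) ∧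
  (∑ i, T.t i) ≡ (T.p : ℤ) - (T.n : ℤ) [ZMOD 2 * e]

/-- `T` is Type 2 `h`-minimal. -/
def Type2Minimal {e : ℕ} (h : ℕ) (T : Triple e) : Prop :=
  ScopesMinimal h T ∧ NormalCharge T ∧
  (∀ i : Fin e, (i : ℕ) = 0 → T.t i = 1 ∨ T.t i = 2) ∧ (∀ i : Fin e, 1 ≤ (i : ℕ) → 1 ≤ T.t i)

/-! ### Representatives -/

/-- The blocks `B` with `h(B) = h`, with core block admitting a base tuple, such that `ψ(B)`
satisfies `P`. -/
def blocksWith (e h : ℕ) (P : Triple e → Prop) : Set (Block e) :=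
  {B | B ∈ circBlocksH e h ∧ ∃ T, IsPsi e B T ∧ P T}

/-- `S` is a complete set of representatives of the classes of the relation `r` on `X`. -/
def IsReps {α : Type*} (r : α → α → Prop) (X S : Set α) : Prop :=
  S ⊆ X ∧ ∀ B ∈ X, ∃! D, D ∈ S ∧ r D B

/-- The classes of `≡_S` on the blocks with `h(B) = h` are in bijection with the triples that
satisfy `P`, by sending `T` to the class of the block `D` with `h(D) = h` and `ψ(D) = T`. -/
def ClassesIndexedBy (e h : ℕ) (P : Triple e → Prop) : Prop :=
  (∀ T, P T → ∃! D, D ∈ circBlocksH e h ∧ IsPsi e D T) ∧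
  ∀ B ∈ blocksH e h, ∃! T, P T ∧ ∃ D ∈ circBlocksH e h, IsPsi e D T ∧ SEquiv e D B

end CombBlock

/-!
# Classification of blocks of bipartitions up to Scopes and shift equivalence

A charged bipartition is a pair of bead configurations on an abacus with `e` runners. The charges
of the runners, read off at every integer position `j`, give two sequences; let `tv` be their sum
(minus `2`) and `dl` their difference. A block is determined by its bicharge, the sequence `tv` and
the number `wt`, which is four times the number of rim hooks plus the sum of the squares of `dl`
over a period (`sim_iff`), and all values permitted by parity occur (`exists_charged`). The numbers
`dl` have the parity of `tv` and add up to the difference of the charges. Hence the core block of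
`B` has a base tuple if and only if the absolute value of this difference is at most the number of
odd entries of `tv` (`mem_circBlocksH_iff`). In that case `ψ(B)` records `tv` on a period, and the
difference as `n - p` (`isPsi_iff`). This makes `ψ` a bijection for every fixed number of hooks.

A Scopes move swaps two neighbouring runners and lowers the size, unless it fixes the block. Moves
at distant positions commute, moves at neighbouring positions satisfy a braid relation, and for
`e = 2` two different moves are never both available. By Newman's lemma every Scopes class contains
exactly one block without a proper move, and this is its block of least size (`existsUnique_min`).
A move at `i` is available exactly if `tᵢ - tᵢ₋₁` reaches `2 h + dᵢ` (`noAdd_iff_le`): a bead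
without a neighbour on the next runner costs hooks, and conversely all hooks can be spent on a single
bead. So the Scopes-minimal triples are the parameters of the blocks without a proper move
(`normal_iff_scopesMinimal`).

Shifts translate all residues and therefore carry Scopes moves to Scopes moves. It follows that
minimal blocks in the same `≡_S`-class are shifts of each other (`Normal.shiftEquiv`). A shift of
the charges by `s` and `s + e m` turns `tv` into `j ↦ tv (j - s) + m`. For odd `m` this exchanges
odd and even entries, and because two intervals of lengths `2 o` and `2 (e - o)` tile the integers
modulo `2 e`, exactly one value of `m` makes the core block have a base tuple and the difference of
the charges satisfy condition (N) (`exists_shift_normalCharge`, `ShiftEquiv.charge_diff_eq`). What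
remains is the choice of `s`. In Type 1 the congruence fixes `s` modulo `e` and the minimum fixes
the multiple of `e` (`existsUnique_rotation1`); in Type 2 the window is the one that ends just before
the first nonpositive entry (`existsUnique_rotation2`).
-/

namespace CombBlock

/-! ### Diagonals of Young diagrams -/

/-- The node with index `i` on the diagonal `column - row = c`. -/
def diagNode (c : ℤ) (i : ℕ) : ℕ × ℕ := (i + (-c).toNat, i + c.toNat)

/-- The content `column - row` of a node. -/
def cont (x : ℕ × ℕ) : ℤ := (x.2 : ℤ) - x.1

/-- The number of nodes of `l` on the diagonal of content `c`. -/
def diagLen (l : YoungDiagram) (c : ℤ) : ℕ := (l.cells.filter fun x => cont x = c).card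

lemma cont_diagNode (c : ℤ) (i : ℕ) : cont (diagNode c i) = c := by
  simp only [cont, diagNode]; push_cast; omega

lemma diagNode_cont (x : ℕ × ℕ) : diagNode (cont x) (min x.1 x.2) = x := by
  rcases x with ⟨a, b⟩
  simp only [cont, diagNode, Prod.mk.injEq]
  omega

lemma diagNode_injective (c : ℤ) : Function.Injective (diagNode c) := by
  intro i j h
  simp only [diagNode, Prod.mk.injEq] at h
  omega

lemma mem_of_le {l : YoungDiagram} {x y : ℕ × ℕ} (h1 : y.1 ≤ x.1) (h2 : y.2 ≤ x.2) (hx : x ∈ l) :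
    y ∈ l :=
  l.up_left_mem h1 h2 hx

lemma diagNode_mem_of_le {l : YoungDiagram} {c : ℤ} {i j : ℕ} (h : i ≤ j)
    (hj : diagNode c j ∈ l) : diagNode c i ∈ l := by
  refine mem_of_le ?_ ?_ hj <;> simp only [diagNode] <;> omega

/-- The nodes of a diagonal are those with the smallest indices. -/
lemma diagNode_mem_iff {l : YoungDiagram} {c : ℤ} {i : ℕ} :
    diagNode c i ∈ l ↔ i < diagLen l c := by
  classical
  have hex : ∃ n, diagNode c n ∉ l := by
    by_contra! hall
    have : (Set.range (diagNode c)) ⊆ (l.cells : Set (ℕ × ℕ)) := by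
      rintro _ ⟨n, rfl⟩
      exact hall n
    exact Set.infinite_range_of_injective (diagNode_injective c) (l.cells.finite_toSet.subset this)
  have key : ∀ j, diagNode c j ∈ l ↔ j < Nat.find hex := by
    intro j
    rw [Nat.lt_find_iff]
    refine ⟨fun hj m hm => not_not.2 (diagNode_mem_of_le hm hj), fun h => not_not.1 (h j le_rfl)⟩
  have : diagLen l c = Nat.find hex := by
    have h1 : (l.cells.filter fun x => cont x = c) = (Finset.range (Nat.find hex)).image (diagNode c) := by
      ext x
      simp only [Finset.mem_filter, YoungDiagram.mem_cells, Finset.mem_image, Finset.mem_range]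
      constructor
      · rintro ⟨hx, rfl⟩
        refine ⟨min x.1 x.2, ?_, diagNode_cont x⟩
        rw [← key, diagNode_cont]; exact hx
      · rintro ⟨n, hn, rfl⟩
        exact ⟨(key n).2 hn, cont_diagNode c n⟩
    rw [diagLen, h1, Finset.card_image_of_injective _ (diagNode_injective c), Finset.card_range]
  rw [this, key]

lemma mem_iff_lt_diagLen {l : YoungDiagram} {x : ℕ × ℕ} :
    x ∈ l ↔ min x.1 x.2 < diagLen l (cont x) := by
  rw [← diagNode_mem_iff, diagNode_cont]

lemma diagLen_ext {l m : YoungDiagram} (h : ∀ c, diagLen l c = diagLen m c) : l = m := by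
  ext x
  rw [YoungDiagram.mem_cells, YoungDiagram.mem_cells, mem_iff_lt_diagLen, mem_iff_lt_diagLen, h]

lemma diagLen_succ_of_nonneg (l : YoungDiagram) {c : ℤ} (hc : 0 ≤ c) :
    diagLen l (c + 1) ≤ diagLen l c ∧ diagLen l c ≤ diagLen l (c + 1) + 1 := by
  constructor
  · by_contra! h
    have h1 := diagNode_mem_iff.2 h
    refine lt_irrefl _ (diagNode_mem_iff.1 (mem_of_le ?_ ?_ h1) : diagLen l c < diagLen l c) <;>
      simp only [diagNode] <;> omega
  · by_contra! h
    have h1 := diagNode_mem_iff.2 h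
    refine lt_irrefl _ (diagNode_mem_iff.1 (mem_of_le ?_ ?_ h1) :
      diagLen l (c + 1) < diagLen l (c + 1)) <;> simp only [diagNode] <;> omega

lemma diagLen_succ_of_neg (l : YoungDiagram) {c : ℤ} (hc : c < 0) :
    diagLen l c ≤ diagLen l (c + 1) ∧ diagLen l (c + 1) ≤ diagLen l c + 1 := by
  constructor
  · by_contra! h
    have h1 := diagNode_mem_iff.2 h
    refine lt_irrefl _ (diagNode_mem_iff.1 (mem_of_le ?_ ?_ h1) :
      diagLen l (c + 1) < diagLen l (c + 1)) <;> simp only [diagNode] <;> omega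
  · by_contra! h
    have h1 := diagNode_mem_iff.2 h
    refine lt_irrefl _ (diagNode_mem_iff.1 (mem_of_le ?_ ?_ h1) : diagLen l c < diagLen l c) <;>
      simp only [diagNode] <;> omega

/-! ### Bead indicators -/

open Classical in
/-- The difference of the indicator functions of `X` and of the negative integers. -/
noncomputable def beadDiff (X : Set ℤ) (x : ℤ) : ℤ :=
  (if x ∈ X then 1 else 0) - (if x < 0 then 1 else 0)

lemma beadDiff_injective {X Y : Set ℤ} (h : ∀ x, beadDiff X x = beadDiff Y x) : X = Y := by
  ext x
  have := h x
  simp only [beadDiff] at this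
  by_cases h1 : x ∈ X <;> by_cases h2 : x ∈ Y <;> simp only [h1, h2, if_true, if_false] at * <;> omega

lemma mem_betaSet_shift {a c : ℤ} {l : YoungDiagram} :
    c ∈ betaSet a l ↔ c - a ∈ betaSet 0 l := by
  simp only [betaSet, Set.mem_range]
  constructor
  · rintro ⟨r, rfl⟩; exact ⟨r, by ring⟩
  · rintro ⟨r, h⟩; exact ⟨r, by linarith⟩

lemma mem_betaSet_of_nonneg {l : YoungDiagram} {c : ℤ} (hc : 0 ≤ c) :
    c ∈ betaSet 0 l ↔ diagLen l (c + 1) < diagLen l c := by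
  have h1 : ∀ r : ℕ, (r < diagLen l c ↔ c + r < l.rowLen r) := by
    intro r
    rw [← diagNode_mem_iff, diagNode, YoungDiagram.mem_iff_lt_rowLen]
    rw [show (-c).toNat = 0 by omega, Nat.add_zero]; omega
  have h2 : ∀ r : ℕ, (r < diagLen l (c + 1) ↔ c + 1 + r < l.rowLen r) := by
    intro r
    rw [← diagNode_mem_iff, diagNode, YoungDiagram.mem_iff_lt_rowLen]
    rw [show (-(c + 1)).toNat = 0 by omega, Nat.add_zero]; omega
  simp only [betaSet, Set.mem_range]
  constructor
  · rintro ⟨r, hr⟩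
    have := h1 r; have := h2 r; omega
  · intro h
    refine ⟨diagLen l (c + 1), ?_⟩
    have := h1 (diagLen l (c + 1)); have := h2 (diagLen l (c + 1)); omega

/-- For negative `c` the diagonal of content `c` starts in row `-c`, so that a row ending exactly at
content `c` is visible as the diagonal `c` being as long as the next one. -/
lemma mem_betaSet_of_neg {l : YoungDiagram} {c : ℤ} (hc : c < 0) :
    c ∈ betaSet 0 l ↔ diagLen l (c + 1) ≤ diagLen l c := by
  obtain ⟨g, rfl⟩ : ∃ g : ℕ, c = -((g : ℤ) + 1) := ⟨(-c - 1).toNat, by omega⟩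
  have h1 : ∀ j : ℕ, (j < diagLen l (-((g : ℤ) + 1)) ↔ j < l.rowLen (j + g + 1)) := by
    intro r
    rw [← diagNode_mem_iff, diagNode, YoungDiagram.mem_iff_lt_rowLen]
    rw [show (-((g : ℤ) + 1)).toNat = 0 by omega, show (-(-((g : ℤ) + 1))).toNat = g + 1 by omega]
    rfl
  have h2 : ∀ j : ℕ, (j < diagLen l (-((g : ℤ) + 1) + 1) ↔ j < l.rowLen (j + g)) := by
    intro r
    rw [← diagNode_mem_iff, diagNode, YoungDiagram.mem_iff_lt_rowLen]
    rw [show (-((g : ℤ) + 1) + 1).toNat = 0 by omega,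
      show (-(-((g : ℤ) + 1) + 1)).toNat = g by omega]
    rfl
  simp only [betaSet, Set.mem_range]
  constructor
  · rintro ⟨r, hr⟩
    obtain ⟨j, rfl⟩ : ∃ j, r = j + g := ⟨r - g, by omega⟩
    have := h2 j
    by_contra! h
    rcases Nat.eq_zero_or_pos j with rfl | hj
    · omega
    · have := h1 (j - 1)
      rw [show j - 1 + g + 1 = j + g by omega] at this
      omega
  · intro h
    refine ⟨diagLen l (-((g : ℤ) + 1) + 1) + g, ?_⟩
    have h3 := h2 (diagLen l (-((g : ℤ) + 1) + 1))
    rcases Nat.eq_zero_or_pos (diagLen l (-((g : ℤ) + 1) + 1)) with h0 | hj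
    · rw [h0] at h3 ⊢; simp at h3 ⊢; omega
    · have := h1 (diagLen l (-((g : ℤ) + 1) + 1) - 1)
      rw [show diagLen l (-((g : ℤ) + 1) + 1) - 1 + g + 1 =
        diagLen l (-((g : ℤ) + 1) + 1) + g by omega] at this
      omega

/-- The beads of the uncharged `β`-set are the descents of the diagonal lengths. -/
lemma beadDiff_betaSet_zero (l : YoungDiagram) (c : ℤ) :
    beadDiff (betaSet 0 l) c = (diagLen l c : ℤ) - diagLen l (c + 1) := by
  simp only [beadDiff]
  rcases lt_or_ge c 0 with hc | hc
  · have := diagLen_succ_of_neg l hc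
    rw [if_pos hc]
    split_ifs with h <;> rw [mem_betaSet_of_neg hc] at h <;> omega
  · have := diagLen_succ_of_nonneg l hc
    rw [if_neg (not_lt.2 hc)]
    split_ifs with h <;> rw [mem_betaSet_of_nonneg hc] at h <;> omega

lemma diagLen_eq_zero (l : YoungDiagram) : ∃ N : ℕ, ∀ c : ℤ, (N : ℤ) ≤ |c| → diagLen l c = 0 := by
  refine ⟨l.cells.sup (fun x => x.1 + x.2) + 1, fun c hc => ?_⟩
  rw [diagLen, Finset.card_eq_zero, Finset.filter_eq_empty_iff]
  rintro x hx rfl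
  have := Finset.le_sup (f := fun x : ℕ × ℕ => x.1 + x.2) hx
  simp only [cont] at *
  rcases abs_cases ((x.2 : ℤ) - x.1) with h | h <;> omega

/-- A function that is known far out is determined by its consecutive differences. -/
lemma eq_of_tail {f g : ℤ → ℕ} {N : ℕ} (hf : ∀ c : ℤ, (N : ℤ) ≤ c → f c = g c)
    (h : ∀ c, (f c : ℤ) - f (c + 1) = g c - g (c + 1)) : ∀ c, f c = g c := by
  have : ∀ k : ℕ, ∀ c : ℤ, (N : ℤ) - k ≤ c → f c = g c := by
    intro k
    induction k with
    | zero => intro c hc; exact hf c (by simpa using hc)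
    | succ k ih =>
      intro c hc
      have := h c
      have := ih (c + 1) (by push_cast at hc; omega)
      omega
  intro c
  exact this (N - c).toNat c (by omega)

lemma betaSet_injective (a : ℤ) : Function.Injective (betaSet a) := by
  intro l m h
  have h0 : betaSet 0 l = betaSet 0 m := by
    ext c
    have : c + a ∈ betaSet a l ↔ c + a ∈ betaSet a m := by rw [h]
    rw [mem_betaSet_shift, mem_betaSet_shift (l := m)] at this
    simpa using this
  obtain ⟨N, hN⟩ := diagLen_eq_zero l
  obtain ⟨M, hM⟩ := diagLen_eq_zero m
  refine diagLen_ext (eq_of_tail (N := N + M) ?_ ?_)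
  · intro c hc
    rw [hN c, hM c] <;> rw [abs_of_nonneg] <;> push_cast at hc <;> omega
  · intro c
    rw [← beadDiff_betaSet_zero, ← beadDiff_betaSet_zero, h0]

/-- A set of bead positions: it contains all small integers and no large ones. -/
def Maya (X : Set ℤ) : Prop := ∃ N : ℕ, (∀ x : ℤ, x < -N → x ∈ X) ∧ ∀ x : ℤ, N ≤ x → x ∉ X

lemma maya_betaSet (a : ℤ) (l : YoungDiagram) : Maya (betaSet a l) := by
  obtain ⟨N, hN⟩ := diagLen_eq_zero l
  have key : ∀ c : ℤ, (N : ℤ) + 1 ≤ |c| → beadDiff (betaSet 0 l) c = 0 := by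
    intro c hc
    rw [beadDiff_betaSet_zero, hN c, hN (c + 1)] <;>
    rcases abs_cases c with h | h <;> rcases abs_cases (c + 1) with h' | h' <;> omega
  simp only [beadDiff] at key
  refine ⟨N + 1 + a.natAbs, fun x hx => ?_, fun x hx => ?_⟩ <;> rw [mem_betaSet_shift]
  · have := key (x - a) (by rcases abs_cases (x - a) with h | h <;> omega)
    rw [if_pos (by omega : x - a < 0)] at this
    by_contra h
    rw [if_neg h] at this; omega
  · have := key (x - a) (by rcases abs_cases (x - a) with h | h <;> omega)
    rw [if_neg (by omega : ¬ x - a < 0)] at this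
    intro h
    rw [if_pos h] at this; omega

/-! ### Linear functionals of bead sets -/

lemma beadDiff_of_mem {X : Set ℤ} {x : ℤ} (h : x ∈ X) :
    beadDiff X x = 1 - (if x < 0 then 1 else 0) := by rw [beadDiff, if_pos h]

lemma beadDiff_of_notMem {X : Set ℤ} {x : ℤ} (h : x ∉ X) :
    beadDiff X x = 0 - (if x < 0 then 1 else 0) := by rw [beadDiff, if_neg h]

lemma Maya.finite_support {X : Set ℤ} (hX : Maya X) : (Function.support (beadDiff X)).Finite := by
  obtain ⟨N, h1, h2⟩ := hX
  refine (Set.finite_Ico (-N : ℤ) N).subset fun x hx => ?_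
  rw [Function.mem_support] at hx
  by_contra h
  rw [Set.mem_Ico, not_and_or] at h
  apply hx
  simp only [beadDiff]
  rcases h with h | h
  · rw [if_pos (h1 x (by omega)), if_pos (by omega)]; rfl
  · rw [if_neg (h2 x (by omega)), if_neg (by omega)]; rfl

open Classical in
/-- `beadDiff X` as a finitely supported function (zero if `X` is not a set of bead positions). -/
noncomputable def beadFun (X : Set ℤ) : ℤ →₀ ℤ :=
  if h : (Function.support (beadDiff X)).Finite then Finsupp.ofSupportFinite (beadDiff X) h else 0

lemma Maya.beadFun_apply {X : Set ℤ} (hX : Maya X) (x : ℤ) : beadFun X x = beadDiff X x := by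
  rw [beadFun, dif_pos hX.finite_support]; rfl

/-- The sum of `f` over the beads of `X`, regularised by subtracting the sum of `f` over the
negative integers. -/
noncomputable def beadSum (f : ℤ → ℤ) (X : Set ℤ) : ℤ :=
  Finsupp.linearCombination ℤ f (beadFun X)

/-- The charge of a set of bead positions. -/
noncomputable def chg (X : Set ℤ) : ℤ := beadSum (fun _ => 1) X

/-- The energy of a set of bead positions. -/
noncomputable def en (X : Set ℤ) : ℤ := beadSum (fun x => x) X

lemma beadSum_add (f g : ℤ → ℤ) (X : Set ℤ) :
    beadSum (fun x => f x + g x) X = beadSum f X + beadSum g X := by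
  simp only [beadSum, Finsupp.linearCombination_apply, smul_add]
  exact Finsupp.sum_add

lemma beadSum_mul (k : ℤ) (g : ℤ → ℤ) (X : Set ℤ) :
    beadSum (fun x => k * g x) X = k * beadSum g X := by
  simp only [beadSum, Finsupp.linearCombination_apply, Finsupp.sum, Finset.mul_sum, smul_eq_mul]
  exact Finset.sum_congr rfl fun _ _ => by ring

lemma maya_Iio (a : ℤ) : Maya (Set.Iio a) :=
  ⟨a.natAbs, fun x hx => by simp only [Set.mem_Iio]; omega, fun x hx => by
    simp only [Set.mem_Iio]; omega⟩

lemma Maya.preimage_add {X : Set ℤ} (hX : Maya X) (c : ℤ) : Maya {x | x + c ∈ X} := by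
  obtain ⟨N, h1, h2⟩ := hX
  exact ⟨N + c.natAbs, fun x hx => h1 _ (by omega),
    fun x hx => h2 _ (by omega)⟩

/-- Moving the bead at `x` to `y`. -/
def moveBead (x y : ℤ) (X : Set ℤ) : Set ℤ := insert y (X \ {x})

lemma Maya.moveBead {X : Set ℤ} (hX : Maya X) (x y : ℤ) : Maya (moveBead x y X) := by
  obtain ⟨N, h1, h2⟩ := hX
  refine ⟨N + x.natAbs + y.natAbs + 1, fun z hz => ?_, fun z hz => ?_⟩ <;>
    simp only [CombBlock.moveBead, Set.mem_insert_iff, Set.mem_sdiff, Set.mem_singleton_iff]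
  · exact Or.inr ⟨h1 z (by omega), by omega⟩
  · rintro (h | h)
    · omega
    · exact h2 z (by omega) h.1

lemma beadSum_moveBead (f : ℤ → ℤ) {X : Set ℤ} (hX : Maya X) {x y : ℤ} (hx : x ∈ X) (hy : y ∉ X) :
    beadSum f (moveBead x y X) = beadSum f X - f x + f y := by
  have : beadFun (moveBead x y X) = beadFun X - Finsupp.single x 1 + Finsupp.single y 1 := by
    ext z
    rw [(hX.moveBead x y).beadFun_apply, Finsupp.add_apply, Finsupp.sub_apply, hX.beadFun_apply,
      Finsupp.single_apply, Finsupp.single_apply]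
    have hxy : x ≠ y := fun h => hy (h ▸ hx)
    have hmem : z ∈ moveBead x y X ↔ z = y ∨ z ∈ X ∧ z ≠ x := by
      simp only [moveBead, Set.mem_insert_iff, Set.mem_sdiff, Set.mem_singleton_iff]
    by_cases h1 : z = x
    · subst h1
      rw [beadDiff_of_notMem (by rw [hmem]; tauto), beadDiff_of_mem hx, if_pos rfl,
        if_neg hxy.symm]
      ring
    · by_cases h2 : z = y
      · subst h2
        rw [beadDiff_of_mem (hmem.2 (Or.inl rfl)), beadDiff_of_notMem hy, if_pos rfl,
          if_neg (Ne.symm h1)]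
        ring
      · rw [if_neg (Ne.symm h1), if_neg (Ne.symm h2)]
        by_cases h3 : z ∈ X
        · rw [beadDiff_of_mem h3, beadDiff_of_mem (by rw [hmem]; tauto)]; ring
        · rw [beadDiff_of_notMem h3, beadDiff_of_notMem (by rw [hmem]; tauto)]; ring
  simp [beadSum, this]

lemma beadFun_Iio_succ (a : ℤ) :
    beadFun (Set.Iio (a + 1)) = beadFun (Set.Iio a) + Finsupp.single a 1 := by
  ext z
  rw [(maya_Iio _).beadFun_apply, Finsupp.add_apply, (maya_Iio _).beadFun_apply,
    Finsupp.single_apply]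
  simp only [beadDiff, Set.mem_Iio]
  split_ifs <;> omega

lemma beadSum_Iio_zero (f : ℤ → ℤ) : beadSum f (Set.Iio 0) = 0 := by
  have : beadFun (Set.Iio 0) = 0 := by
    ext z
    rw [(maya_Iio _).beadFun_apply]
    simp only [beadDiff, Set.mem_Iio, sub_self, Finsupp.zero_apply]
  simp [beadSum, this]

lemma beadSum_Iio_succ (f : ℤ → ℤ) (a : ℤ) :
    beadSum f (Set.Iio (a + 1)) = beadSum f (Set.Iio a) + f a := by
  simp [beadSum, beadFun_Iio_succ]

lemma chg_Iio (a : ℤ) : chg (Set.Iio a) = a := by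
  induction a using Int.induction_on with
  | zero => exact beadSum_Iio_zero _
  | succ i ih => rw [chg, beadSum_Iio_succ]; rw [chg] at ih; rw [ih]
  | pred i ih =>
    have := beadSum_Iio_succ (fun _ => 1) (-(i : ℤ) - 1)
    rw [sub_add_cancel] at this
    rw [chg] at ih ⊢; linarith

lemma two_mul_en_Iio (a : ℤ) : 2 * en (Set.Iio a) = a * (a - 1) := by
  induction a using Int.induction_on with
  | zero => rw [en, beadSum_Iio_zero]; rfl
  | succ i ih => rw [en, beadSum_Iio_succ]; rw [en] at ih; rw [mul_add, ih]; ring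
  | pred i ih =>
    have := beadSum_Iio_succ (fun x => x) (-(i : ℤ) - 1)
    rw [sub_add_cancel] at this
    rw [en] at ih ⊢; linarith

lemma chg_preimage_add_one {X : Set ℤ} (hX : Maya X) : chg {x | x + 1 ∈ X} = chg X - 1 := by
  have : beadFun X = Finsupp.mapDomain (fun x => x + 1) (beadFun {x | x + 1 ∈ X}) +
      Finsupp.single 0 1 := by
    ext z
    obtain ⟨z, rfl⟩ : ∃ y, z = y + 1 := ⟨z - 1, by ring⟩
    rw [Finsupp.add_apply, Finsupp.mapDomain_apply (f := fun x : ℤ => x + 1)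
      (fun a b h => by simpa using h), hX.beadFun_apply, (hX.preimage_add 1).beadFun_apply,
      Finsupp.single_apply]
    simp only [beadDiff, Set.mem_ofPred_eq]
    split_ifs <;> omega
  have h2 : chg X = chg {x | x + 1 ∈ X} + 1 := by
    simp only [chg, beadSum]
    rw [this, map_add, Finsupp.linearCombination_mapDomain, Finsupp.linearCombination_single]
    rfl
  rw [h2]; ring

lemma chg_preimage_add {X : Set ℤ} (hX : Maya X) (c : ℤ) : chg {x | x + c ∈ X} = chg X - c := by
  induction c using Int.induction_on with
  | zero => simp
  | succ i ih =>
    have := chg_preimage_add_one (hX.preimage_add i)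
    simp only [Set.mem_ofPred_eq] at this
    rw [show {x : ℤ | x + ((i : ℤ) + 1) ∈ X} = {x | x + 1 + (i : ℤ) ∈ X} by
      ext x; simp only [Set.mem_ofPred_eq]; rw [show x + ((i : ℤ) + 1) = x + 1 + i by ring], this, ih]
    ring
  | pred i ih =>
    have := chg_preimage_add_one (hX.preimage_add (-(i : ℤ) - 1))
    simp only [Set.mem_ofPred_eq] at this
    rw [show {x : ℤ | x + 1 + (-(i : ℤ) - 1) ∈ X} = {x | x + -(i : ℤ) ∈ X} by
      ext x; simp only [Set.mem_ofPred_eq]; rw [show x + 1 + (-(i : ℤ) - 1) = x + -i by ring], ih] at this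
    linarith

/-- A set of bead positions without gaps is determined by its charge. -/
lemma eq_Iio_of_downward {X : Set ℤ} (hX : Maya X) (h : ∀ x, x ∈ X → x - 1 ∈ X) :
    X = Set.Iio (chg X) := by
  obtain ⟨N, h1, h2⟩ := id hX
  have hdown : ∀ (k : ℕ) x, x ∈ X → x - k ∈ X := by
    intro k
    induction k with
    | zero => intro x hx; simpa using hx
    | succ k ih => intro x hx; have := h _ (ih x hx); rwa [show x - ((k + 1 : ℕ) : ℤ) = x - k - 1 by push_cast; ring]
  obtain ⟨q, hq, hmax⟩ := Int.exists_greatest_of_bdd (P := fun x => x ∈ X)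
    ⟨N, fun z hz => by by_contra hc; exact h2 z (by omega) hz⟩ ⟨-N - 1, h1 _ (by omega)⟩
  have : X = Set.Iio (q + 1) := by
    ext x
    simp only [Set.mem_Iio]
    constructor
    · intro hx; have := hmax x hx; omega
    · intro hx
      have := hdown (q - x).toNat q hq
      rwa [show q - ((q - x).toNat : ℤ) = x by omega] at this
  rw [this, chg_Iio]

/-! ### Bead sums of `β`-sets -/

/-- Each node of content `c` raises a bead from `c + a - 1` to `c + a`. -/
lemma beadSum_betaSet (f : ℤ → ℤ) (a : ℤ) (l : YoungDiagram) :
    beadSum f (betaSet a l) = beadSum f (Set.Iio a) +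
      ∑ x ∈ l.cells, (f (cont x + a) - f (cont x + a - 1)) := by
  have : beadFun (betaSet a l) = beadFun (Set.Iio a) +
      ∑ x ∈ l.cells, (Finsupp.single (cont x + a) 1 - Finsupp.single (cont x + a - 1) 1) := by
    ext z
    rw [(maya_betaSet _ _).beadFun_apply, Finsupp.add_apply, (maya_Iio _).beadFun_apply,
      Finsupp.finsetSum_apply]
    simp only [Finsupp.sub_apply, Finsupp.single_apply, Finset.sum_sub_distrib]
    have h0 := beadDiff_betaSet_zero l (z - a)
    have h1 : ((diagLen l (z - a) : ℕ) : ℤ) = ∑ x ∈ l.cells, if cont x + a = z then 1 else 0 := by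
      rw [diagLen, Finset.card_filter]; push_cast
      refine Finset.sum_congr rfl fun x _ => ?_
      simp only [show cont x = z - a ↔ cont x + a = z by omega]
    have h2 : ((diagLen l (z - a + 1) : ℕ) : ℤ) =
        ∑ x ∈ l.cells, if cont x + a - 1 = z then 1 else 0 := by
      rw [diagLen, Finset.card_filter]; push_cast
      refine Finset.sum_congr rfl fun x _ => ?_
      simp only [show cont x = z - a + 1 ↔ cont x + a - 1 = z by omega]
    rw [← h1, ← h2, ← h0]
    by_cases h3 : z ∈ betaSet a l
    · rw [beadDiff_of_mem h3, beadDiff_of_mem (mem_betaSet_shift.1 h3)]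
      simp only [beadDiff, Set.mem_Iio]
      split_ifs <;> omega
    · rw [beadDiff_of_notMem h3, beadDiff_of_notMem (fun h => h3 (mem_betaSet_shift.2 h))]
      simp only [beadDiff, Set.mem_Iio]
      split_ifs <;> omega
  simp [beadSum, this, map_sum]

lemma chg_betaSet (a : ℤ) (l : YoungDiagram) : chg (betaSet a l) = a := by
  have := chg_Iio a
  rw [chg] at this ⊢
  rw [beadSum_betaSet, this]; simp

lemma en_betaSet (a : ℤ) (l : YoungDiagram) :
    2 * en (betaSet a l) = a * (a - 1) + 2 * l.card := by
  have := two_mul_en_Iio a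
  rw [en] at this ⊢
  rw [beadSum_betaSet, mul_add, this]; simp

/-- Finitely supported diagonal lengths that change by at most one from each diagonal to the next,
weakly decreasing away from the main diagonal, are those of a Young diagram. -/
lemma exists_diagram_of_diagLen (f : ℤ → ℕ) (N : ℕ) (hN : ∀ c : ℤ, (N : ℤ) ≤ |c| → f c = 0)
    (hpos : ∀ c, 0 ≤ c → f (c + 1) ≤ f c ∧ f c ≤ f (c + 1) + 1)
    (hneg : ∀ c, c < 0 → f c ≤ f (c + 1) ∧ f (c + 1) ≤ f c + 1) :
    ∃ l : YoungDiagram, ∀ c, diagLen l c = f c := by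
  -- the diagonals are short enough for the diagram to fit into an `N × N` square
  have hb : ∀ k : ℕ, ∀ c : ℤ, (N : ℤ) ≤ |c| + k → f c + |c| ≤ N ∨ f c = 0 := by
    intro k
    induction k with
    | zero => intro c hc; right; exact hN c (by simpa using hc)
    | succ k ih =>
      intro c hc
      by_cases h3 : (N : ℤ) ≤ |c|
      · right; exact hN c h3
      rcases lt_or_ge c 0 with h | h
      · have h2 := hneg (c - 1) (by omega)
        have h1 := ih (c - 1)
        rw [sub_add_cancel] at h2
        rw [abs_of_neg h] at *
        rw [abs_of_neg (by omega : c - 1 < 0)] at *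
        omega
      · have h2 := hpos c h
        have h1 := ih (c + 1)
        rw [abs_of_nonneg h] at *
        rw [abs_of_nonneg (by omega : 0 ≤ c + 1)] at *
        omega
  have hb' : ∀ c, f c + |c| ≤ N ∨ f c = 0 := fun c => hb N c (by have := abs_nonneg c; omega)
  -- moving one step up or to the left stays inside the diagram
  have hstep : ∀ r c : ℕ, min r c < f ((c : ℤ) - r) →
      (∀ r', r = r' + 1 → min r' c < f ((c : ℤ) - r')) ∧
      (∀ c', c = c' + 1 → min r c' < f ((c' : ℤ) - r)) := by
    intro r c h
    refine ⟨fun r' hr => ?_, fun c' hc => ?_⟩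
    · have h1 := hpos ((c : ℤ) - r)
      have h2 := hneg ((c : ℤ) - r)
      rw [show (c : ℤ) - r + 1 = (c : ℤ) - r' by omega] at h1 h2
      rcases lt_or_ge ((c : ℤ) - r) 0 with h0 | h0
      · have := h2 h0; omega
      · have := h1 h0; omega
    · have h1 := hpos ((c' : ℤ) - r)
      have h2 := hneg ((c' : ℤ) - r)
      rw [show (c' : ℤ) - r + 1 = (c : ℤ) - r by omega] at h1 h2
      rcases lt_or_ge ((c' : ℤ) - r) 0 with h0 | h0
      · have := h2 h0; omega
      · have := h1 h0; omega
  have hmem : ∀ x : ℕ × ℕ, min x.1 x.2 < f (cont x) → x ∈ Finset.range N ×ˢ Finset.range N := by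
    intro x hx
    have := hb' (cont x)
    rw [Finset.mem_product, Finset.mem_range, Finset.mem_range]
    simp only [cont] at *
    rcases abs_cases ((x.2 : ℤ) - x.1) with h' | h' <;> omega
  let l : YoungDiagram :=
    { cells := (Finset.range N ×ˢ Finset.range N).filter fun x => min x.1 x.2 < f (cont x)
      isLowerSet := by
        have key : ∀ (i j r c : ℕ), min (r + i) (c + j) < f (((c + j : ℕ) : ℤ) - (r + i : ℕ)) →
            min r c < f ((c : ℤ) - r) := by
          intro i j
          induction i with
          | zero =>
            induction j with
            | zero => intro r c h; exact h
            | succ j ih => intro r c h; exact ih r c ((hstep _ _ h).2 _ rfl)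
          | succ i ih => intro r c h; exact ih r c ((hstep _ _ h).1 _ rfl)
        rintro ⟨r, c⟩ ⟨r', c'⟩ ⟨h1, h2⟩ hx
        simp only [Finset.coe_filter, Set.mem_ofPred_eq] at hx ⊢
        have : min r' c' < f ((c' : ℤ) - r') := by
          refine key (r - r') (c - c') r' c' ?_
          simp only at h1 h2
          rw [Nat.add_sub_cancel' h1, Nat.add_sub_cancel' h2]
          exact hx.2
        exact ⟨hmem (r', c') this, this⟩ }
  have hl : ∀ x, x ∈ l ↔ min x.1 x.2 < f (cont x) := by
    intro x
    rw [← YoungDiagram.mem_cells, Finset.mem_filter]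
    exact ⟨fun h => h.2, fun h => ⟨hmem x h, h⟩⟩
  refine ⟨l, fun c => ?_⟩
  have h1 : ∀ i, i < diagLen l c ↔ i < f c := by
    intro i
    rw [← diagNode_mem_iff, hl, cont_diagNode]
    simp only [diagNode]
    rw [show min (i + (-c).toNat) (i + c.toNat) = i by omega]
  exact le_antisymm (not_lt.1 fun h => lt_irrefl _ ((h1 _).1 h))
    (not_lt.1 fun h => lt_irrefl _ ((h1 _).2 h))

/-- Every set of bead positions of charge `a` is the `β`-set of a partition. -/
lemma exists_betaSet_eq {X : Set ℤ} (hX : Maya X) {a : ℤ} (ha : chg X = a) :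
    ∃ l : YoungDiagram, betaSet a l = X := by
  set Y : Set ℤ := {x | x + a ∈ X} with hY
  have hYM : Maya Y := hX.preimage_add a
  have hY0 : chg Y = 0 := by rw [hY, chg_preimage_add hX, ha, sub_self]
  -- the length of the diagonal of content `c` is the number of beads at or beyond `c`
  let D : ℤ → ℤ := fun c => beadSum (fun x => if c ≤ x then 1 else 0) Y
  have hD : ∀ c, D c = D (c + 1) + beadDiff Y c := by
    intro c
    have : beadSum (fun x => if x = c then 1 else 0) Y = beadDiff Y c := by
      rw [← hYM.beadFun_apply, beadSum, Finsupp.linearCombination_apply, Finsupp.sum]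
      simp [eq_comm]
    rw [← this]
    simp only [D]
    rw [← beadSum_add]
    congr 1
    ext x
    split_ifs <;> omega
  -- `D` vanishes far to the right by definition and far to the left because the charge is zero
  obtain ⟨N, h1, h2⟩ := id hYM
  have hd0 : ∀ x : ℤ, x < -N ∨ N ≤ x → beadDiff Y x = 0 := by
    intro x hx
    simp only [beadDiff]
    rcases hx with h | h
    · rw [if_pos (h1 x h), if_pos (by omega)]; rfl
    · rw [if_neg (h2 x h), if_neg (by omega)]; rfl
  have hsupp : ∀ x ∈ (beadFun Y).support, -(N : ℤ) ≤ x ∧ x < N := by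
    intro x hx
    rw [Finsupp.mem_support_iff, hYM.beadFun_apply] at hx
    by_contra h
    exact hx (hd0 x (by omega))
  have htop : ∀ c : ℤ, N ≤ c → D c = 0 := by
    intro c hc
    simp only [D, beadSum, Finsupp.linearCombination_apply, Finsupp.sum]
    refine Finset.sum_eq_zero fun x hx => ?_
    have := hsupp x hx
    rw [if_neg (by omega), smul_zero]
  have hbot : ∀ c : ℤ, c ≤ -N → D c = 0 := by
    intro c hc
    rw [← hY0]
    simp only [D, chg, beadSum, Finsupp.linearCombination_apply, Finsupp.sum]
    refine Finset.sum_congr rfl fun x hx => ?_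
    have := hsupp x hx
    rw [if_pos (by omega)]
  have hind : ∀ c, (0 ≤ c → 0 ≤ beadDiff Y c ∧ beadDiff Y c ≤ 1) ∧
      (c < 0 → -1 ≤ beadDiff Y c ∧ beadDiff Y c ≤ 0) := by
    intro c
    simp only [beadDiff]
    split_ifs <;> omega
  -- nonnegativity propagates from the right end for `0 ≤ c` and from the left end for `c ≤ 0`
  have hpos1 : ∀ k : ℕ, ∀ c : ℤ, 0 ≤ c → (N : ℤ) ≤ c + k → 0 ≤ D c := by
    intro k
    induction k with
    | zero => intro c _ hc; rw [htop c (by simpa using hc)]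
    | succ k ih =>
      intro c h0 hc
      have := ih (c + 1) (by omega) (by omega)
      have := (hind c).1 h0
      rw [hD c]; omega
  have hneg1 : ∀ k : ℕ, ∀ c : ℤ, c ≤ 0 → c - k ≤ -(N : ℤ) → 0 ≤ D c := by
    intro k
    induction k with
    | zero => intro c _ hc; rw [hbot c (by simpa using hc)]
    | succ k ih =>
      intro c h0 hc
      have := ih (c - 1) (by omega) (by omega)
      have := (hind (c - 1)).2 (by omega)
      have := hD (c - 1)
      rw [sub_add_cancel] at this
      omega
  have hnn : ∀ c, 0 ≤ D c := by
    intro c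
    rcases le_total 0 c with h | h
    · exact hpos1 N c h (by omega)
    · exact hneg1 N c h (by omega)
  obtain ⟨l, hl⟩ := exists_diagram_of_diagLen (fun c => (D c).toNat) N
    (fun c hc => by
      show (D c).toNat = 0
      rcases abs_cases c with h | h
      · rw [htop c (by omega)]; rfl
      · rw [hbot c (by omega)]; rfl)
    (fun c hc => by
      have := hD c; have := (hind c).1 hc; have := hnn c; have := hnn (c + 1)
      omega)
    (fun c hc => by
      have := hD c; have := (hind c).2 hc; have := hnn c; have := hnn (c + 1)
      omega)
  refine ⟨l, ?_⟩
  have h0 : betaSet 0 l = Y := by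
    refine beadDiff_injective fun c => ?_
    rw [beadDiff_betaSet_zero, hl, hl]
    have := hD c; have := hnn c; have := hnn (c + 1)
    omega
  ext x
  rw [mem_betaSet_shift, h0, hY]
  simp

/-! ### Rim hooks and addable nodes on the abacus -/

lemma beadDiff_betaSet (a : ℤ) (l : YoungDiagram) (c : ℤ) :
    (c ∈ betaSet a l → (diagLen l (c - a) : ℤ) - diagLen l (c - a + 1) =
      1 - if c - a < 0 then 1 else 0) ∧
    (c ∉ betaSet a l → (diagLen l (c - a) : ℤ) - diagLen l (c - a + 1) =
      0 - if c - a < 0 then 1 else 0) := by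
  rw [← beadDiff_betaSet_zero, mem_betaSet_shift]
  exact ⟨beadDiff_of_mem, beadDiff_of_notMem⟩

lemma mem_moveBead {x y z : ℤ} {X : Set ℤ} : z ∈ moveBead x y X ↔ z = y ∨ z ∈ X ∧ z ≠ x := by
  simp only [moveBead, Set.mem_insert_iff, Set.mem_sdiff, Set.mem_singleton_iff]

/-- Moving a bead down by `k` places shortens `k` consecutive diagonals by one node. -/
lemma moveBead_iff_diagLen (a : ℤ) (l m : YoungDiagram) (x : ℤ) {k : ℕ} (hk : 1 ≤ k) :
    (x ∈ betaSet a l ∧ x - k ∉ betaSet a l ∧ betaSet a m = moveBead x (x - k) (betaSet a l)) ↔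
      ∀ c, diagLen l c = diagLen m c + if x - k - a < c ∧ c ≤ x - a then 1 else 0 := by
  constructor
  · rintro ⟨h1, h2, h3⟩
    obtain ⟨N, hN⟩ := diagLen_eq_zero l
    obtain ⟨M, hM⟩ := diagLen_eq_zero m
    refine eq_of_tail (N := N + M + x.natAbs + a.natAbs + 1) (fun c hc => ?_) (fun c => ?_)
    · rw [hN c (by rw [abs_of_nonneg] <;> omega), hM c (by rw [abs_of_nonneg] <;> omega), if_neg]
      omega
    · have hl := beadDiff_betaSet a l (c + a)
      have hm := beadDiff_betaSet a m (c + a)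
      rw [add_sub_cancel_right] at hl hm
      rw [h3, mem_moveBead] at hm
      push_cast
      by_cases hx : c + a = x
      · have e1 := hl.1 (hx ▸ h1)
        have e2 := hm.2 (by omega)
        split_ifs at * <;> omega
      · by_cases hy : c + a = x - k
        · have e1 := hl.2 (hy ▸ h2)
          have e2 := hm.1 (Or.inl hy)
          split_ifs at * <;> omega
        · by_cases hc : c + a ∈ betaSet a l
          · have e1 := hl.1 hc
            have e2 := hm.1 (Or.inr ⟨hc, hx⟩)
            split_ifs at * <;> omega
          · have e1 := hl.2 hc
            have e2 := hm.2 (by tauto)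
            split_ifs at * <;> omega
  · intro h
    have key : ∀ c, (c = x ∧ c ∈ betaSet a l ∧ c ∉ betaSet a m) ∨
        (c = x - k ∧ c ∉ betaSet a l ∧ c ∈ betaSet a m) ∨
        (c ≠ x ∧ c ≠ x - k ∧ (c ∈ betaSet a l ↔ c ∈ betaSet a m)) := by
      intro c
      have hl := beadDiff_betaSet a l c
      have hm := beadDiff_betaSet a m c
      have g1 := h (c - a)
      have g2 := h (c - a + 1)
      by_cases hcl : c ∈ betaSet a l <;> by_cases hcm : c ∈ betaSet a m
      · have e1 := hl.1 hcl
        have e2 := hm.1 hcm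
        refine Or.inr (Or.inr ⟨?_, ?_, iff_of_true hcl hcm⟩) <;> split_ifs at * <;> omega
      · have e1 := hl.1 hcl
        have e2 := hm.2 hcm
        refine Or.inl ⟨?_, hcl, hcm⟩
        split_ifs at * <;> omega
      · have e1 := hl.2 hcl
        have e2 := hm.1 hcm
        refine Or.inr (Or.inl ⟨?_, hcl, hcm⟩)
        split_ifs at * <;> omega
      · have e1 := hl.2 hcl
        have e2 := hm.2 hcm
        refine Or.inr (Or.inr ⟨?_, ?_, iff_of_false hcl hcm⟩) <;> split_ifs at * <;> omega
    have hxk : x ≠ x - k := by omega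
    refine ⟨by have := key x; tauto, by have := key (x - k); have := hxk.symm; tauto, ?_⟩
    ext c
    rw [mem_moveBead]
    rcases key c with ⟨rfl, h1, h2⟩ | ⟨rfl, h1, h2⟩ | ⟨h1, h2, h3⟩ <;> tauto

/-- The rim meets every diagonal in its last node only. -/
lemma cont_injOn_rim (l : YoungDiagram) : Set.InjOn cont (rim l) := by
  rintro x ⟨hx, hx'⟩ y ⟨hy, hy'⟩ h
  have e1 : min x.1 x.2 + 1 = diagLen l (cont x) := by
    have h1 := mem_iff_lt_diagLen.1 hx
    have h2 := (mem_iff_lt_diagLen (x := (x.1 + 1, x.2 + 1))).not.1 hx'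
    have : cont (x.1 + 1, x.2 + 1) = cont x := by simp only [cont]; push_cast; ring
    rw [this] at h2
    simp only at h2
    omega
  have e2 : min y.1 y.2 + 1 = diagLen l (cont y) := by
    have h1 := mem_iff_lt_diagLen.1 hy
    have h2 := (mem_iff_lt_diagLen (x := (y.1 + 1, y.2 + 1))).not.1 hy'
    have : cont (y.1 + 1, y.2 + 1) = cont y := by simp only [cont]; push_cast; ring
    rw [this] at h2
    simp only at h2
    omega
  rw [← diagNode_cont x, ← diagNode_cont y, h]
  congr 1
  rw [h] at e1; omega

lemma Adjacent.cont {x y : ℕ × ℕ} (h : Adjacent x y) : cont y = cont x + 1 ∨ cont y = cont x - 1 := by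
  simp only [Adjacent, CombBlock.cont] at *
  omega

/-- The contents of a connected set of nodes form an interval. -/
lemma exists_cont_eq {S : Finset (ℕ × ℕ)} (hS : NodesConnected S) {x y : ℕ × ℕ} (hx : x ∈ S)
    (hy : y ∈ S) {c : ℤ} (h1 : cont x ≤ c) (h2 : c ≤ cont y) : ∃ z ∈ S, cont z = c := by
  have := hS x hx y hy
  induction this with
  | refl => exact ⟨x, hx, by omega⟩
  | @tail u v huv hadj ih =>
    by_cases h : c ≤ cont u
    · have hu : u ∈ S := by
        cases huv with
        | refl => exact hx
        | tail _ h' => exact h'.2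
      exact ih hu h
    · have := hadj.1.cont
      exact ⟨v, hadj.2, by omega⟩

lemma diagLen_of_cells_sdiff {l m : YoungDiagram} {S : Finset (ℕ × ℕ)}
    (hS : (S : Set (ℕ × ℕ)) ⊆ rim l) (hm : m.cells = l.cells \ S) (c : ℤ) :
    diagLen l c = diagLen m c + if c ∈ S.image cont then 1 else 0 := by
  have hsub : S ⊆ l.cells := fun x hx => (hS hx).1
  have h1 : diagLen l c = diagLen m c + (S.filter fun x => cont x = c).card := by
    rw [diagLen, diagLen, hm]
    have : l.cells.filter (fun x => cont x = c) =
        (l.cells \ S).filter (fun x => cont x = c) ∪ S.filter fun x => cont x = c := by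
      rw [← Finset.filter_union, Finset.sdiff_union_of_subset hsub]
    rw [this, Finset.card_union_of_disjoint]
    exact Finset.disjoint_filter_filter Finset.sdiff_disjoint
  rw [h1]
  congr 1
  split_ifs with h
  · obtain ⟨x, hx, rfl⟩ := Finset.mem_image.1 h
    rw [Finset.card_eq_one]
    refine ⟨x, ?_⟩
    ext y
    simp only [Finset.mem_filter, Finset.mem_singleton]
    exact ⟨fun hy => cont_injOn_rim l (hS hy.1) (hS hx) hy.2, fun hy => ⟨hy ▸ hx, hy ▸ rfl⟩⟩
  · rw [Finset.card_eq_zero, Finset.filter_eq_empty_iff]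
    intro x hx hc
    exact h (Finset.mem_image.2 ⟨x, hx, hc⟩)

/-- Consecutive rim nodes are adjacent. -/
lemma adjacent_last (l : YoungDiagram) {c : ℤ} (h1 : 0 < diagLen l c) (h2 : 0 < diagLen l (c + 1)) :
    Adjacent (diagNode c (diagLen l c - 1)) (diagNode (c + 1) (diagLen l (c + 1) - 1)) := by
  simp only [Adjacent, diagNode]
  rcases lt_or_ge c 0 with hc | hc
  · have := diagLen_succ_of_neg l hc; omega
  · have := diagLen_succ_of_nonneg l hc; omega

lemma Adjacent.symm {x y : ℕ × ℕ} (h : Adjacent x y) : Adjacent y x := by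
  simp only [Adjacent] at *; omega

/-- Removing an `e`-rim hook amounts to moving a bead from `x` to the free position `x - e`. -/
lemma removesHook_iff {e : ℕ} (he : 1 ≤ e) (a : ℤ) (l m : YoungDiagram) :
    RemovesHook e l m ↔ ∃ x, x ∈ betaSet a l ∧ x - e ∉ betaSet a l ∧
      betaSet a m = moveBead x (x - e) (betaSet a l) := by
  simp only [moveBead_iff_diagLen a l m _ he]
  constructor
  · rintro ⟨S, hS, hconn, hcard, hm⟩
    -- the contents of a rim hook form an interval of length `e`
    have hne : (S.image cont).Nonempty := by
      rw [Finset.image_nonempty, ← Finset.card_pos]; omega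
    have hI : S.image cont = Finset.Icc ((S.image cont).min' hne) ((S.image cont).max' hne) := by
      ext c
      rw [Finset.mem_Icc]
      constructor
      · exact fun h => ⟨Finset.min'_le _ _ h, Finset.le_max' _ _ h⟩
      · rintro ⟨h1, h2⟩
        obtain ⟨x, hx, hx'⟩ := Finset.mem_image.1 (Finset.min'_mem _ hne)
        obtain ⟨y, hy, hy'⟩ := Finset.mem_image.1 (Finset.max'_mem _ hne)
        obtain ⟨z, hz, hz'⟩ := exists_cont_eq hconn hx hy (hx' ▸ h1) (hy' ▸ h2)
        exact Finset.mem_image.2 ⟨z, hz, hz'⟩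
    have hc : (S.image cont).card = e := by
      rw [Finset.card_image_of_injOn ((cont_injOn_rim l).mono hS), hcard]
    set u := (S.image cont).min' hne
    set v := (S.image cont).max' hne
    rw [hI, Int.card_Icc] at hc
    refine ⟨v + a, fun c => ?_⟩
    rw [diagLen_of_cells_sdiff hS hm c, hI]
    congr 1
    simp only [Finset.mem_Icc]
    congr 1
    apply propext
    omega
  · rintro ⟨x, hx⟩
    set J := Finset.Ioc (x - e - a) (x - a) with hJ
    have hx' : ∀ c, diagLen l c = diagLen m c + if c ∈ J then 1 else 0 := by
      intro c; rw [hx c]; simp only [hJ, Finset.mem_Ioc]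
    have hposJ : ∀ c ∈ J, 0 < diagLen l c := by
      intro c hc; rw [hx' c, if_pos hc]; omega
    -- the hook consists of the last nodes of the diagonals in `J`
    let nd : ℤ → ℕ × ℕ := fun c => diagNode c (diagLen l c - 1)
    have hnd : ∀ c, CombBlock.cont (nd c) = c := fun c => cont_diagNode _ _
    refine ⟨J.image nd, ?_, ?_, ?_, ?_⟩
    · intro z hz
      obtain ⟨c, hc, rfl⟩ := Finset.mem_image.1 (Finset.mem_coe.1 hz)
      have := hposJ c hc
      refine ⟨diagNode_mem_iff.2 (by omega), fun h => ?_⟩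
      have h' : diagNode c (diagLen l c) ∈ l := by
        convert h using 1
        simp only [nd, diagNode, Prod.mk.injEq]
        omega
      exact lt_irrefl _ (diagNode_mem_iff.1 h')
    · have up : ∀ k : ℕ, ∀ c, c ∈ J → c + k ∈ J →
          Relation.ReflTransGen (fun u v => Adjacent u v ∧ v ∈ J.image nd) (nd c) (nd (c + k)) ∧
          Relation.ReflTransGen (fun u v => Adjacent u v ∧ v ∈ J.image nd) (nd (c + k)) (nd c) := by
        intro k
        induction k with
        | zero => intro c _ _; simp [Relation.ReflTransGen.refl]
        | succ k ih =>
          intro c hc hk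
          have hk' : c + k ∈ J := by
            rw [hJ, Finset.mem_Ioc] at *; push_cast at hk; omega
          have hadj := adjacent_last l (hposJ _ hk') (by
            rw [show c + (k : ℤ) + 1 = c + ((k + 1 : ℕ) : ℤ) by push_cast; ring]; exact hposJ _ hk)
          rw [show c + (k : ℤ) + 1 = c + ((k + 1 : ℕ) : ℤ) by push_cast; ring] at hadj
          obtain ⟨i1, i2⟩ := ih c hc hk'
          exact ⟨i1.tail ⟨hadj, Finset.mem_image_of_mem _ hk⟩,
            Relation.ReflTransGen.head ⟨hadj.symm, Finset.mem_image_of_mem _ hk'⟩ i2⟩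
      intro y hy z hz
      obtain ⟨c, hc, rfl⟩ := Finset.mem_image.1 hy
      obtain ⟨d, hd, rfl⟩ := Finset.mem_image.1 hz
      rcases le_total c d with h | h
      · have := (up (d - c).toNat c hc (by rwa [show c + ((d - c).toNat : ℤ) = d by omega])).1
        rwa [show c + ((d - c).toNat : ℤ) = d by omega] at this
      · have := (up (c - d).toNat d hd (by rwa [show d + ((c - d).toNat : ℤ) = c by omega])).2
        rwa [show d + ((c - d).toNat : ℤ) = c by omega] at this
    · rw [Finset.card_image_of_injective _ (fun c d h => by rw [← hnd c, h, hnd]), hJ, Int.card_Ioc]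
      omega
    · ext z
      rw [Finset.mem_sdiff, YoungDiagram.mem_cells, YoungDiagram.mem_cells, mem_iff_lt_diagLen,
        mem_iff_lt_diagLen, hx' (CombBlock.cont z)]
      have hz : z ∈ J.image nd ↔ CombBlock.cont z ∈ J ∧ min z.1 z.2 = diagLen m (CombBlock.cont z) := by
        rw [Finset.mem_image]
        constructor
        · rintro ⟨c, hc, rfl⟩
          rw [hnd]
          refine ⟨hc, ?_⟩
          have := hx' c
          rw [if_pos hc] at this
          simp only [nd, diagNode]; omega
        · rintro ⟨h1, h2⟩
          refine ⟨_, h1, ?_⟩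
          have := hx' (CombBlock.cont z)
          rw [if_pos h1] at this
          simp only [nd]
          rw [this, Nat.add_sub_cancel, ← h2, diagNode_cont]
      rw [hz]
      split_ifs with h
      · simp only [h, true_and]; omega
      · simp only [h, false_and, not_false_eq_true, and_true, add_zero]

/-- An addable node of content `c` corresponds to a bead at `c + a - 1` followed by a free
position. -/
lemma exists_addable_iff (a : ℤ) (l : YoungDiagram) (b : ℤ) :
    (∃ n : ℕ × ℕ, n ∉ l ∧ cont n + a = b ∧ ∃ m : YoungDiagram, m.cells = insert n l.cells) ↔
      b - 1 ∈ betaSet a l ∧ b ∉ betaSet a l := by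
  constructor
  · rintro ⟨n, hn, rfl, m, hm⟩
    have : ∀ c, diagLen m c = diagLen l c +
        if (cont n + a) - (1 : ℕ) - a < c ∧ c ≤ (cont n + a) - a then 1 else 0 := by
      intro c
      rw [diagLen, hm, Finset.filter_insert]
      by_cases hc : cont n = c
      · rw [if_pos hc, if_pos (by push_cast; omega), Finset.card_insert_of_notMem]
        · rfl
        · simp only [Finset.mem_filter]; exact fun h => hn h.1
      · rw [if_neg hc, if_neg (by push_cast; omega)]; rfl
    obtain ⟨h1, h2, h3⟩ := (moveBead_iff_diagLen a m l (cont n + a) le_rfl).2 this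
    rw [h3, mem_moveBead, mem_moveBead]
    push_cast
    refine ⟨Or.inl rfl, ?_⟩
    rintro (h | h)
    · omega
    · exact h.2 rfl
  · rintro ⟨h1, h2⟩
    have hM := maya_betaSet a l
    obtain ⟨m, hm⟩ := exists_betaSet_eq (hM.moveBead (b - 1) b) (a := a) (by
      rw [chg, beadSum_moveBead _ hM h1 h2]
      have := chg_betaSet a l
      rw [chg] at this; rw [this]; ring)
    have h4 := (moveBead_iff_diagLen a m l b le_rfl).1 ⟨by rw [hm, mem_moveBead]; simp, by
        rw [hm, mem_moveBead]; push_cast; rintro (h | h)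
        · omega
        · exact h.2 rfl, by
        ext z
        rw [mem_moveBead, hm, mem_moveBead]
        push_cast
        by_cases hz : z = b - 1
        · subst hz; simp [h1]
        · by_cases hz' : z = b
          · subst hz'; simp [h2, hz]
          · simp [hz, hz']⟩
    have h5 : ∀ c, diagLen m c = diagLen l c + if c = b - a then 1 else 0 := by
      intro c
      rw [h4 c]
      congr 1
      push_cast
      simp only [show b - 1 - a < c ∧ c ≤ b - a ↔ c = b - a by omega]
    refine ⟨diagNode (b - a) (diagLen l (b - a)), ?_, ?_, m, ?_⟩
    · rw [diagNode_mem_iff]; omega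
    · rw [cont_diagNode]; ring
    · ext z
      rw [Finset.mem_insert, YoungDiagram.mem_cells, YoungDiagram.mem_cells, mem_iff_lt_diagLen,
        mem_iff_lt_diagLen, h5]
      by_cases hz : cont z = b - a
      · rw [if_pos hz]
        have : z = diagNode (b - a) (diagLen l (b - a)) ↔ min z.1 z.2 = diagLen l (b - a) := by
          constructor
          · intro h; rw [h]; simp only [diagNode]; omega
          · intro h; rw [← h, ← hz, diagNode_cont]
        rw [this, hz]; omega
      · rw [if_neg hz]
        have : z ≠ diagNode (b - a) (diagLen l (b - a)) := by
          rintro rfl; exact hz (cont_diagNode _ _)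
        simp [this]

/-! ### Runners -/

/-- The runner through the position `j` of the abacus with `e` runners: its `b`-th place is the
position `j + e b`. -/
def runner (e : ℕ) (X : Set ℤ) (j : ℤ) : Set ℤ := {b | j + e * b ∈ X}

/-- The charge of the runner through `j`, counted from the position `j`. -/
noncomputable def rc (e : ℕ) (X : Set ℤ) (j : ℤ) : ℤ := chg (runner e X j)

lemma mem_runner {e : ℕ} {X : Set ℤ} {j b : ℤ} : b ∈ runner e X j ↔ j + e * b ∈ X := Iff.rfl

lemma maya_runner {e : ℕ} (he : 1 ≤ e) {X : Set ℤ} (hX : Maya X) (j : ℤ) : Maya (runner e X j) := by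
  obtain ⟨N, h1, h2⟩ := hX
  have he' : (1 : ℤ) ≤ e := by exact_mod_cast he
  refine ⟨N + j.natAbs, fun x hx => h1 _ ?_, fun x hx => h2 _ ?_⟩
  · have : (e : ℤ) * x ≤ 1 * x := by nlinarith
    omega
  · have : (1 : ℤ) * x ≤ e * x := by nlinarith
    omega

lemma rc_add_mul {e : ℕ} (he : 1 ≤ e) {X : Set ℤ} (hX : Maya X) (j m : ℤ) :
    rc e X (j + e * m) = rc e X j - m := by
  rw [rc, rc, ← chg_preimage_add (maya_runner he hX j) m]
  congr 1
  ext b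
  simp only [runner, Set.mem_ofPred_eq]
  rw [show j + e * m + e * b = j + e * (b + m) by ring]

lemma rc_add {e : ℕ} (he : 1 ≤ e) {X : Set ℤ} (hX : Maya X) (j : ℤ) :
    rc e X (j + e) = rc e X j - 1 := by
  have := rc_add_mul he hX j 1
  rwa [mul_one] at this

/-- Moving a bead along its runner changes no runner charge. -/
lemma rc_moveBead {e : ℕ} (he : 1 ≤ e) {X : Set ℤ} (hX : Maya X) {x m : ℤ} (hx : x ∈ X)
    (hy : x + e * m ∉ X) (j : ℤ) : rc e (moveBead x (x + e * m) X) j = rc e X j := by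
  have he' : (e : ℤ) ≠ 0 := by positivity
  by_cases hj : ∃ b, x = j + e * b
  · obtain ⟨b, rfl⟩ := hj
    have : runner e (moveBead (j + e * b) (j + e * b + e * m) X) j =
        moveBead b (b + m) (runner e X j) := by
      ext c
      rw [mem_runner, mem_moveBead, mem_moveBead, mem_runner]
      rw [show j + e * c = j + e * b + e * m ↔ c = b + m by
        rw [show j + e * b + e * m = j + e * (b + m) by ring, add_right_inj]
        exact mul_right_inj' he']
      rw [show j + e * c ≠ j + e * b ↔ c ≠ b by
        rw [ne_eq, add_right_inj, mul_right_inj' he']]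
    rw [rc, this, chg, beadSum_moveBead _ (maya_runner he hX j) hx]
    · simp [rc, chg]
    · rw [mem_runner, show j + (e : ℤ) * (b + m) = j + e * b + e * m by ring]; exact hy
  · rw [rc, rc]
    congr 1
    ext c
    push Not at hj
    rw [mem_runner, mem_moveBead, mem_runner]
    have h1 := hj c
    have h2 := hj (c - m)
    constructor
    · rintro (h | h)
      · exact absurd (by rw [mul_sub]; linarith) h2
      · exact h.1
    · exact fun h => Or.inr ⟨h, h1.symm⟩

/-- The abacus is the disjoint union of its runners; as `i + e b < 0` exactly if `b < 0` for
`0 ≤ i < e`, the regularisations match as well. -/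
lemma beadFun_eq_sum_runner {e : ℕ} (he : 1 ≤ e) {X : Set ℤ} (hX : Maya X) :
    beadFun X = ∑ i ∈ Finset.range e,
      Finsupp.mapDomain (fun b : ℤ => (i : ℤ) + e * b) (beadFun (runner e X i)) := by
  have he' : (0 : ℤ) < e := by exact_mod_cast he
  ext z
  rw [Finsupp.finsetSum_apply]
  have hinj : ∀ i : ℕ, Function.Injective (fun b : ℤ => (i : ℤ) + e * b) := by
    intro i b c h
    exact mul_left_cancel₀ he'.ne' (add_left_cancel h)
  have hz := Int.emod_add_mul_ediv z e
  have h0 := Int.emod_nonneg z he'.ne'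
  have h1 := Int.emod_lt_of_pos z he'
  rw [Finset.sum_eq_single (z % e).toNat]
  · have happ := Finsupp.mapDomain_apply (hinj (z % e).toNat)
      (beadFun (runner e X ((z % e).toNat : ℕ))) (z / e)
    rw [show (((z % e).toNat : ℕ) : ℤ) + e * (z / e) = z by omega] at happ
    rw [happ, hX.beadFun_apply, (maya_runner he hX _).beadFun_apply]
    have hneg : z < 0 ↔ z / e < 0 := by
      constructor
      · exact fun h => Int.ediv_neg_of_neg_of_pos h he'
      · intro h
        by_contra h'
        have := Int.ediv_nonneg (not_lt.1 h') he'.le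
        omega
    have hmem : z ∈ X ↔ z / e ∈ runner e X ((z % e).toNat : ℕ) := by
      rw [mem_runner, show (((z % e).toNat : ℕ) : ℤ) + e * (z / e) = z by omega]
    by_cases h : z ∈ X
    · rw [beadDiff_of_mem h, beadDiff_of_mem (hmem.1 h)]; simp only [hneg]
    · rw [beadDiff_of_notMem h, beadDiff_of_notMem (hmem.not.1 h)]; simp only [hneg]
  · intro i hi hne
    refine Finsupp.mapDomain_of_notMem_range _ _ ?_
    rintro ⟨b, hb⟩
    apply hne
    have := Finset.mem_range.1 hi
    simp only at hb
    rw [← hb, Int.add_mul_emod_self_left, Int.emod_eq_of_lt (by positivity) (by exact_mod_cast this)]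
    rfl
  · intro h
    exfalso; apply h
    rw [Finset.mem_range]; omega

lemma beadSum_eq_sum_runner {e : ℕ} (he : 1 ≤ e) {X : Set ℤ} (hX : Maya X) (f : ℤ → ℤ) :
    beadSum f X = ∑ i ∈ Finset.range e, beadSum (fun b => f (i + e * b)) (runner e X i) := by
  rw [beadSum, beadFun_eq_sum_runner he hX, map_sum]
  refine Finset.sum_congr rfl fun i _ => ?_
  rw [Finsupp.linearCombination_mapDomain]; rfl

lemma sum_rc {e : ℕ} (he : 1 ≤ e) {X : Set ℤ} (hX : Maya X) :
    ∑ i ∈ Finset.range e, rc e X i = chg X := by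
  rw [chg, beadSum_eq_sum_runner he hX]; rfl

lemma en_eq_sum_runner {e : ℕ} (he : 1 ≤ e) {X : Set ℤ} (hX : Maya X) :
    en X = ∑ i ∈ Finset.range e, ((i : ℤ) * rc e X i + e * en (runner e X i)) := by
  rw [en, beadSum_eq_sum_runner he hX]
  refine Finset.sum_congr rfl fun i _ => ?_
  rw [beadSum_add, beadSum_mul, ← en]
  congr 1
  have := beadSum_mul i (fun _ => 1) (runner e X i)
  simp only [mul_one] at this
  rw [this]; rfl

lemma beadSum_residue {e : ℕ} (he : 1 ≤ e) {X : Set ℤ} (hX : Maya X) {i : ℕ} (hi : i < e) :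
    beadSum (fun x => if (x : ZMod e) = (i : ℕ) then 1 else 0) X = rc e X i := by
  rw [beadSum_eq_sum_runner he hX, Finset.sum_eq_single i]
  · simp [rc, chg]
  · intro j hj hne
    have : ∀ b : ℤ, ¬ ((((j : ℤ) + e * b : ℤ)) : ZMod e) = (i : ℕ) := by
      intro b h
      push_cast at h
      rw [ZMod.natCast_self, zero_mul, add_zero, ZMod.natCast_eq_natCast_iff'] at h
      rw [Nat.mod_eq_of_lt (Finset.mem_range.1 hj), Nat.mod_eq_of_lt hi] at h
      exact hne h
    simp only [this, if_false]
    have := beadSum_mul 0 (fun _ => 0) (runner e X j)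
    simpa using this
  · intro h; exact absurd (Finset.mem_range.2 hi) h

/-! ### Cores -/

/-- No bead can be moved down by `e` places. -/
def IsCore (e : ℕ) (X : Set ℤ) : Prop := ∀ x ∈ X, x - e ∈ X

lemma IsCore.runner_eq {e : ℕ} (he : 1 ≤ e) {X : Set ℤ} (hX : Maya X) (hc : IsCore e X) (j : ℤ) :
    runner e X j = Set.Iio (rc e X j) := by
  refine eq_Iio_of_downward (maya_runner he hX j) fun b hb => ?_
  have := hc _ hb
  rwa [show j + e * b - e = j + e * (b - 1) by ring] at this

lemma IsCore.mem_iff {e : ℕ} (he : 1 ≤ e) {X : Set ℤ} (hX : Maya X) (hc : IsCore e X) (x : ℤ) :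
    x ∈ X ↔ 0 < rc e X x := by
  have := hc.runner_eq he hX x
  rw [← Set.mem_Iio, ← this, mem_runner]
  simp

lemma IsCore.two_mul_en {e : ℕ} (he : 1 ≤ e) {X : Set ℤ} (hX : Maya X) (hc : IsCore e X) :
    2 * en X = ∑ i ∈ Finset.range e, (2 * (i : ℤ) * rc e X i + e * (rc e X i * (rc e X i - 1))) := by
  rw [en_eq_sum_runner he hX, Finset.mul_sum]
  refine Finset.sum_congr rfl fun i _ => ?_
  have := two_mul_en_Iio (rc e X i)
  rw [← hc.runner_eq he hX i] at this
  rw [← this]; ring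

/-- `q` can be the function of runner charges of an abacus: moving the origin of a runner up by one
place decreases its charge by one. -/
def QuasiPeriodic (e : ℕ) (c : ℤ) (q : ℤ → ℤ) : Prop := ∀ j, q (j + e) = q j - c

lemma QuasiPeriodic.add_mul {e : ℕ} {c : ℤ} {q : ℤ → ℤ} (hq : QuasiPeriodic e c q) (j m : ℤ) :
    q (j + e * m) = q j - c * m := by
  induction m using Int.induction_on with
  | zero => simp
  | succ i ih =>
    rw [show j + (e : ℤ) * (i + 1) = j + e * i + e by ring, hq, ih]; ring
  | pred i ih =>
    have := hq (j + e * (-(i : ℤ) - 1))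
    rw [show j + (e : ℤ) * (-(i : ℤ) - 1) + e = j + e * -i by ring, ih] at this
    linarith

lemma QuasiPeriodic.eq_emod {e : ℕ} {c : ℤ} {q : ℤ → ℤ} (hq : QuasiPeriodic e c q) (j : ℤ) :
    q j = q (j % e) - c * (j / e) := by
  have := hq.add_mul (j % e) (j / e)
  rwa [Int.emod_add_mul_ediv] at this

lemma QuasiPeriodic.ext {e : ℕ} (he : 1 ≤ e) {c : ℤ} {q r : ℤ → ℤ} (hq : QuasiPeriodic e c q)
    (hr : QuasiPeriodic e c r) (h : ∀ i : ℕ, i < e → q i = r i) (j : ℤ) : q j = r j := by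
  have he' : (0 : ℤ) < e := by exact_mod_cast he
  have h0 := Int.emod_nonneg j he'.ne'
  have h1 := Int.emod_lt_of_pos j he'
  rw [hq.eq_emod, hr.eq_emod]
  have := h (j % e).toNat (by omega)
  rw [Int.toNat_of_nonneg h0] at this
  rw [this]

lemma maya_core {e : ℕ} (he : 1 ≤ e) {q : ℤ → ℤ} (hq : QuasiPeriodic e 1 q) :
    Maya {x | 0 < q x} := by
  have he' : (0 : ℤ) < e := by exact_mod_cast he
  set M : ℕ := ∑ i ∈ Finset.range e, (q i).natAbs with hM
  have hle : ∀ j : ℤ, (q (j % e)).natAbs ≤ M := by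
    intro j
    have h0 := Int.emod_nonneg j he'.ne'
    have h1 := Int.emod_lt_of_pos j he'
    have := Finset.single_le_sum (f := fun i : ℕ => (q i).natAbs) (fun _ _ => Nat.zero_le _)
      (Finset.mem_range.2 (show (j % e).toNat < e by omega))
    simpa [Int.toNat_of_nonneg h0] using this
  have hd : ∀ j : ℤ, (e * (M + 1) : ℤ) ≤ j → (M : ℤ) + 1 ≤ j / e := by
    intro j hj
    rw [Int.le_ediv_iff_mul_le he']; linarith
  have hd' : ∀ j : ℤ, j < -(e * (M + 1) : ℤ) → j / e < -((M : ℤ) + 1) := by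
    intro j hj
    rw [Int.ediv_lt_iff_lt_mul he']; linarith
  refine ⟨e * (M + 1), fun x hx => ?_, fun x hx => ?_⟩
  · have := hd' x (by push_cast at hx; linarith)
    have := hle x
    show 0 < q x
    rw [hq.eq_emod]; omega
  · have := hd x (by push_cast at hx; linarith)
    have := hle x
    show ¬ 0 < q x
    rw [hq.eq_emod]; omega

lemma rc_core {e : ℕ} {q : ℤ → ℤ} (hq : QuasiPeriodic e 1 q) (j : ℤ) :
    rc e {x | 0 < q x} j = q j := by
  have : runner e {x | 0 < q x} j = Set.Iio (q j) := by
    ext b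
    rw [mem_runner]
    show 0 < q (j + e * b) ↔ b < q j
    rw [hq.add_mul]; omega
  rw [rc, this, chg_Iio]

lemma isCore_core {e : ℕ} {q : ℤ → ℤ} (hq : QuasiPeriodic e 1 q) : IsCore e {x | 0 < q x} := by
  intro x hx
  have hx' : 0 < q x := hx
  show 0 < q (x - e)
  have := hq (x - e)
  rw [sub_add_cancel] at this
  omega

/-! ### Charged bipartitions -/

/-- The positions of the beads of the `k`-th component. -/
def beads (x : Charged) (k : Fin 2) : Set ℤ := betaSet (x.2 k) (x.1 k)

lemma maya_beads (x : Charged) (k : Fin 2) : Maya (beads x k) := maya_betaSet _ _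

lemma chg_beads (x : Charged) (k : Fin 2) : chg (beads x k) = x.2 k := chg_betaSet _ _

lemma beads_injective {x y : Charged} (h : ∀ k, beads x k = beads y k) : x = y := by
  have h2 : x.2 = y.2 := by
    ext k; rw [← chg_beads, h, chg_beads]
  refine Prod.ext ?_ h2
  ext1 k
  refine betaSet_injective (x.2 k) ?_
  have := h k
  simp only [beads] at this
  rw [this, h2]

lemma exists_beads_eq (X : Fin 2 → Set ℤ) (hX : ∀ k, Maya (X k)) :
    ∃ x : Charged, (∀ k, x.2 k = chg (X k)) ∧ ∀ k, beads x k = X k := by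
  choose l hl using fun k => exists_betaSet_eq (hX k) (a := chg (X k)) rfl
  exact ⟨(l, fun k => chg (X k)), fun _ => rfl, hl⟩

/-- The charge of the runner through `j` of the `k`-th component. -/
noncomputable def rch (e : ℕ) (x : Charged) (k : Fin 2) (j : ℤ) : ℤ := rc e (beads x k) j

lemma rch_quasiPeriodic {e : ℕ} (he : 1 ≤ e) (x : Charged) (k : Fin 2) :
    QuasiPeriodic e 1 (rch e x k) := fun j => rc_add he (maya_beads x k) j

lemma sum_rch {e : ℕ} (he : 1 ≤ e) (x : Charged) (k : Fin 2) :
    ∑ i ∈ Finset.range e, rch e x k i = x.2 k := by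
  rw [← chg_beads x k, ← sum_rc he (maya_beads x k)]; rfl

/-- The total energy of the two components. -/
noncomputable def enT (x : Charged) : ℤ := en (beads x 0) + en (beads x 1)

lemma two_mul_enT (x : Charged) :
    2 * enT x = x.2 0 * (x.2 0 - 1) + x.2 1 * (x.2 1 - 1) + 2 * size x.1 := by
  have h0 := en_betaSet (x.2 0) (x.1 0)
  have h1 := en_betaSet (x.2 1) (x.1 1)
  rw [size, Fin.sum_univ_two, enT, beads, beads]
  push_cast; linarith

/-- Twice the energy of the bicore with runner charges `q`. -/
def coreEn (e : ℕ) (q : Fin 2 → ℤ → ℤ) : ℤ :=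
  ∑ i ∈ Finset.range e, (2 * (i : ℤ) * q 0 i + e * (q 0 i * (q 0 i - 1))) +
    ∑ i ∈ Finset.range e, (2 * (i : ℤ) * q 1 i + e * (q 1 i * (q 1 i - 1)))

lemma removesBiHook_iff {e : ℕ} (he : 1 ≤ e) (l m : Bipartition) (a : Bicharge) :
    RemovesBiHook e l m ↔ ∃ k, (∃ z, z ∈ beads (l, a) k ∧ z - e ∉ beads (l, a) k ∧
      beads (m, a) k = moveBead z (z - e) (beads (l, a) k)) ∧ ∀ j, j ≠ k → m j = l j := by
  simp only [RemovesBiHook]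
  refine exists_congr fun k => and_congr_left' ?_
  rw [removesHook_iff he (a k)]; rfl

lemma isBicore_iff {e : ℕ} (he : 1 ≤ e) (x : Charged) :
    IsBicore e x.1 ↔ ∀ k, IsCore e (beads x k) := by
  constructor
  · intro h k z hz
    by_contra hz'
    obtain ⟨m, hm⟩ := exists_betaSet_eq ((maya_beads x k).moveBead z (z - e)) (a := x.2 k) (by
      have : z - (e : ℤ) = z + e * (-1) := by ring
      rw [chg, beadSum_moveBead _ (maya_beads x k) hz hz', ← chg, chg_beads]; ring)
    refine h (Function.update x.1 k m) ((removesBiHook_iff he x.1 _ x.2).2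
      ⟨k, ⟨z, hz, hz', ?_⟩, fun j hj => Function.update_of_ne hj _ _⟩)
    simp only [beads, Function.update_self]
    exact hm
  · intro h m hm
    obtain ⟨k, ⟨z, hz, hz', -⟩, -⟩ := (removesBiHook_iff he x.1 _ x.2).1 hm
    exact hz' (h k z hz)

lemma RemovesBiHook.rch_eq {e : ℕ} (he : 1 ≤ e) {l m : Bipartition} (h : RemovesBiHook e l m)
    (a : Bicharge) (k : Fin 2) (j : ℤ) : rch e (m, a) k j = rch e (l, a) k j := by
  obtain ⟨k', ⟨z, hz, hz', hm⟩, hj⟩ := (removesBiHook_iff he l m a).1 h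
  by_cases hk : k = k'
  · subst hk
    rw [rch, hm]
    have : z - (e : ℤ) = z + e * (-1) := by ring
    rw [this] at hz' ⊢
    exact rc_moveBead he (maya_beads _ _) hz hz' j
  · rw [rch, rch, beads, beads]; simp only [hj k hk]

lemma RemovesBiHook.enT_eq {e : ℕ} (he : 1 ≤ e) {l m : Bipartition} (h : RemovesBiHook e l m)
    (a : Bicharge) : enT (l, a) = enT (m, a) + e := by
  obtain ⟨k', ⟨z, hz, hz', hm⟩, hj⟩ := (removesBiHook_iff he l m a).1 h
  have h1 : en (beads (m, a) k') = en (beads (l, a) k') - e := by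
    rw [hm, en, beadSum_moveBead _ (maya_beads _ _) hz hz', ← en]; ring
  have h2 : ∀ j, j ≠ k' → en (beads (m, a) j) = en (beads (l, a) j) := by
    intro j hjk; rw [beads, beads]; simp only [hj j hjk]
  rw [enT, enT]
  fin_cases k'
  · have := h2 1 (by decide); simp only [Fin.zero_eta] at h1; linarith
  · have := h2 0 (by decide); simp only [Fin.mk_one] at h1; linarith

lemma HookChain.rch_eq {e : ℕ} (he : 1 ≤ e) {w : ℕ} {l m : Bipartition} (h : HookChain e w l m)
    (a : Bicharge) (k : Fin 2) (j : ℤ) : rch e (m, a) k j = rch e (l, a) k j := by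
  induction h with
  | nil => rfl
  | cons h1 _ ih => rw [ih, h1.rch_eq he]

lemma HookChain.enT_eq {e : ℕ} (he : 1 ≤ e) {w : ℕ} {l m : Bipartition} (h : HookChain e w l m)
    (a : Bicharge) : enT (l, a) = enT (m, a) + e * w := by
  induction h with
  | nil => simp
  | cons h1 _ ih => rw [h1.enT_eq he, ih]; push_cast; ring

lemma two_mul_enT_of_isBicore {e : ℕ} (he : 1 ≤ e) {x : Charged} (h : IsBicore e x.1) :
    2 * enT x = coreEn e (rch e x) := by
  have h' := (isBicore_iff he x).1 h
  rw [enT, mul_add, (h' 0).two_mul_en he (maya_beads x 0), (h' 1).two_mul_en he (maya_beads x 1)]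
  rfl

lemma ReducesTo.two_mul_enT {e : ℕ} (he : 1 ≤ e) {w : ℕ} {l κ : Bipartition}
    (h : ReducesTo e w l κ) (a : Bicharge) :
    2 * enT (l, a) = 2 * e * w + coreEn e (rch e (l, a)) := by
  have h1 := h.1.enT_eq he a
  have h2 := two_mul_enT_of_isBicore he (x := (κ, a)) h.2
  have h3 : rch e (κ, a) = rch e (l, a) := by ext k j; exact h.1.rch_eq he a k j
  rw [h3] at h2
  linarith

lemma exists_reducesTo' {e : ℕ} (he : 1 ≤ e) (l : Bipartition) : ∃ w κ, ReducesTo e w l κ := by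
  induction hn : size l using Nat.strong_induction_on generalizing l with
  | _ n ih =>
    by_cases h : IsBicore e l
    · exact ⟨0, l, HookChain.nil l, h⟩
    · simp only [IsBicore, not_forall, not_not] at h
      obtain ⟨m, hm⟩ := h
      have h1 := hm.enT_eq he 0
      have h2 := CombBlock.two_mul_enT (l, 0)
      have h3 := CombBlock.two_mul_enT (m, 0)
      simp only at h2 h3
      obtain ⟨w, κ, hw, hκ⟩ := ih (size m) (by omega) m rfl
      exact ⟨w + 1, κ, HookChain.cons hm hw, hκ⟩

/-- The number of `e`-rim hooks removed in passing from `l` to its bicore. -/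
noncomputable def hooks (e : ℕ) (l : Bipartition) : ℕ := sInf {w | ∃ κ, ReducesTo e w l κ}

lemma exists_reducesTo {e : ℕ} (he : 1 ≤ e) (l : Bipartition) : ∃ κ, ReducesTo e (hooks e l) l κ :=
  Nat.sInf_mem (s := {w | ∃ κ, ReducesTo e w l κ}) (exists_reducesTo' he l)

lemma two_mul_enT_eq_hooks {e : ℕ} (he : 1 ≤ e) (x : Charged) :
    2 * enT x = 2 * e * hooks e x.1 + coreEn e (rch e x) := by
  obtain ⟨κ, hκ⟩ := exists_reducesTo he x.1
  exact hκ.two_mul_enT he x.2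

lemma ReducesTo.eq_hooks {e : ℕ} (he : 1 ≤ e) {w : ℕ} {l κ : Bipartition}
    (h : ReducesTo e w l κ) : w = hooks e l := by
  have h1 := h.two_mul_enT he 0
  have h2 := two_mul_enT_eq_hooks he (l, 0)
  simp only at h2
  have he' : (0 : ℤ) < e := by exact_mod_cast he
  have : (2 * e : ℤ) * w = (2 * e) * hooks e l := by linarith
  have := mul_left_cancel₀ (by positivity) this
  exact_mod_cast this

lemma isBicore_iff_hooks {e : ℕ} (he : 1 ≤ e) (l : Bipartition) : IsBicore e l ↔ hooks e l = 0 := by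
  constructor
  · intro h; exact (ReducesTo.eq_hooks he ⟨HookChain.nil l, h⟩).symm
  · intro h
    obtain ⟨κ, h1, h2⟩ := exists_reducesTo he l
    rw [h] at h1
    cases h1
    exact h2

/-! ### The invariants of a block -/

/-- The sum of the rows of the last beads on the runners through `j` of the bicore of `x`. -/
noncomputable def tv (e : ℕ) (x : Charged) (j : ℤ) : ℤ := rch e x 0 j + rch e x 1 j - 2

/-- The difference of the charges of the two runners through `j`. -/
noncomputable def dl (e : ℕ) (x : Charged) (j : ℤ) : ℤ := rch e x 0 j - rch e x 1 j

/-- The sum of the squares of the differences of runner charges. -/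
noncomputable def sq (e : ℕ) (x : Charged) : ℤ := ∑ i ∈ Finset.range e, dl e x i ^ 2

/-- The weight of `x`; together with the bicharge and `tv` it determines the block of `x`. -/
noncomputable def wt (e : ℕ) (x : Charged) : ℤ := 4 * hooks e x.1 + sq e x

lemma tv_quasiPeriodic {e : ℕ} (he : 1 ≤ e) (x : Charged) : QuasiPeriodic e 2 (tv e x) := by
  intro j
  rw [tv, tv, rch_quasiPeriodic he, rch_quasiPeriodic he]; ring

lemma dl_periodic {e : ℕ} (he : 1 ≤ e) (x : Charged) : QuasiPeriodic e 0 (dl e x) := by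
  intro j
  rw [dl, dl, rch_quasiPeriodic he, rch_quasiPeriodic he]; ring

lemma sum_tv {e : ℕ} (he : 1 ≤ e) (x : Charged) :
    ∑ i ∈ Finset.range e, tv e x i = x.2 0 + x.2 1 - 2 * e := by
  simp only [tv, Finset.sum_sub_distrib, Finset.sum_add_distrib, sum_rch he]
  simp; ring

lemma sum_dl {e : ℕ} (he : 1 ≤ e) (x : Charged) :
    ∑ i ∈ Finset.range e, dl e x i = x.2 0 - x.2 1 := by
  simp only [dl, Finset.sum_sub_distrib, sum_rch he]

/-- The energy in terms of the invariants: up to a function of `tv` it is a multiple of `wt`. -/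
lemma four_mul_enT {e : ℕ} (he : 1 ≤ e) (x : Charged) :
    4 * enT x = e * wt e x + ∑ i ∈ Finset.range e,
      (4 * (i : ℤ) * (tv e x i + 2) - 2 * e * (tv e x i + 2) + e * (tv e x i + 2) ^ 2) := by
  have h := two_mul_enT_eq_hooks he x
  rw [wt, mul_add, sq, Finset.mul_sum, add_assoc, ← Finset.sum_add_distrib]
  have : 2 * coreEn e (rch e x) = ∑ i ∈ Finset.range e, ((e : ℤ) * dl e x i ^ 2 +
      (4 * (i : ℤ) * (tv e x i + 2) - 2 * e * (tv e x i + 2) + e * (tv e x i + 2) ^ 2)) := by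
    rw [coreEn, ← Finset.sum_add_distrib, Finset.mul_sum]
    refine Finset.sum_congr rfl fun i _ => ?_
    rw [tv, dl]; ring
  linarith

lemma sum_map_residues {e : ℕ} (F : ZMod e → ℤ) (x : Charged) :
    ((residues e x).map F).sum =
      ∑ k, ∑ n ∈ (x.1 k).cells, F ((cont n + x.2 k : ℤ) : ZMod e) := by
  simp only [residues, Fin.sum_univ_two, Multiset.map_add, Multiset.sum_add, Multiset.map_map]
  rfl

/-- The residues with multiplicities determine the sums of runner charges. -/
lemma sum_residues_eq {e : ℕ} (he : 1 ≤ e) (x : Charged) {i : ℕ} (hi : i < e) :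
    ((residues e x).map fun z => (if z = (i : ZMod e) then 1 else 0) -
      (if z - 1 = (i : ZMod e) then (1 : ℤ) else 0)).sum =
      rch e x 0 i + rch e x 1 i - rc e (Set.Iio (x.2 0)) i - rc e (Set.Iio (x.2 1)) i := by
  rw [sum_map_residues, Fin.sum_univ_two]
  have h : ∀ k, rch e x k i = rc e (Set.Iio (x.2 k)) i + ∑ n ∈ (x.1 k).cells,
      ((if ((cont n + x.2 k : ℤ) : ZMod e) = (i : ℕ) then 1 else 0) -
      (if ((cont n + x.2 k : ℤ) : ZMod e) - 1 = (i : ℕ) then (1 : ℤ) else 0)) := by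
    intro k
    rw [rch, ← beadSum_residue he (maya_beads x k) hi, ← beadSum_residue he (maya_Iio _) hi, beads,
      beadSum_betaSet]
    simp only [Int.cast_sub, Int.cast_one]
  rw [h 0, h 1]; ring

lemma card_residues {e : ℕ} (x : Charged) : (residues e x).card = size x.1 := by
  simp [residues, size, Fin.sum_univ_two]

lemma zmod_const {e : ℕ} (he : 1 ≤ e) {f : ZMod e → ℤ} (h : ∀ i : ℕ, i < e → f i = f (i + 1))
    (z : ZMod e) : f z = f 0 := by
  have : NeZero e := ⟨by omega⟩
  have key : ∀ i : ℕ, i ≤ e → f i = f 0 := by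
    intro i
    induction i with
    | zero => simp
    | succ i ih => intro hi; rw [← ih (by omega), h i (by omega)]; push_cast; rfl
  rw [← key z.val (ZMod.val_lt z).le, ZMod.natCast_zmod_val]

/-- The classes of `∼` are described by the bicharge, `tv` and `wt`: differences of consecutive
residue multiplicities are the entries of `tv`, and the total multiplicity, which is the size, is
governed by the energy and hence by `wt`. -/
lemma sim_iff {e : ℕ} (he : 1 ≤ e) (x y : Charged) :
    sim e x y ↔ x.2 = y.2 ∧ (∀ j, tv e x j = tv e y j) ∧ wt e x = wt e y := by
  have : NeZero e := ⟨by omega⟩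
  have he' : (0 : ℤ) < e := by exact_mod_cast he
  show (x.2 = y.2 ∧ residues e x = residues e y) ↔ _
  refine and_congr_right fun ha => ?_
  have hen : (∀ j, tv e x j = tv e y j) → (wt e x = wt e y ↔ size x.1 = size y.1) := by
    intro ht
    have h1 := four_mul_enT he x
    have h2 := four_mul_enT he y
    simp only [ht] at h1
    have h3 := two_mul_enT x
    have h4 := two_mul_enT y
    rw [ha] at h3
    have h5 : (e : ℤ) * (wt e x - wt e y) = 4 * ((size x.1 : ℤ) - size y.1) := by linarith
    constructor
    · intro h
      rw [h, sub_self, mul_zero] at h5; omega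
    · intro h
      rw [h, sub_self, mul_zero, mul_eq_zero] at h5
      omega
  constructor
  · intro hr
    have ht : ∀ j, tv e x j = tv e y j := by
      refine (tv_quasiPeriodic he x).ext he (tv_quasiPeriodic he y) fun i hi => ?_
      have h1 := sum_residues_eq he x hi
      have h2 := sum_residues_eq he y hi
      rw [hr, h2, ha] at h1
      rw [tv, tv]; linarith
    refine ⟨ht, (hen ht).2 ?_⟩
    rw [← card_residues (e := e), ← card_residues (e := e), hr]
  · rintro ⟨ht, hw⟩
    -- the difference `f` of the multiplicities is constant, and its sum vanishes
    have hs := (hen ht).1 hw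
    classical
    let f : ZMod e → ℤ := fun z => ((residues e x).count z : ℤ) - (residues e y).count z
    have hcount : ∀ (s : Multiset (ZMod e)) (z : ZMod e), ((s.count z : ℕ) : ℤ) =
        (s.map fun w => if w = z then (1 : ℤ) else 0).sum := by
      intro s z
      induction s using Multiset.induction_on with
      | empty => simp
      | cons a s ih =>
        rw [Multiset.count_cons, Multiset.map_cons, Multiset.sum_cons, ← ih]
        push_cast
        simp only [eq_comm (a := z)]
        ring
    have hstep : ∀ i : ℕ, i < e → f i = f (i + 1) := by
      intro i hi
      have h1 := sum_residues_eq he x hi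
      have h2 := sum_residues_eq he y hi
      have h3 := ht i
      rw [tv, tv] at h3
      rw [Multiset.sum_map_sub, ← hcount] at h1 h2
      simp only [sub_eq_iff_eq_add] at h1 h2
      have h4 : ∀ s : Multiset (ZMod e), (s.map fun z => if z = (i : ZMod e) + 1 then (1 : ℤ) else 0).sum
          = s.count ((i : ZMod e) + 1) := fun s => (hcount s _).symm
      rw [h4] at h1 h2
      simp only [f]
      rw [ha] at h1
      linarith
    have hconst := zmod_const he hstep
    have hcard : ∀ s : Multiset (ZMod e), ((s.card : ℕ) : ℤ) = ∑ z, (s.count z : ℤ) := by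
      intro s
      rw [← Multiset.sum_count_eq_card (s := Finset.univ) (fun a _ => Finset.mem_univ a)]
      push_cast; rfl
    have hsum : ∑ z, f z = 0 := by
      simp only [f]
      rw [Finset.sum_sub_distrib, ← hcard, ← hcard, card_residues, card_residues, hs, sub_self]
    simp only [hconst, Finset.sum_const, Finset.card_univ, ZMod.card, nsmul_eq_mul] at hsum
    have h0 : f 0 = 0 := by
      rcases mul_eq_zero.1 hsum with h | h
      · omega
      · exact h
    refine Multiset.ext.2 fun z => ?_
    have := hconst z
    rw [h0] at this
    simp only [f] at this
    omega

/-! ### Realisation of invariants -/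

lemma enT_of_beads {x : Charged} {X : Fin 2 → Set ℤ} (h : ∀ k, beads x k = X k) :
    enT x = en (X 0) + en (X 1) := by rw [enT, h, h]

/-- Runner charges and a number of hooks can be prescribed. Moreover all the hooks can be put on a
single runner, by raising its last bead. -/
lemma exists_charged {e : ℕ} (he : 1 ≤ e) (q : Fin 2 → ℤ → ℤ) (hq : ∀ k, QuasiPeriodic e 1 (q k))
    (w : ℕ) (k₀ : Fin 2) (j₀ : ℤ) :
    ∃ x : Charged, (∀ k j, rch e x k j = q k j) ∧ hooks e x.1 = w ∧
      j₀ + e * (q k₀ j₀ - 1 + w) ∈ beads x k₀ ∧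
      ∀ y, ¬ y ≡ j₀ [ZMOD e] → (y ∈ beads x k₀ ↔ 0 < q k₀ y) := by
  have he' : (0 : ℤ) < e := by exact_mod_cast he
  set p : ℤ := j₀ + e * (q k₀ j₀ - 1) with hp
  have hM : ∀ k, Maya {z | 0 < q k z} := fun k => maya_core he (hq k)
  have hp1 : p ∈ {z | 0 < q k₀ z} := by
    show 0 < q k₀ p
    rw [hp, (hq k₀).add_mul]; omega
  have hp2 : ∀ m : ℤ, 0 < m → p + e * m ∉ {z | 0 < q k₀ z} := by
    intro m hm
    show ¬ 0 < q k₀ (p + e * m)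
    rw [hp, (hq k₀).add_mul, (hq k₀).add_mul]; omega
  have hpj : p ≡ j₀ [ZMOD e] := by
    rw [hp]; exact Int.modEq_iff_dvd.2 ⟨-(q k₀ j₀ - 1), by ring⟩
  -- the two bead sets
  have hX : ∃ X : Set ℤ, Maya X ∧ (∀ j, rc e X j = q k₀ j) ∧
      en X = en {z | 0 < q k₀ z} + e * w ∧ p + e * w ∈ X ∧
      ∀ y, ¬ y ≡ j₀ [ZMOD e] → (y ∈ X ↔ 0 < q k₀ y) := by
    rcases Nat.eq_zero_or_pos w with rfl | hw
    · exact ⟨_, hM k₀, rc_core (hq k₀), by simp, by simpa using hp1, fun y _ => Iff.rfl⟩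
    · have hw' : (0 : ℤ) < w := by exact_mod_cast hw
      refine ⟨moveBead p (p + e * w) {z | 0 < q k₀ z}, (hM k₀).moveBead _ _, fun j => ?_, ?_, ?_,
        fun y hy => ?_⟩
      · rw [rc_moveBead he (hM k₀) hp1 (hp2 w hw'), rc_core (hq k₀)]
      · rw [en, beadSum_moveBead _ (hM k₀) hp1 (hp2 w hw'), en]; ring
      · rw [mem_moveBead]; exact Or.inl rfl
      · rw [mem_moveBead]
        constructor
        · rintro (rfl | h)
          · exact absurd ((Int.modEq_iff_dvd.2 ⟨-w, by ring⟩ : p + e * w ≡ p [ZMOD e]).trans hpj) hy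
          · exact h.1
        · intro h
          exact Or.inr ⟨h, fun h' => hy (h' ▸ hpj)⟩
  obtain ⟨X, hXM, hXr, hXe, hXp, hXy⟩ := hX
  let Y : Fin 2 → Set ℤ := fun k => if k = k₀ then X else {z | 0 < q k z}
  have hYk : Y k₀ = X := if_pos rfl
  have hYn : ∀ k, k ≠ k₀ → Y k = {z | 0 < q k z} := fun k hk => if_neg hk
  obtain ⟨x, -, hx⟩ := exists_beads_eq Y (fun k => by
    by_cases hk : k = k₀
    · rw [hk, hYk]; exact hXM
    · rw [hYn k hk]; exact hM k)
  have hr : ∀ k j, rch e x k j = q k j := by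
    intro k j
    rw [rch, hx]
    by_cases hk : k = k₀
    · rw [hk, hYk, hXr]
    · rw [hYn k hk, rc_core (hq k)]
  refine ⟨x, hr, ?_, ?_, ?_⟩
  · have h1 := two_mul_enT_eq_hooks he x
    have hcore : 2 * (en {z | 0 < q 0 z} + en {z | 0 < q 1 z}) = coreEn e (rch e x) := by
      rw [mul_add, (isCore_core (hq 0)).two_mul_en he (hM 0),
        (isCore_core (hq 1)).two_mul_en he (hM 1), coreEn]
      simp only [rc_core (hq _), hr]
    have h2 : enT x = en {z | 0 < q 0 z} + en {z | 0 < q 1 z} + e * w := by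
      rw [enT_of_beads hx]
      fin_cases k₀
      · rw [hYn 1 (by decide)]; simp only [Fin.zero_eta] at hYk hXe; rw [hYk, hXe]; ring
      · rw [hYn 0 (by decide)]; simp only [Fin.mk_one] at hYk hXe; rw [hYk, hXe]; ring
    have : (2 * e : ℤ) * hooks e x.1 = (2 * e) * w := by linarith
    have := mul_left_cancel₀ (by positivity) this
    exact_mod_cast this
  · rw [hx, hYk]
    rwa [show j₀ + e * (q k₀ j₀ - 1 + w) = p + e * w by rw [hp]; ring]
  · intro y hy
    rw [hx, hYk]; exact hXy y hy

/-- A bead `u` above and a free position `v` below the places expected in the core cost hooks, by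
induction on the hooks: each removal moves `u` or `v` by at most one row, and never both because
they lie on different runners. -/
lemma hooks_ge {e : ℕ} (he : 1 ≤ e) {w : ℕ} {l κ : Bipartition} (h : HookChain e w l κ)
    (hκ : IsBicore e κ) (a : Bicharge) (k : Fin 2) {u v : ℤ} (huv : ¬ u ≡ v [ZMOD e])
    (hu : u ∈ beads (l, a) k) (hv : v ∉ beads (l, a) k) :
    1 - rch e (l, a) k u + rch e (l, a) k v ≤ w := by
  induction h generalizing u v with
  | nil l =>
    have hc := (isBicore_iff he (l, a)).1 hκ k
    rw [hc.mem_iff he (maya_beads _ _)] at hu hv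
    rw [rch, rch]; push_cast; omega
  | @cons w l m n h1 h2 ih =>
    have hq := rch_quasiPeriodic he (l, a) k
    obtain ⟨k', ⟨z, hz, hz', hm⟩, hj⟩ := (removesBiHook_iff he l m a).1 h1
    have hr : ∀ j, rch e (m, a) k j = rch e (l, a) k j := h1.rch_eq he a k
    by_cases hk : k = k'
    · subst hk
      have mm : ∀ y, y ∈ beads (m, a) k ↔ y = z - e ∨ y ∈ beads (l, a) k ∧ y ≠ z := by
        intro y; rw [hm, mem_moveBead]
      have hshift : ∀ y : ℤ, y - e ≡ y [ZMOD e] := fun y => Int.modEq_iff_dvd.2 ⟨1, by ring⟩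
      by_cases huz : u = z
      · subst huz
        have := ih hκ (u := u - e) (v := v) (fun h => huv ((hshift u).symm.trans h))
          ((mm _).2 (Or.inl rfl)) (by
            rw [mm]
            rintro (h | h)
            · exact huv (h ▸ (hshift u).symm)
            · exact hv h.1)
        rw [hr, hr] at this
        have h3 := hq (u - e)
        rw [sub_add_cancel] at h3
        push_cast; omega
      · by_cases hvz : v = z - e
        · have := ih hκ (u := u) (v := z) (fun h => huv (h.trans (by rw [hvz]; exact (hshift z).symm)))
            ((mm _).2 (Or.inr ⟨hu, huz⟩)) (by
              rw [mm]
              rintro (h | h)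
              · apply hv; rw [hvz, ← h]; exact hz
              · exact h.2 rfl)
          rw [hr, hr] at this
          have h3 := hq v
          rw [hvz, sub_add_cancel] at h3
          rw [hvz]
          push_cast; omega
        · have := ih hκ (u := u) (v := v) huv ((mm _).2 (Or.inr ⟨hu, huz⟩)) (by
            rw [mm]; rintro (h | h)
            · exact hvz h
            · exact hv h.1)
          rw [hr, hr] at this
          push_cast; omega
    · have hb : beads (m, a) k = beads (l, a) k := by rw [beads, beads]; simp only [hj k hk]
      have := ih hκ huv (by rwa [hb]) (by rwa [hb])
      rw [hr, hr] at this
      push_cast; omega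

lemma le_hooks {e : ℕ} (he : 1 ≤ e) (x : Charged) (k : Fin 2) {u v : ℤ} (huv : ¬ u ≡ v [ZMOD e])
    (hu : u ∈ beads x k) (hv : v ∉ beads x k) : 1 - rch e x k u + rch e x k v ≤ hooks e x.1 := by
  obtain ⟨κ, h1, h2⟩ := exists_reducesTo he x.1
  exact hooks_ge he h1 h2 x.2 k huv hu hv

/-! ### Blocks and their elements -/

lemma Block.mem_iff {e : ℕ} {B : Block e} {x : Charged} (hx : x ∈ B.1) (y : Charged) :
    y ∈ B.1 ↔ sim e x y := by
  obtain ⟨z, hz⟩ := B.2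
  rw [hz] at hx ⊢
  exact ⟨fun h => (sim e).trans hx ((sim e).symm h), fun h => (sim e).trans ((sim e).symm h) hx⟩

lemma Block.nonempty {e : ℕ} (B : Block e) : ∃ x, x ∈ B.1 := by
  obtain ⟨z, hz⟩ := B.2
  exact ⟨z, by rw [hz]; exact (sim e).refl z⟩

lemma Block.eq_of_mem {e : ℕ} {B B' : Block e} {x : Charged} (h : x ∈ B.1) (h' : x ∈ B'.1) :
    B = B' := by
  apply Subtype.ext
  ext y
  rw [Block.mem_iff h, Block.mem_iff h']

lemma Block.eq_of_sim {e : ℕ} {B B' : Block e} {x y : Charged} (h : x ∈ B.1) (h' : y ∈ B'.1)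
    (hs : sim e x y) : B = B' := Block.eq_of_mem ((Block.mem_iff h y).2 hs) h'

/-- The block of a charged bipartition. -/
def blockOf (e : ℕ) (x : Charged) : Block e := ⟨{y | sim e y x}, x, rfl⟩

lemma mem_blockOf (e : ℕ) (x : Charged) : x ∈ (blockOf e x).1 := (sim e).refl x

lemma hasHooks_iff_hooks {e : ℕ} (he : 1 ≤ e) (B : Block e) (h : ℕ) :
    HasHooks e B h ↔ IsGreatest {w | ∃ x ∈ B.1, hooks e x.1 = w} h := by
  have : {w : ℕ | ∃ x ∈ B.1, ∃ κ, ReducesTo e w x.1 κ} = {w | ∃ x ∈ B.1, hooks e x.1 = w} := by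
    ext w
    refine exists_congr fun x => and_congr_right fun _ => ?_
    constructor
    · rintro ⟨κ, hκ⟩; exact (hκ.eq_hooks he).symm
    · rintro rfl; exact exists_reducesTo he x.1
  rw [HasHooks, this]

lemma HasHooks.unique {e : ℕ} {B : Block e} {h h' : ℕ} (H : HasHooks e B h)
    (H' : HasHooks e B h') : h = h' := IsGreatest.unique H H'

/-! ### Differences of runner charges -/

/-- The number of odd values of `t` on a period. -/
def od (e : ℕ) (t : ℤ → ℤ) : ℕ := ((Finset.range e).filter fun i : ℕ => Odd (t i)).card

lemma od_congr {e : ℕ} {t t' : ℤ → ℤ} (h : ∀ j, t j = t' j) : od e t = od e t' := by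
  simp only [od, h]

lemma od_eq_sum (e : ℕ) (t : ℤ → ℤ) :
    (od e t : ℤ) = ∑ i ∈ Finset.range e, if Odd (t i) then 1 else 0 := by
  rw [od, Finset.card_filter]; push_cast; rfl

lemma odd_dl (e : ℕ) (x : Charged) (j : ℤ) : Odd (dl e x j) ↔ Odd (tv e x j) := by
  rw [show dl e x j = tv e x j + 2 * (1 - rch e x 1 j) by rw [dl, tv]; ring, Int.odd_add]
  simp

lemma sq_lower {d : ℤ} : (if Odd d then (1 : ℤ) else 0) ≤ d ^ 2 := by
  split_ifs with h
  · have : d ≠ 0 := by rintro rfl; simp at h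
    have := sq_pos_of_ne_zero this
    omega
  · positivity

lemma od_le_sq (e : ℕ) (x : Charged) : (od e (tv e x) : ℤ) ≤ sq e x := by
  rw [od_eq_sum, sq]
  refine Finset.sum_le_sum fun i _ => ?_
  have := sq_lower (d := dl e x i)
  simpa only [odd_dl] using this

lemma od_le_wt (e : ℕ) (x : Charged) : (od e (tv e x) : ℤ) ≤ wt e x := by
  have := od_le_sq e x
  rw [wt]; omega

/-- If the sum of the squares is the least possible, all differences are `0`, `1` or `-1`. -/
lemma abs_dl_le_one {e : ℕ} {x : Charged} (h : sq e x = od e (tv e x)) {i : ℕ} (hi : i < e) :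
    |dl e x i| ≤ 1 := by
  rw [od_eq_sum, sq] at h
  have h1 := (Finset.sum_eq_sum_iff_of_le (fun i _ => by
    have := sq_lower (d := dl e x i); simpa only [odd_dl] using this)).1 h.symm i
      (Finset.mem_range.2 hi)
  rw [abs_le_one_iff_mul_self_le_one, ← pow_two, ← h1]
  split_ifs <;> norm_num

lemma sq_eq_od {e : ℕ} {x : Charged} (h : ∀ i : ℕ, i < e → |dl e x i| ≤ 1) :
    sq e x = od e (tv e x) := by
  rw [od_eq_sum, sq]
  refine Finset.sum_congr rfl fun i hi => ?_
  have := h i (Finset.mem_range.1 hi)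
  rw [abs_le] at this
  simp only [← odd_dl]
  have : dl e x i = -1 ∨ dl e x i = 0 ∨ dl e x i = 1 := by omega
  rcases this with h | h | h <;> rw [h] <;> decide

/-- With `tv` fixed the differences vary by even numbers, so their squares vary by multiples
of `4`. -/
lemma four_dvd_sq_sub {e : ℕ} {x y : Charged} (h : ∀ j, tv e x j = tv e y j) :
    (4 : ℤ) ∣ sq e x - sq e y := by
  rw [sq, sq, ← Finset.sum_sub_distrib]
  refine Finset.dvd_sum fun i _ => ?_
  have h1 := h i
  have h2 : dl e x i = dl e y i + 2 * (rch e x 0 i - rch e y 0 i) := by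
    rw [tv, tv] at h1; rw [dl, dl]; linarith
  rw [h2]
  exact ⟨(rch e x 0 i - rch e y 0 i) * (dl e y i + (rch e x 0 i - rch e y 0 i)), by ring⟩

/-- The differences of runner charges can be prescribed, within the parity constraint. -/
lemma exists_of_dl {e : ℕ} (he : 1 ≤ e) (a : Bicharge) {t δ : ℤ → ℤ} (ht : QuasiPeriodic e 2 t)
    (hδ : QuasiPeriodic e 0 δ) (hpar : ∀ j, Odd (δ j) ↔ Odd (t j))
    (hst : ∑ i ∈ Finset.range e, t i = a 0 + a 1 - 2 * e)
    (hsd : ∑ i ∈ Finset.range e, δ i = a 0 - a 1) (w : ℕ) (k₀ : Fin 2) (j₀ : ℤ) :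
    ∃ x : Charged, x.2 = a ∧ (∀ j, tv e x j = t j) ∧ (∀ j, dl e x j = δ j) ∧ hooks e x.1 = w ∧
      j₀ + e * (rch e x k₀ j₀ - 1 + w) ∈ beads x k₀ ∧
      ∀ y, ¬ y ≡ j₀ [ZMOD e] → (y ∈ beads x k₀ ↔ 0 < rch e x k₀ y) := by
  have hp : ∀ j, ∃ r, t j + δ j = r + r := by
    intro j
    have := hpar j
    exact (Int.even_add.2 (by rw [← Int.not_odd_iff_even, ← Int.not_odd_iff_even]; tauto))
  let q : Fin 2 → ℤ → ℤ := ![fun j => (t j + 2 + δ j) / 2, fun j => (t j + 2 - δ j) / 2]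
  have hq0 : ∀ j, 2 * q 0 j = t j + 2 + δ j := by
    intro j; obtain ⟨r, hr⟩ := hp j
    show 2 * ((t j + 2 + δ j) / 2) = _
    omega
  have hq1 : ∀ j, 2 * q 1 j = t j + 2 - δ j := by
    intro j; obtain ⟨r, hr⟩ := hp j
    show 2 * ((t j + 2 - δ j) / 2) = _
    omega
  have hq : ∀ k, QuasiPeriodic e 1 (q k) := by
    intro k j
    have h1 := ht j; have h2 := hδ j
    fin_cases k
    · have := hq0 j; have := hq0 (j + e); simp only [Fin.zero_eta]; omega
    · have := hq1 j; have := hq1 (j + e); simp only [Fin.mk_one]; omega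
  obtain ⟨x, h1, h2, h3, h4⟩ := exists_charged he q hq w k₀ j₀
  have htv : ∀ j, tv e x j = t j := by
    intro j; have := hq0 j; have := hq1 j; rw [tv, h1, h1]; omega
  have hdl : ∀ j, dl e x j = δ j := by
    intro j; have := hq0 j; have := hq1 j; rw [dl, h1, h1]; omega
  refine ⟨x, ?_, htv, hdl, h2, by rwa [h1], fun y hy => by rw [h1]; exact h4 y hy⟩
  have e1 := sum_tv he x
  have e2 := sum_dl he x
  simp only [htv, hdl] at e1 e2
  rw [hst] at e1; rw [hsd] at e2
  ext k
  fin_cases k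
  · simp only [Fin.zero_eta]; omega
  · simp only [Fin.mk_one]; omega

lemma odd_emod {e : ℕ} {t : ℤ → ℤ} (ht : QuasiPeriodic e 2 t) (j : ℤ) :
    Odd (t (j % e)) ↔ Odd (t j) := by
  rw [ht.eq_emod j, Int.odd_sub]
  simp

/-- The bicharge difference is at most the number of odd values: this characterises the blocks
whose core block has a base tuple. -/
def Flat (e : ℕ) (x : Charged) : Prop := |x.2 0 - x.2 1| ≤ od e (tv e x)

lemma od_parity {e : ℕ} {t : ℤ → ℤ} {s : ℤ} (hst : ∑ i ∈ Finset.range e, t i = s) :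
    (2 : ℤ) ∣ od e t - s := by
  rw [od_eq_sum, ← hst, ← Finset.sum_sub_distrib]
  refine Finset.dvd_sum fun i _ => ?_
  split_ifs with h
  · obtain ⟨r, hr⟩ := h; exact ⟨-r, by rw [hr]; ring⟩
  · rw [Int.not_odd_iff_even] at h; obtain ⟨r, hr⟩ := h; exact ⟨-r, by rw [hr]; ring⟩

/-- The element with least differences whose positive differences are at `P`. -/
lemma exists_flat {e : ℕ} (he : 1 ≤ e) (a : Bicharge) {t : ℤ → ℤ} (ht : QuasiPeriodic e 2 t)
    (hst : ∑ i ∈ Finset.range e, t i = a 0 + a 1 - 2 * e) {P : Finset ℕ}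
    (hP : P ⊆ (Finset.range e).filter fun i : ℕ => Odd (t i))
    (hcard : 2 * (P.card : ℤ) = od e t + (a 0 - a 1)) (w : ℕ) (k₀ : Fin 2) (j₀ : ℤ) :
    ∃ x : Charged, x.2 = a ∧ (∀ j, tv e x j = t j) ∧ sq e x = od e t ∧
      (∀ i : ℕ, i < e → dl e x i = if i ∈ P then 1 else if Odd (t i) then -1 else 0) ∧
      hooks e x.1 = w ∧
      j₀ + e * (rch e x k₀ j₀ - 1 + w) ∈ beads x k₀ ∧
      ∀ y, ¬ y ≡ j₀ [ZMOD e] → (y ∈ beads x k₀ ↔ 0 < rch e x k₀ y) := by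
  classical
  have he' : (0 : ℤ) < e := by exact_mod_cast he
  let δ : ℤ → ℤ := fun j =>
    if (j % e).toNat ∈ P then 1 else if Odd (t (j % e)) then -1 else 0
  have hδi : ∀ i : ℕ, i < e → δ i = if i ∈ P then 1 else if Odd (t i) then -1 else 0 := by
    intro i hi
    simp only [δ]
    rw [Int.emod_eq_of_lt (by positivity) (by exact_mod_cast hi), Int.toNat_natCast]
  have hPodd : ∀ i ∈ P, i < e ∧ Odd (t i) := fun i hi => by simpa using hP hi
  obtain ⟨x, h1, h2, h3, h4, h5, h6⟩ := exists_of_dl he a (t := t) (δ := δ) ht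
    (fun j => by simp only [δ, Int.add_emod_right, sub_zero])
    (fun j => by
      rw [← odd_emod ht]
      simp only [δ]
      split_ifs with h h'
      · have := (hPodd _ h).2
        rw [Int.toNat_of_nonneg (Int.emod_nonneg j he'.ne')] at this
        simp [this]
      · simp [h']
      · simp [h']) hst
    (by
      rw [Finset.sum_congr rfl fun i hi => hδi i (Finset.mem_range.1 hi)]
      have : ∀ i ∈ Finset.range e, (if i ∈ P then (1 : ℤ) else if Odd (t i) then -1 else 0) =
          2 * (if i ∈ P then 1 else 0) - if Odd (t i) then 1 else 0 := by
        intro i _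
        by_cases h : i ∈ P
        · simp [h, (hPodd i h).2]
        · simp only [h, if_false]; split_ifs <;> norm_num
      rw [Finset.sum_congr rfl this, Finset.sum_sub_distrib, ← od_eq_sum, ← Finset.mul_sum]
      have : ∑ i ∈ Finset.range e, (if i ∈ P then (1 : ℤ) else 0) = P.card := by
        rw [Finset.sum_ite_mem, Finset.inter_eq_right.2 fun i hi => Finset.mem_range.2 (hPodd i hi).1]
        simp
      rw [this]; linarith) w k₀ j₀
  refine ⟨x, h1, h2, ?_, fun i hi => by rw [h3, hδi i hi], h4, h5, h6⟩
  rw [← od_congr h2]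
  refine sq_eq_od fun i hi => ?_
  rw [h3, hδi i hi]
  split_ifs <;> norm_num

lemma exists_flat' {e : ℕ} (he : 1 ≤ e) (a : Bicharge) {t : ℤ → ℤ} (ht : QuasiPeriodic e 2 t)
    (hst : ∑ i ∈ Finset.range e, t i = a 0 + a 1 - 2 * e) (hd : |a 0 - a 1| ≤ od e t) (w : ℕ) :
    ∃ x : Charged, x.2 = a ∧ (∀ j, tv e x j = t j) ∧ sq e x = od e t ∧ hooks e x.1 = w := by
  have hpar := od_parity hst
  rw [abs_le] at hd
  obtain ⟨P, hP, hc⟩ := Finset.exists_subset_card_eq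
    (s := (Finset.range e).filter fun i : ℕ => Odd (t i))
    (n := ((od e t + (a 0 - a 1)) / 2).toNat) (by
      rw [← od]; omega)
  obtain ⟨x, h1, h2, h3, -, h4, -⟩ := exists_flat he a ht hst hP (by rw [hc]; omega) w 0 0
  exact ⟨x, h1, h2, h3, h4⟩

lemma Flat.four_dvd {e : ℕ} (he : 1 ≤ e) {x : Charged} (hx : Flat e x) :
    (4 : ℤ) ∣ wt e x - od e (tv e x) := by
  obtain ⟨y, h1, h2, h3, h4⟩ := exists_flat' he x.2 (tv_quasiPeriodic he x) (sum_tv he x) hx 0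
  have := four_dvd_sq_sub (e := e) (x := x) (y := y) (fun j => (h2 j).symm)
  rw [h3] at this
  rw [wt]; omega

/-- The number `h(B)` for a flat block: as `wt` is `4` times the number of hooks plus the sum of
squares, the hooks are most numerous where the sum of squares takes its least value `od`. -/
lemma Flat.hasHooks_iff {e : ℕ} (he : 1 ≤ e) {B : Block e} {x : Charged} (hB : x ∈ B.1)
    (hx : Flat e x) (h : ℕ) : HasHooks e B h ↔ wt e x = 4 * h + od e (tv e x) := by
  obtain ⟨w, hw⟩ := hx.four_dvd he
  have hw0 : 0 ≤ w := by have := od_le_wt e x; omega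
  lift w to ℕ using hw0
  have key : HasHooks e B w := by
    rw [hasHooks_iff_hooks he]
    constructor
    · obtain ⟨y, h1, h2, h3, h4⟩ := exists_flat' he x.2 (tv_quasiPeriodic he x) (sum_tv he x) hx w
      refine ⟨y, (Block.mem_iff hB y).2 ((sim_iff he x y).2 ⟨h1.symm, fun j => (h2 j).symm, ?_⟩), h4⟩
      have : wt e y = 4 * w + od e (tv e x) := by rw [wt, h4, h3]
      omega
    · rintro v ⟨y, hy, rfl⟩
      obtain ⟨h1, h2, h3⟩ := (sim_iff he x y).1 ((Block.mem_iff hB y).1 hy)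
      have h4 := od_le_sq e y
      rw [← od_congr h2] at h4
      rw [wt] at h3
      have : wt e y = 4 * hooks e y.1 + sq e y := rfl
      have : wt e x = 4 * hooks e x.1 + sq e x := rfl
      omega
  constructor
  · intro H; rw [H.unique key]; omega
  · intro H; have : h = w := by omega
    rw [this]; exact key

/-! ### Core blocks -/

lemma bicore_ext {e : ℕ} (he : 1 ≤ e) {x y : Charged} (hx : IsBicore e x.1) (hy : IsBicore e y.1)
    (h : ∀ k j, rch e x k j = rch e y k j) : x = y := by
  refine beads_injective fun k => ?_
  ext z
  rw [((isBicore_iff he x).1 hx k).mem_iff he (maya_beads x k),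
    ((isBicore_iff he y).1 hy k).mem_iff he (maya_beads y k)]
  have := h k z
  rw [rch, rch] at this
  rw [this]

lemma charge_eq_of_rch {e : ℕ} (he : 1 ≤ e) {x y : Charged}
    (h : ∀ k j, rch e x k j = rch e y k j) : x.2 = y.2 := by
  ext k
  rw [← sum_rch he x k, ← sum_rch he y k]
  simp only [h]

lemma ReducesTo.wt_eq {e : ℕ} (he : 1 ≤ e) {w : ℕ} {x y : Charged} (h : ReducesTo e w x.1 y.1)
    (ha : y.2 = x.2) : (∀ k j, rch e y k j = rch e x k j) ∧ (∀ j, tv e y j = tv e x j) ∧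
      hooks e y.1 = 0 ∧ wt e y = sq e x := by
  have h1 : ∀ k j, rch e y k j = rch e x k j := by
    intro k j
    have := h.1.rch_eq he x.2 k j
    rw [← ha] at this
    exact this.trans (by rw [ha])
  have h2 := (isBicore_iff_hooks he _).1 h.2
  refine ⟨h1, fun j => by rw [tv, tv, h1, h1], h2, ?_⟩
  rw [wt, h2, sq, sq]
  simp only [dl, h1]
  simp

/-- The core block consists of the bicores with the bicharge and `tv` of the block whose runner
charge differences are least possible. -/
lemma Flat.coreBlock_eq {e : ℕ} (he : 1 ≤ e) {B : Block e} {x : Charged} (hB : x ∈ B.1)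
    (hx : Flat e x) :
    coreBlock e B = {y | x.2 = y.2 ∧ (∀ j, tv e x j = tv e y j) ∧ wt e y = od e (tv e x)} := by
  obtain ⟨h, hh⟩ : ∃ h, HasHooks e B h := by
    obtain ⟨w, hw⟩ := hx.four_dvd he
    have hw0 : 0 ≤ w := by have := od_le_wt e x; omega
    lift w to ℕ using hw0
    exact ⟨w, (hx.hasHooks_iff he hB w).2 (by omega)⟩
  have hwt := (hx.hasHooks_iff he hB h).1 hh
  ext y
  constructor
  · rintro ⟨z, hz, h', hh', hr, ha⟩
    obtain rfl := hh'.unique hh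
    obtain ⟨s1, s2, s3⟩ := (sim_iff he x z).1 ((Block.mem_iff hB z).1 hz)
    obtain ⟨r1, r2, r3, r4⟩ := hr.wt_eq he ha
    refine ⟨s1.trans ha.symm, fun j => by rw [s2, r2], ?_⟩
    have := hr.eq_hooks he
    have hz' : wt e z = 4 * hooks e z.1 + sq e z := rfl
    rw [r4]; omega
  · rintro ⟨h1, h2, h3⟩
    have h4 := od_le_sq e y
    rw [← od_congr h2] at h4
    have h5 : wt e y = 4 * hooks e y.1 + sq e y := rfl
    have hy0 : hooks e y.1 = 0 := by omega
    obtain ⟨z, z1, z2, -⟩ := exists_charged he (rch e y) (rch_quasiPeriodic he y) h 0 0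
    have za : y.2 = z.2 := charge_eq_of_rch he fun k j => (z1 k j).symm
    obtain ⟨κ, hκ⟩ := exists_reducesTo he z.1
    obtain ⟨r1, r2, r3, r4⟩ := ReducesTo.wt_eq he (x := z) (y := (κ, z.2)) hκ rfl
    have hy : y = (κ, z.2) := bicore_ext he ((isBicore_iff_hooks he _).2 hy0) hκ.2
      fun k j => by rw [r1, z1]
    refine ⟨z, (Block.mem_iff hB z).2 ((sim_iff he x z).2
      ⟨h1.trans za, fun j => ?_, ?_⟩), h, hh, ?_, za⟩
    · rw [h2, tv, tv, z1, z1]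
    · have : wt e z = 4 * hooks e z.1 + sq e z := rfl
      have : sq e z = sq e y := by simp only [sq, dl, z1]
      rw [z2] at *
      omega
    · rw [hy]; rwa [z2] at hκ

lemma lastRow_eq {e : ℕ} (he : 1 ≤ e) {x : Charged} (hx : IsBicore e x.1) (i : Fin e) (k : Fin 2) :
    lastRow e x i k = rch e x k (i : ℕ) - 1 := by
  have he' : (0 : ℤ) < e := by exact_mod_cast he
  have hc := (isBicore_iff he x).1 hx k
  have hq := rch_quasiPeriodic he x k
  have hg : IsGreatest {b : ℤ | b ∈ betaSet (x.2 k) (x.1 k) ∧ b ≡ (i : ℕ) [ZMOD e]}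
      ((i : ℕ) + e * (rch e x k (i : ℕ) - 1)) := by
    constructor
    · refine ⟨?_, Int.modEq_iff_dvd.2 ⟨-(rch e x k (i : ℕ) - 1), by ring⟩⟩
      refine (hc.mem_iff he (maya_beads x k) _).2 ?_
      rw [← rch, hq.add_mul]; omega
    · rintro b ⟨hb, hbi⟩
      obtain ⟨c, hc'⟩ := Int.modEq_iff_dvd.1 hbi.symm
      obtain rfl : b = (i : ℕ) + e * c := by linarith
      have h1 := (hc.mem_iff he (maya_beads x k) _).1 hb
      rw [← rch, hq.add_mul] at h1
      have : c ≤ rch e x k (i : ℕ) - 1 := by omega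
      have := mul_le_mul_of_nonneg_left this he'.le
      linarith
  rw [lastRow, hg.csSup_eq, add_sub_cancel_left, Int.mul_ediv_cancel_left _ he'.ne']

/-- A base tuple forces all differences in the core block to be at most `1` in absolute value, which
bounds their sum, the bicharge difference, by the number of odd entries. Conversely `⌊tⱼ / 2⌋` is a
base tuple. -/
lemma mem_circBlocksH_iff {e : ℕ} (he : 1 ≤ e) {B : Block e} {x : Charged} (hB : x ∈ B.1) (h : ℕ) :
    B ∈ circBlocksH e h ↔ HasHooks e B h ∧ Flat e x := by
  refine and_congr_right fun hh => ?_
  constructor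
  · rintro ⟨-, hbi, b, hb⟩
    obtain ⟨z, hz, hzh⟩ := ((hasHooks_iff_hooks he B h).1 hh).1
    obtain ⟨κ, hκ⟩ := exists_reducesTo he z.1
    have hy : (κ, z.2) ∈ coreBlock e B := ⟨z, hz, h, hh, hzh ▸ hκ, rfl⟩
    obtain ⟨s1, s2, s3⟩ := (sim_iff he x z).1 ((Block.mem_iff hB z).1 hz)
    obtain ⟨r1, r2, -, -⟩ := ReducesTo.wt_eq he (x := z) (y := (κ, z.2)) hκ rfl
    have habs : ∀ i : ℕ, i < e → |dl e (κ, z.2) i| ≤ 1 := by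
      intro i hi
      have h0 := hb _ hy ⟨i, hi⟩ 0
      have h1 := hb _ hy ⟨i, hi⟩ 1
      rw [lastRow_eq he hκ.2] at h0 h1
      simp only at h0 h1
      rw [dl, abs_le]; omega
    rw [Flat, s1, od_congr s2, ← od_congr r2, ← sum_dl he z]
    have hdl : ∀ j, dl e z j = dl e (κ, z.2) j := fun j => by rw [dl, dl, r1, r1]
    simp only [hdl]
    refine (Finset.abs_sum_le_sum_abs _ _).trans ?_
    rw [od_eq_sum]
    refine Finset.sum_le_sum fun i hi => ?_
    simp only [← odd_dl]
    have := habs i (Finset.mem_range.1 hi)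
    split_ifs with ho
    · exact this
    · rw [abs_le] at this
      have : dl e (κ, z.2) i = -1 ∨ dl e (κ, z.2) i = 0 ∨ dl e (κ, z.2) i = 1 := by omega
      rcases this with h | h | h <;> rw [h] at ho ⊢ <;> simp at ho ⊢
  · intro hx
    rw [hx.coreBlock_eq he hB]
    obtain ⟨y, y1, y2, y3, y4⟩ := exists_flat' he x.2 (tv_quasiPeriodic he x) (sum_tv he x) hx 0
    have hwy : wt e y = od e (tv e x) := by rw [wt, y4, y3]; simp
    have key : ∀ z : Charged, (x.2 = z.2 ∧ (∀ j, tv e x j = tv e z j) ∧ wt e z = od e (tv e x)) →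
        hooks e z.1 = 0 ∧ sq e z = od e (tv e z) := by
      rintro z ⟨h1, h2, h3⟩
      have h4 := od_le_sq e z
      rw [← od_congr h2] at h4 ⊢
      have h5 : wt e z = 4 * hooks e z.1 + sq e z := rfl
      omega
    refine ⟨⟨y, ?_⟩, fun z hz => (isBicore_iff_hooks he _).2 (key z hz).1,
      fun i => tv e x (i : ℕ) / 2, fun z hz i k => ?_⟩
    · ext z
      show _ ↔ sim e z y
      rw [sim_iff he]
      constructor
      · rintro ⟨h1, h2, h3⟩; exact ⟨by rw [← h1, y1], fun j => by rw [← h2, y2], by rw [h3, hwy]⟩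
      · rintro ⟨h1, h2, h3⟩; exact ⟨by rw [h1, y1], fun j => by rw [h2, y2], by rw [h3, hwy]⟩
    · obtain ⟨k1, k2⟩ := key z hz
      rw [lastRow_eq he ((isBicore_iff_hooks he _).2 k1)]
      simp only [hz.2.1 _]
      have h1 := abs_dl_le_one k2 i.2
      rw [abs_le, dl] at h1
      rw [tv]
      fin_cases k
      · simp only [Fin.zero_eta]; omega
      · simp only [Fin.mk_one]; omega

/-! ### The parameter of a block -/

lemma card_filter_fin_eq {e : ℕ} (p : ℕ → Prop) [DecidablePred p] :
    (Finset.univ.filter fun i : Fin e => p i).card = ((Finset.range e).filter p).card := by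
  rw [Finset.card_filter, Finset.card_filter, Finset.sum_range]

/-- The first `n` elements of a finite set, ordered by `≺`, are `n` in number. -/
lemma ncard_prec_lt {e : ℕ} (t : Fin e → ℤ) (I : Finset (Fin e)) {n : ℕ} (hn : n ≤ I.card) :
    {i | i ∈ I ∧ {j | j ∈ I ∧ Prec t j i}.ncard < n}.ncard = n := by
  classical
  let r : Fin e → ℕ := fun i => (I.filter fun j => Prec t j i).card
  have hr : ∀ i, {j | j ∈ I ∧ Prec t j i}.ncard = r i := by
    intro i
    have : {j | j ∈ I ∧ Prec t j i} = ((I.filter fun j => Prec t j i : Finset (Fin e)) :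
        Set (Fin e)) := by ext j; simp
    rw [this, Set.ncard_coe_finset]
  -- the rank function `r` maps the set bijectively to an initial segment
  have htrans : ∀ i j k, Prec t i j → Prec t j k → Prec t i k := by
    intro i j k h1 h2
    simp only [Prec] at *
    omega
  have hlt : ∀ i ∈ I, ∀ j, Prec t i j → r i < r j := by
    intro i hi j hij
    refine Finset.card_lt_card ?_
    rw [Finset.ssubset_iff_of_subset]
    · refine ⟨i, Finset.mem_filter.2 ⟨hi, hij⟩, fun h => ?_⟩
      have := (Finset.mem_filter.1 h).2
      simp only [Prec] at this
      omega
    · intro k hk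
      rw [Finset.mem_filter] at hk ⊢
      exact ⟨hk.1, htrans _ _ _ hk.2 hij⟩
  have hinj : Set.InjOn r I := by
    intro i hi j hj hij
    by_contra hne
    have : Prec t i j ∨ Prec t j i := by
      simp only [Prec]
      have : (i : ℕ) ≠ j := fun h => hne (Fin.ext h)
      simp only [Fin.lt_def]; omega
    rcases this with h | h
    · exact absurd hij (hlt i hi j h).ne
    · exact absurd hij (hlt j hj i h).ne'
  have himg : I.image r = Finset.range I.card := by
    refine Finset.eq_of_subset_of_card_le ?_ ?_
    · intro m hm
      obtain ⟨i, hi, rfl⟩ := Finset.mem_image.1 hm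
      rw [Finset.mem_range]
      refine Finset.card_lt_card ?_
      rw [Finset.ssubset_iff_of_subset (Finset.filter_subset _ _)]
      refine ⟨i, hi, fun h => ?_⟩
      have := (Finset.mem_filter.1 h).2
      simp only [Prec] at this
      omega
    · rw [Finset.card_image_of_injOn hinj, Finset.card_range]
  have hset : {i | i ∈ I ∧ {j | j ∈ I ∧ Prec t j i}.ncard < n} =
      ((I.filter fun i => r i < n : Finset (Fin e)) : Set (Fin e)) := by
    ext i; simp [hr]
  rw [hset, Set.ncard_coe_finset, ← Finset.card_image_of_injOn (f := r)
    (hinj.mono (by intro i hi; exact (Finset.mem_filter.1 hi).1))]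
  have : (I.filter fun i => r i < n).image r = Finset.range n := by
    ext m
    rw [Finset.mem_image, Finset.mem_range]
    constructor
    · rintro ⟨i, hi, rfl⟩; exact (Finset.mem_filter.1 hi).2
    · intro hm
      have : m ∈ I.image r := by rw [himg, Finset.mem_range]; omega
      obtain ⟨i, hi, rfl⟩ := Finset.mem_image.1 this
      exact ⟨i, Finset.mem_filter.2 ⟨hi, hm⟩, rfl⟩
  rw [this, Finset.card_range]

/-- The data of the triple `T` agree with the invariants of `x`. -/
def Matches {e : ℕ} (T : Triple e) (x : Charged) : Prop :=
  (∀ i : Fin e, T.t i = tv e x (i : ℕ)) ∧ (T.n : ℤ) - T.p = x.2 0 - x.2 1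

lemma card_oddIdx {e : ℕ} {t : Fin e → ℤ} {f : ℤ → ℤ} (h : ∀ i : Fin e, t i = f (i : ℕ)) :
    (oddIdx t).card = od e f := by
  rw [oddIdx, od, ← card_filter_fin_eq fun i : ℕ => Odd (f i)]
  simp only [h]

lemma Matches.card {e : ℕ} {T : Triple e} {x : Charged} (h : Matches T x) :
    T.n + T.p = od e (tv e x) := by rw [T.card_eq, card_oddIdx h.1]

lemma Matches.flat {e : ℕ} {T : Triple e} {x : Charged} (h : Matches T x) : Flat e x := by
  rw [Flat, ← h.2, ← h.card, abs_le]; push_cast; omega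

lemma Matches.eq_data {e : ℕ} (he : 1 ≤ e) {T : Triple e} {x y : Charged} (hx : Matches T x)
    (hy : Matches T y) : x.2 = y.2 ∧ ∀ j, tv e x j = tv e y j := by
  have ht : ∀ j, tv e x j = tv e y j :=
    (tv_quasiPeriodic he x).ext he (tv_quasiPeriodic he y) fun i hi =>
      (hx.1 ⟨i, hi⟩).symm.trans (hy.1 ⟨i, hi⟩)
  refine ⟨?_, ht⟩
  have h1 := sum_tv he x
  have h2 := sum_tv he y
  have h3 := hx.2.symm.trans hy.2
  simp only [ht] at h1
  ext k
  fin_cases k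
  · simp only [Fin.zero_eta]; omega
  · simp only [Fin.mk_one]; omega

lemma Matches.unique {e : ℕ} {T T' : Triple e} {x : Charged} (h : Matches T x)
    (h' : Matches T' x) : T = T' := by
  obtain ⟨t, n, p, hc⟩ := T
  obtain ⟨t', n', p', hc'⟩ := T'
  have h1 : t = t' := funext fun i => (h.1 i).trans (h'.1 i).symm
  have h2 := h.card
  have h3 := h'.card
  have h4 := h.2
  have h5 := h'.2
  simp only at *
  have : n = n' := by omega
  have : p = p' := by omega
  subst h1; subst n'; subst p'; rfl

lemma Flat.exists_matches {e : ℕ} (he : 1 ≤ e) {x : Charged} (h : Flat e x) :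
    ∃ T : Triple e, Matches T x := by
  have hp := od_parity (sum_tv he x)
  rw [Flat, abs_le] at h
  refine ⟨⟨fun i => tv e x (i : ℕ), ((od e (tv e x) + (x.2 0 - x.2 1)) / 2).toNat,
    ((od e (tv e x) - (x.2 0 - x.2 1)) / 2).toNat, ?_⟩, fun i => rfl, ?_⟩
  · rw [card_oddIdx (f := tv e x) fun i => rfl]; omega
  · simp only; omega

/-- The quasi-periodic extension of a sequence. -/
def extend {e : ℕ} (he : 0 < e) (c : ℤ) (t : Fin e → ℤ) (j : ℤ) : ℤ :=
  t ⟨(j % e).toNat, by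
    have := Int.emod_nonneg j (b := (e : ℤ)) (by omega)
    have := Int.emod_lt_of_pos j (b := (e : ℤ)) (by omega)
    omega⟩ - c * (j / e)

lemma extend_quasiPeriodic {e : ℕ} (he : 0 < e) (c : ℤ) (t : Fin e → ℤ) :
    QuasiPeriodic e c (extend he c t) := by
  intro j
  simp only [extend, Int.add_emod_right]
  have := Int.add_mul_ediv_right j 1 (c := (e : ℤ)) (by omega)
  rw [one_mul] at this
  rw [this]
  ring

lemma extend_apply {e : ℕ} (he : 0 < e) (c : ℤ) (t : Fin e → ℤ) (i : Fin e) :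
    extend he c t (i : ℕ) = t i := by
  have h1 : ((i : ℕ) : ℤ) % e = (i : ℕ) :=
    Int.emod_eq_of_lt (by positivity) (by exact_mod_cast i.2)
  have h2 : ((i : ℕ) : ℤ) / e = 0 :=
    Int.ediv_eq_zero_of_lt (by positivity) (by exact_mod_cast i.2)
  simp only [extend, h1, h2, Int.toNat_natCast]
  simp

lemma IMinus_subset {e : ℕ} (T : Triple e) {i : Fin e} (h : i ∈ IMinus T) : i ∈ oddIdx T.t := h.1

lemma ncard_IMinus {e : ℕ} (T : Triple e) : (IMinus T).ncard = T.n :=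
  ncard_prec_lt T.t (oddIdx T.t) (by rw [← T.card_eq]; omega)

lemma mem_oddIdx {e : ℕ} (t : Fin e → ℤ) (i : Fin e) : i ∈ oddIdx t ↔ Odd (t i) := by
  simp [oddIdx]

open Classical in
lemma sum_sign {e : ℕ} (T : Triple e) :
    ∑ i : Fin e, (if i ∈ IMinus T then (1 : ℤ) else if i ∈ oddIdx T.t then -1 else 0) =
      T.n - T.p := by
  have h1 : ∀ i : Fin e, (if i ∈ IMinus T then (1 : ℤ) else if i ∈ oddIdx T.t then -1 else 0) =
      2 * (if i ∈ IMinus T then 1 else 0) - if i ∈ oddIdx T.t then 1 else 0 := by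
    intro i
    by_cases h : i ∈ IMinus T
    · simp [h, IMinus_subset T h]
    · simp only [h, if_false]; split_ifs <;> norm_num
  simp only [h1, Finset.sum_sub_distrib, ← Finset.mul_sum]
  have h2 : ∑ i : Fin e, (if i ∈ IMinus T then (1 : ℤ) else 0) = T.n := by
    rw [← ncard_IMinus T, Set.ncard_eq_toFinset_card', Set.toFinset_card, Fintype.card_subtype,
      Finset.card_filter]
    push_cast; rfl
  have h3 : ∑ i : Fin e, (if i ∈ oddIdx T.t then (1 : ℤ) else 0) = T.n + T.p := by
    have := T.card_eq
    rw [Finset.sum_ite_mem, Finset.univ_inter]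
    simp [← this]
  rw [h2, h3]; ring

/-- The invariants of `φ*(T)`. -/
lemma IsPhiStar.matches {e : ℕ} (he : 1 ≤ e) {T : Triple e} {x : Charged} (h : IsPhiStar e T x) :
    Matches T x ∧ wt e x = od e (tv e x) := by
  classical
  obtain ⟨hb, h0, h1, h2⟩ := h
  simp only [lastRow_eq he hb] at h0 h1 h2
  have htv : ∀ i : Fin e, T.t i = tv e x (i : ℕ) := by
    intro i
    rw [tv]
    by_cases hi : i ∈ oddIdx T.t
    · obtain ⟨r, hr⟩ := (mem_oddIdx _ _).1 hi
      by_cases hm : i ∈ IMinus T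
      · have := h1 i hm; omega
      · have := h2 i ⟨hi, hm⟩; omega
    · have e0 := h0 i hi 0
      have e1 := h0 i hi 1
      rw [mem_oddIdx, Int.not_odd_iff_even] at hi
      obtain ⟨r, hr⟩ := hi
      omega
  have hdl : ∀ i : Fin e, dl e x (i : ℕ) =
      if i ∈ IMinus T then 1 else if i ∈ oddIdx T.t then -1 else 0 := by
    intro i
    rw [dl]
    split_ifs with hm hi
    · obtain ⟨r, hr⟩ := (mem_oddIdx _ _).1 (IMinus_subset T hm)
      have := h1 i hm; omega
    · obtain ⟨r, hr⟩ := (mem_oddIdx _ _).1 hi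
      have := h2 i ⟨hi, hm⟩; omega
    · have e0 := h0 i hi 0
      have e1 := h0 i hi 1
      omega
  refine ⟨⟨htv, ?_⟩, ?_⟩
  · rw [← sum_dl he x, Finset.sum_range, ← sum_sign T]
    exact Finset.sum_congr rfl fun i _ => (hdl i).symm
  · rw [wt, (isBicore_iff_hooks he _).1 hb, sq_eq_od fun i hi => ?_]
    · simp
    · rw [hdl ⟨i, hi⟩]; split_ifs <;> norm_num

lemma exists_isPhiStar {e : ℕ} (he : 1 ≤ e) (T : Triple e) : ∃ x, IsPhiStar e T x := by
  classical
  have he0 : 0 < e := he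
  let ε : Fin e → ℤ := fun i => if i ∈ IMinus T then 1 else if i ∈ oddIdx T.t then -1 else 0
  let q : Fin 2 → ℤ → ℤ :=
    ![extend he0 1 fun i => (T.t i + ε i) / 2 + 1, extend he0 1 fun i => (T.t i - ε i) / 2 + 1]
  obtain ⟨x, h1, h2, -⟩ := exists_charged he q (Fin.forall_fin_two.2
    ⟨extend_quasiPeriodic he0 1 fun i => (T.t i + ε i) / 2 + 1,
      extend_quasiPeriodic he0 1 fun i => (T.t i - ε i) / 2 + 1⟩) 0 0 0
  have hb : IsBicore e x.1 := (isBicore_iff_hooks he _).2 h2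
  have hq0 : ∀ i : Fin e, rch e x 0 (i : ℕ) = (T.t i + ε i) / 2 + 1 := fun i => by
    rw [h1]; exact extend_apply he0 1 (fun i => (T.t i + ε i) / 2 + 1) i
  have hq1 : ∀ i : Fin e, rch e x 1 (i : ℕ) = (T.t i - ε i) / 2 + 1 := fun i => by
    rw [h1]; exact extend_apply he0 1 (fun i => (T.t i - ε i) / 2 + 1) i
  refine ⟨x, hb, fun i hi k => ?_, fun i hi => ?_, fun i hi => ?_⟩
  · have hm : i ∉ IMinus T := fun h => hi (IMinus_subset T h)
    have hε : ε i = 0 := by simp only [ε, if_neg hm, if_neg hi]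
    rw [lastRow_eq he hb]
    fin_cases k
    · simp only [Fin.zero_eta]; rw [hq0, hε]; simp
    · simp only [Fin.mk_one]; rw [hq1, hε]; simp
  · have hε : ε i = 1 := by simp only [ε, if_pos hi]
    rw [lastRow_eq he hb, lastRow_eq he hb, hq0, hq1, hε]; omega
  · have hε : ε i = -1 := by simp only [ε, if_neg hi.2, if_pos hi.1]
    rw [lastRow_eq he hb, lastRow_eq he hb, hq0, hq1, hε]; omega

/-- `ψ(B) = T` is a comparison of `T` with the invariants of any element of `B`. -/
lemma isPsi_iff {e : ℕ} (he : 1 ≤ e) {B : Block e} {x : Charged} (hB : x ∈ B.1) (hx : Flat e x)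
    (T : Triple e) : IsPsi e B T ↔ Matches T x := by
  obtain ⟨y, hy⟩ := exists_isPhiStar he T
  obtain ⟨hm, hw⟩ := hy.matches he
  rw [IsPsi, hx.coreBlock_eq he hB]
  constructor
  · intro h
    have : y ∈ phi e T := ⟨y, hy, (sim e).refl y⟩
    rw [← h] at this
    obtain ⟨h1, h2, h3⟩ := this
    exact ⟨fun i => by rw [h2]; exact hm.1 i, by rw [h1]; exact hm.2⟩
  · intro h
    obtain ⟨e1, e2⟩ := h.eq_data he hm
    ext z
    constructor
    · rintro ⟨h1, h2, h3⟩
      refine ⟨y, hy, (sim_iff he y z).2 ⟨e1.symm.trans h1, fun j => by rw [← e2, h2], ?_⟩⟩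
      rw [hw, h3, od_congr e2]
    · rintro ⟨y', hy', hs⟩
      obtain ⟨hm', hw'⟩ := hy'.matches he
      obtain ⟨f1, f2⟩ := h.eq_data he hm'
      obtain ⟨s1, s2, s3⟩ := (sim_iff he y' z).1 hs
      exact ⟨f1.trans s1, fun j => by rw [f2, s2], by rw [← s3, hw', od_congr f2]⟩

lemma existsUnique_isPsi {e : ℕ} (he : 1 ≤ e) {h : ℕ} {B : Block e} (hB : B ∈ circBlocksH e h) :
    ∃! T, IsPsi e B T := by
  obtain ⟨x, hx⟩ := B.nonempty
  have hf := ((mem_circBlocksH_iff he hx h).1 hB).2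
  obtain ⟨T, hT⟩ := hf.exists_matches he
  refine ⟨T, (isPsi_iff he hx hf T).2 hT, fun T' hT' => ?_⟩
  exact ((isPsi_iff he hx hf T').1 hT').unique hT

/-- There is exactly one block with given number of hooks and parameter. -/
lemma existsUnique_block {e : ℕ} (he : 1 ≤ e) (h : ℕ) (T : Triple e) :
    ∃! D, D ∈ circBlocksH e h ∧ IsPsi e D T := by
  obtain ⟨y, hy⟩ := exists_isPhiStar he T
  obtain ⟨hm, hw⟩ := hy.matches he
  obtain ⟨x, x1, x2, x3, x4⟩ := exists_flat' he y.2 (tv_quasiPeriodic he y) (sum_tv he y) hm.flat h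
  have hxm : Matches T x := ⟨fun i => by rw [x2]; exact hm.1 i, by rw [x1]; exact hm.2⟩
  have hxw : wt e x = 4 * h + od e (tv e x) := by rw [wt, x4, x3, od_congr x2]
  refine ⟨blockOf e x, ⟨?_, (isPsi_iff he (mem_blockOf e x) hxm.flat T).2 hxm⟩, ?_⟩
  · rw [mem_circBlocksH_iff he (mem_blockOf e x)]
    exact ⟨(hxm.flat.hasHooks_iff he (mem_blockOf e x) h).2 hxw, hxm.flat⟩
  · rintro D ⟨hD, hDT⟩
    obtain ⟨z, hz⟩ := D.nonempty
    obtain ⟨hh, hf⟩ := (mem_circBlocksH_iff he hz h).1 hD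
    have hzm := (isPsi_iff he hz hf T).1 hDT
    obtain ⟨e1, e2⟩ := hzm.eq_data he hxm
    refine Block.eq_of_sim hz (mem_blockOf e x) ((sim_iff he z x).2 ⟨e1, e2, ?_⟩)
    rw [(hf.hasHooks_iff he hz h).1 hh, hxw, od_congr e2]

/-! ### Swapping neighbouring runners -/

/-- The permutation of the integers exchanging `b - 1` and `b` for all `b ≡ i` modulo `e`. -/
def sig (e : ℕ) (i j : ℤ) : ℤ :=
  if j ≡ i [ZMOD e] then j - 1 else if j ≡ i - 1 [ZMOD e] then j + 1 else j

lemma modEq_iff_exists {e : ℕ} {a b : ℤ} : a ≡ b [ZMOD e] ↔ ∃ m : ℤ, a = b + e * m := by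
  rw [Int.modEq_comm, Int.modEq_iff_dvd]
  exact ⟨fun ⟨m, hm⟩ => ⟨m, by linarith⟩, fun ⟨m, hm⟩ => ⟨m, by linarith⟩⟩

lemma not_modEq_of_lt {e : ℕ} {a b : ℤ} (h1 : a < b) (h2 : b < a + e) : ¬ a ≡ b [ZMOD e] := by
  rw [modEq_iff_exists]
  rintro ⟨m, hm⟩
  have he : (0 : ℤ) < e := by linarith
  rcases le_or_gt 0 m with h | h
  · have := mul_nonneg he.le h; linarith
  · have : (e : ℤ) * m ≤ e * (-1) := mul_le_mul_of_nonneg_left (by omega) he.le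
    linarith

lemma not_modEq_pred {e : ℕ} (he : 2 ≤ e) (j : ℤ) : ¬ j - 1 ≡ j [ZMOD e] :=
  not_modEq_of_lt (by omega) (by omega)

lemma modEq_add_iff {e : ℕ} {a b : ℤ} (c : ℤ) : a + c ≡ b + c [ZMOD e] ↔ a ≡ b [ZMOD e] :=
  ⟨fun h => Int.ModEq.add_right_cancel' c h, fun h => h.add_right c⟩

lemma modEq_pred_iff {e : ℕ} {a b : ℤ} : a - 1 ≡ b - 1 [ZMOD e] ↔ a ≡ b [ZMOD e] := by
  simpa [sub_eq_add_neg] using modEq_add_iff (e := e) (a := a) (b := b) (-1)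

lemma modEq_succ_iff {e : ℕ} {a b : ℤ} : a + 1 ≡ b [ZMOD e] ↔ a ≡ b - 1 [ZMOD e] := by
  rw [← modEq_pred_iff, add_sub_cancel_right]

lemma sig_of_eq {e : ℕ} {i j : ℤ} (h : j ≡ i [ZMOD e]) : sig e i j = j - 1 := if_pos h

lemma sig_of_pred {e : ℕ} (he : 2 ≤ e) {i j : ℤ} (h : j ≡ i - 1 [ZMOD e]) : sig e i j = j + 1 := by
  rw [sig, if_neg, if_pos h]
  intro h'
  exact not_modEq_pred he i (h.symm.trans h')

lemma sig_of_ne {e : ℕ} {i j : ℤ} (h : ¬ j ≡ i [ZMOD e]) (h' : ¬ j ≡ i - 1 [ZMOD e]) :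
    sig e i j = j := by rw [sig, if_neg h, if_neg h']

lemma sig_sig {e : ℕ} (he : 2 ≤ e) (i j : ℤ) : sig e i (sig e i j) = j := by
  by_cases h : j ≡ i [ZMOD e]
  · rw [sig_of_eq h, sig_of_pred he (modEq_pred_iff.2 h)]; ring
  · by_cases h' : j ≡ i - 1 [ZMOD e]
    · rw [sig_of_pred he h', sig_of_eq (modEq_succ_iff.2 h')]; ring
    · rw [sig_of_ne h h', sig_of_ne h h']

lemma sig_add_mul (e : ℕ) (i j m : ℤ) : sig e i (j + e * m) = sig e i j + e * m := by
  have h : ∀ c, j + e * m ≡ c [ZMOD e] ↔ j ≡ c [ZMOD e] := fun c =>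
    ⟨fun h => (modEq_iff_exists.2 ⟨m, rfl⟩ : j + e * m ≡ j [ZMOD e]).symm.trans h,
      fun h => (modEq_iff_exists.2 ⟨m, rfl⟩ : j + e * m ≡ j [ZMOD e]).trans h⟩
  simp only [sig, h]
  split_ifs <;> ring

lemma abs_sig_sub_le (e : ℕ) (i j : ℤ) : j - 1 ≤ sig e i j ∧ sig e i j ≤ j + 1 := by
  rw [sig]; split_ifs <;> omega

lemma mem_swapBeads {e : ℕ} (he : 2 ≤ e) (i : Fin e) (X : Set ℤ) (b : ℤ) :
    b ∈ swapBeads e i X ↔ sig e (i : ℕ) b ∈ X := by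
  show ((¬ b ≡ (i : ℕ) - 1 [ZMOD e] ∧ ¬ b ≡ (i : ℕ) [ZMOD e] ∧ b ∈ X) ∨
    (b ≡ (i : ℕ) [ZMOD e] ∧ b - 1 ∈ X) ∨ (b ≡ (i : ℕ) - 1 [ZMOD e] ∧ b + 1 ∈ X)) ↔ _
  by_cases h : b ≡ (i : ℕ) [ZMOD e]
  · have h' : ¬ b ≡ (i : ℕ) - 1 [ZMOD e] := fun h' => not_modEq_pred he _ (h'.symm.trans h)
    rw [sig_of_eq h]; tauto
  · by_cases h' : b ≡ (i : ℕ) - 1 [ZMOD e]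
    · rw [sig_of_pred he h']; tauto
    · rw [sig_of_ne h h']; tauto

lemma maya_swapBeads {e : ℕ} (he : 2 ≤ e) (i : Fin e) {X : Set ℤ} (hX : Maya X) :
    Maya (swapBeads e i X) := by
  obtain ⟨N, h1, h2⟩ := hX
  refine ⟨N + 1, fun x hx => ?_, fun x hx => ?_⟩ <;> rw [mem_swapBeads he] <;>
    have := abs_sig_sub_le e (i : ℕ) x
  · exact h1 _ (by omega)
  · exact h2 _ (by omega)

lemma rc_swapBeads {e : ℕ} (he : 2 ≤ e) (i : Fin e) (X : Set ℤ) (j : ℤ) :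
    rc e (swapBeads e i X) j = rc e X (sig e (i : ℕ) j) := by
  rw [rc, rc]
  congr 1
  ext b
  rw [mem_runner, mem_runner, mem_swapBeads he, sig_add_mul]

lemma swapBeads_swapBeads {e : ℕ} (he : 2 ≤ e) (i : Fin e) (X : Set ℤ) :
    swapBeads e i (swapBeads e i X) = X := by
  ext b; rw [mem_swapBeads he, mem_swapBeads he, sig_sig he]

/-- Sums over an arbitrary period. -/
lemma sum_window {e : ℕ} {c : ℤ} {f : ℤ → ℤ} (hf : QuasiPeriodic e c f) (u : ℤ) :
    ∑ m ∈ Finset.range e, f (u + m) = ∑ m ∈ Finset.range e, f m - c * u := by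
  have step : ∀ u, ∑ m ∈ Finset.range e, f (u + 1 + m) = ∑ m ∈ Finset.range e, f (u + m) - c := by
    intro u
    have h1 := Finset.sum_range_succ (fun m : ℕ => f (u + m)) e
    have h2 := Finset.sum_range_succ' (fun m : ℕ => f (u + m)) e
    rw [h1, hf] at h2
    simp only [Nat.cast_add, Nat.cast_one, Nat.cast_zero, add_zero] at h2
    have h3 : ∀ m : ℕ, u + 1 + (m : ℤ) = u + ((m : ℤ) + 1) := fun m => by ring
    simp only [h3]; linarith
  induction u using Int.induction_on with
  | zero => simp
  | succ i ih => rw [step, ih]; ring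
  | pred i ih =>
    have := step (-(i : ℤ) - 1)
    rw [sub_add_cancel, ih] at this
    linarith

/-- Two quasi-periodic functions that differ at two neighbouring residues only. -/
lemma sum_eq_of_pair {e : ℕ} (he : 2 ≤ e) {c D : ℤ} {f g : ℤ → ℤ} (hf : QuasiPeriodic e c f)
    (hg : QuasiPeriodic e c g) (i : ℤ) (h : f (i - 1) + f i = g (i - 1) + g i + D)
    (hne : ∀ j, ¬ j ≡ i [ZMOD e] → ¬ j ≡ i - 1 [ZMOD e] → f j = g j) :
    ∑ m ∈ Finset.range e, f m = ∑ m ∈ Finset.range e, g m + D := by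
  have h1 := sum_window hf (i - 1)
  have h2 := sum_window hg (i - 1)
  obtain ⟨n, rfl⟩ : ∃ n, e = n + 2 := ⟨e - 2, by omega⟩
  rw [Finset.sum_range_succ', Finset.sum_range_succ'] at h1 h2
  have h3 : ∀ m ∈ Finset.range n, f (i - 1 + ((m + 1 + 1 : ℕ) : ℤ)) =
      g (i - 1 + ((m + 1 + 1 : ℕ) : ℤ)) := by
    intro m hm
    rw [Finset.mem_range] at hm
    refine hne _ (fun hh => ?_) (fun hh => ?_)
    · exact not_modEq_of_lt (by push_cast; omega) (by push_cast; omega) hh.symm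
    · exact not_modEq_of_lt (by push_cast; omega) (by push_cast; omega) hh.symm
  rw [Finset.sum_congr rfl h3] at h1
  simp only [Nat.cast_add, Nat.cast_one, Nat.cast_zero, zero_add, add_zero, sub_add_cancel] at *
  linarith

lemma QuasiPeriodic.comp_sig {e : ℕ} {c : ℤ} {q : ℤ → ℤ} (hq : QuasiPeriodic e c q) (i : ℤ) :
    QuasiPeriodic e c fun j => q (sig e i j) := by
  intro j
  have := sig_add_mul e i j 1
  rw [mul_one] at this
  simp only [this]
  exact hq _

lemma sum_comp_sig {e : ℕ} (he : 2 ≤ e) {c : ℤ} {q : ℤ → ℤ} (hq : QuasiPeriodic e c q) (i : ℤ) :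
    ∑ m ∈ Finset.range e, q (sig e i m) = ∑ m ∈ Finset.range e, q m := by
  have := sum_eq_of_pair he (hq.comp_sig i) hq i (D := 0) (by
    rw [sig_of_eq (Int.ModEq.refl i), sig_of_pred he (Int.ModEq.refl _), sub_add_cancel]
    ring) (fun j h h' => by simp only [sig_of_ne h h'])
  rw [this, add_zero]

lemma chg_swapBeads {e : ℕ} (he : 2 ≤ e) (i : Fin e) {X : Set ℤ} (hX : Maya X) :
    chg (swapBeads e i X) = chg X := by
  rw [← sum_rc (e := e) (by omega) (maya_swapBeads he i hX), ← sum_rc (e := e) (by omega) hX]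
  simp only [rc_swapBeads he]
  exact sum_comp_sig he (fun j => rc_add (by omega) hX j) _

lemma exists_isSwap {e : ℕ} (he : 2 ≤ e) (i : Fin e) (x : Charged) : ∃ y, IsSwap e i x y := by
  obtain ⟨y, h1, h2⟩ := exists_beads_eq (fun k => swapBeads e i (beads x k))
    fun k => maya_swapBeads he i (maya_beads x k)
  have ha : y.2 = x.2 := by
    ext k; rw [h1, chg_swapBeads he i (maya_beads x k), chg_beads]
  refine ⟨y, ha, fun k => ?_⟩
  rw [← ha]; rw [ha]
  have := h2 k
  rw [beads, ha] at this
  exact this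

lemma isSwap_iff {e : ℕ} (he : 2 ≤ e) (i : Fin e) (x y : Charged) :
    IsSwap e i x y ↔ ∀ k, beads y k = swapBeads e i (beads x k) := by
  constructor
  · rintro ⟨h1, h2⟩ k
    rw [beads, h1, h2]; rfl
  · intro h
    have ha : y.2 = x.2 := by
      ext k; rw [← chg_beads, h, chg_swapBeads he i (maya_beads x k), chg_beads]
    refine ⟨ha, fun k => ?_⟩
    have := h k
    rw [beads, ha] at this
    exact this

lemma IsSwap.symm {e : ℕ} (he : 2 ≤ e) {i : Fin e} {x y : Charged} (h : IsSwap e i x y) :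
    IsSwap e i y x := by
  rw [isSwap_iff he] at *
  intro k; rw [h, swapBeads_swapBeads he]

lemma IsSwap.unique {e : ℕ} (he : 2 ≤ e) {i : Fin e} {x y z : Charged} (h : IsSwap e i x y)
    (h' : IsSwap e i x z) : y = z := by
  rw [isSwap_iff he] at *
  exact beads_injective fun k => by rw [h, h']

lemma IsSwap.rch_eq {e : ℕ} (he : 2 ≤ e) {i : Fin e} {x y : Charged} (h : IsSwap e i x y)
    (k : Fin 2) (j : ℤ) : rch e y k j = rch e x k (sig e (i : ℕ) j) := by
  rw [rch, (isSwap_iff he i x y).1 h, rc_swapBeads he]; rfl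

lemma IsSwap.tv_eq {e : ℕ} (he : 2 ≤ e) {i : Fin e} {x y : Charged} (h : IsSwap e i x y)
    (j : ℤ) : tv e y j = tv e x (sig e (i : ℕ) j) := by
  rw [tv, tv, h.rch_eq he, h.rch_eq he]

lemma IsSwap.isBicore {e : ℕ} (he : 2 ≤ e) {i : Fin e} {x y : Charged} (h : IsSwap e i x y)
    (hx : IsBicore e x.1) : IsBicore e y.1 := by
  rw [isBicore_iff (by omega)] at *
  intro k z hz
  rw [(isSwap_iff he i x y).1 h, mem_swapBeads he] at *
  have := sig_add_mul e (i : ℕ) z (-1)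
  rw [show z + (e : ℤ) * -1 = z - e by ring] at this
  rw [this, show sig e (i : ℕ) z + (e : ℤ) * -1 = sig e (i : ℕ) z - e by ring]
  exact hx k _ hz

/-- Swapping neighbouring runners turns the removal of a hook into the removal of a hook. -/
lemma IsSwap.removesBiHook {e : ℕ} (he : 2 ≤ e) {i : Fin e} {l m : Bipartition} {a : Bicharge}
    {y z : Charged} (hy : IsSwap e i (l, a) y) (hz : IsSwap e i (m, a) z)
    (h : RemovesBiHook e l m) : RemovesBiHook e y.1 z.1 := by
  obtain ⟨k, ⟨b, hb, hb', hm⟩, hj⟩ := (removesBiHook_iff (by omega) l m a).1 h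
  have hya : y.2 = a := hy.1
  have hza : z.2 = a := hz.1
  have hzy : (z.1, y.2) = z := by rw [hya, ← hza]
  have hinv : ∀ c d : ℤ, sig e (i : ℕ) c = d ↔ c = sig e (i : ℕ) d := by
    intro c d
    exact ⟨fun h => by rw [← h, sig_sig he], fun h => by rw [h, sig_sig he]⟩
  rw [isSwap_iff he] at hy hz
  have hsub : sig e (i : ℕ) (b - e) = sig e (i : ℕ) b - e := by
    have := sig_add_mul e (i : ℕ) b (-1)
    rw [show b + (e : ℤ) * -1 = b - e by ring] at this
    rw [this]; ring
  rw [removesBiHook_iff (by omega) _ _ y.2, hzy]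
  refine ⟨k, ⟨sig e (i : ℕ) b, ?_, ?_, ?_⟩, fun j hjk => ?_⟩
  · show _ ∈ beads y k
    rwa [hy, mem_swapBeads he, sig_sig he]
  · show _ ∉ beads y k
    rwa [hy, mem_swapBeads he, ← hsub, sig_sig he]
  · show _ = moveBead _ _ (beads y k)
    ext c
    rw [hz, mem_swapBeads he, hm, mem_moveBead, mem_moveBead, hy, mem_swapBeads he, hinv, hsub,
      ne_eq, ne_eq, hinv]
  · refine betaSet_injective (a j) ?_
    have h1 := hy j
    have h2 := hz j
    rw [beads, hya] at h1
    rw [beads, hza] at h2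
    rw [h1, h2, beads, beads]
    simp only [hj j hjk]

lemma HookChain.exists_swap {e : ℕ} (he : 2 ≤ e) {i : Fin e} {w : ℕ} {l κ : Bipartition}
    (h : HookChain e w l κ) (a : Bicharge) {y z : Charged} (hy : IsSwap e i (l, a) y)
    (hz : IsSwap e i (κ, a) z) : HookChain e w y.1 z.1 := by
  induction h generalizing y with
  | nil l => rw [hy.unique he hz]; exact HookChain.nil _
  | @cons w l m n h1 h2 ih =>
    obtain ⟨y', hy'⟩ := exists_isSwap he i (m, a)
    exact HookChain.cons (hy.removesBiHook he hy' h1) (ih hy' hz)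

lemma IsSwap.hooks_eq {e : ℕ} (he : 2 ≤ e) {i : Fin e} {x y : Charged} (h : IsSwap e i x y) :
    hooks e y.1 = hooks e x.1 := by
  obtain ⟨κ, h1, h2⟩ := exists_reducesTo (e := e) (by omega) x.1
  obtain ⟨z, hz⟩ := exists_isSwap he i (κ, x.2)
  exact (ReducesTo.eq_hooks (by omega) ⟨h1.exists_swap he x.2 h hz, hz.isBicore he h2⟩).symm

lemma IsSwap.sq_eq {e : ℕ} (he : 2 ≤ e) {i : Fin e} {x y : Charged} (h : IsSwap e i x y) :
    sq e y = sq e x := by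
  rw [sq, sq]
  have := sum_comp_sig he (q := fun j => dl e x j ^ 2) (c := 0)
    (fun j => by simp only [dl_periodic (by omega : 1 ≤ e) x j, sub_zero]) (i : ℕ)
  rw [← this]
  refine Finset.sum_congr rfl fun m _ => ?_
  rw [dl, dl, h.rch_eq he, h.rch_eq he]

lemma IsSwap.wt_eq {e : ℕ} (he : 2 ≤ e) {i : Fin e} {x y : Charged} (h : IsSwap e i x y) :
    wt e y = wt e x := by rw [wt, wt, h.hooks_eq he, h.sq_eq he]

lemma IsSwap.sim {e : ℕ} (he : 2 ≤ e) {i : Fin e} {x y x' y' : Charged} (h : IsSwap e i x y)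
    (h' : IsSwap e i x' y') (hs : sim e x x') : sim e y y' := by
  rw [sim_iff (by omega)] at *
  refine ⟨by rw [h.1, h'.1, hs.1], fun j => ?_, by rw [h.wt_eq he, h'.wt_eq he, hs.2.2]⟩
  rw [h.tv_eq he, h'.tv_eq he, hs.2.1]

/-- Swapping two neighbouring runners changes the size by the difference of the entries of `tv`. -/
lemma IsSwap.size_eq {e : ℕ} (he : 2 ≤ e) {i : Fin e} {x y : Charged} (h : IsSwap e i x y) :
    (size y.1 : ℤ) = size x.1 - (tv e x (i : ℕ) - tv e x ((i : ℕ) - 1)) := by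
  have he1 : 1 ≤ e := by omega
  have he' : (0 : ℤ) < e := by exact_mod_cast he1
  have hx := four_mul_enT he1 x
  have hy := four_mul_enT he1 y
  have sx := two_mul_enT x
  have sy := two_mul_enT y
  rw [h.wt_eq he] at hy
  rw [h.1] at sy
  -- the positions `U` of the first gaps are periodic, and complete the squares
  let U : Charged → ℤ → ℤ := fun z j => e * (tv e z j + 2) + 2 * j
  have hU : ∀ z, QuasiPeriodic e 0 fun j => U z j ^ 2 - 2 * e * U z j := by
    intro z j
    simp only [U, tv_quasiPeriodic he1 z j]
    ring
  have hF : ∀ z, (e : ℤ) * ∑ m ∈ Finset.range e, (4 * (m : ℤ) * (tv e z m + 2) - 2 * e * (tv e z m + 2) +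
      e * (tv e z m + 2) ^ 2) = ∑ m ∈ Finset.range e, (U z m ^ 2 - 2 * e * U z m) +
      ∑ m ∈ Finset.range e, (4 * e * (m : ℤ) - 4 * m ^ 2) := by
    intro z
    rw [Finset.mul_sum, ← Finset.sum_add_distrib]
    refine Finset.sum_congr rfl fun m _ => ?_
    simp only [U]; ring
  have hsum := sum_eq_of_pair he (hU y) (hU x) (i : ℕ)
    (D := -4 * e * (tv e x (i : ℕ) - tv e x ((i : ℕ) - 1))) (by
      simp only [U, h.tv_eq he]
      rw [sig_of_eq (Int.ModEq.refl _), sig_of_pred he (Int.ModEq.refl _), sub_add_cancel]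
      ring) (fun j h1 h2 => by simp only [U, h.tv_eq he, sig_of_ne h1 h2])
  have e1 := hF x
  have e2 := hF y
  rw [hsum] at e2
  have : (e : ℤ) * (4 * enT y - 4 * enT x) =
      e * (-4 * (tv e x (i : ℕ) - tv e x ((i : ℕ) - 1))) := by
    rw [hx, hy]; linarith
  have := mul_left_cancel₀ he'.ne' this
  linarith

/-! ### Addable nodes -/

lemma hasAddable_iff {e : ℕ} (i : Fin e) (x : Charged) :
    HasAddable e i x ↔ ∃ k, ∃ b : ℤ, b ≡ (i : ℕ) [ZMOD e] ∧ b - 1 ∈ beads x k ∧ b ∉ beads x k := by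
  have hres : ∀ (k : Fin 2) (n : ℕ × ℕ),
      residue e (x.2 k) n = ((i : ℕ) : ZMod e) ↔ cont n + x.2 k ≡ (i : ℕ) [ZMOD e] := by
    intro k n
    rw [← ZMod.intCast_eq_intCast_iff]
    simp only [residue, cont, Int.cast_natCast]
  refine exists_congr fun k => ?_
  constructor
  · rintro ⟨n, hn, hr, hm⟩
    exact ⟨cont n + x.2 k, (hres k n).1 hr,
      (exists_addable_iff (x.2 k) (x.1 k) _).1 ⟨n, hn, rfl, hm⟩⟩
  · rintro ⟨b, hb, hb'⟩
    obtain ⟨n, hn, rfl, hm⟩ := (exists_addable_iff (x.2 k) (x.1 k) b).2 hb'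
    exact ⟨n, hn, (hres k n).2 hb, hm⟩

/-- No element of the block has an addable `i`-node. -/
def NoAdd (e : ℕ) (i : Fin e) (B : Block e) : Prop := ∀ x ∈ B.1, ¬ HasAddable e i x

/-- All beads on the runner before the runner `i` have a right neighbour. -/
def Closed (e : ℕ) (i : ℤ) (x : Charged) : Prop :=
  ∀ k, ∀ b : ℤ, b ≡ i [ZMOD e] → b - 1 ∈ beads x k → b ∈ beads x k

lemma noAdd_iff {e : ℕ} (i : Fin e) (B : Block e) :
    NoAdd e i B ↔ ∀ x ∈ B.1, Closed e (i : ℕ) x := by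
  refine forall₂_congr fun x _ => ?_
  rw [hasAddable_iff, Closed]
  push Not
  rfl

lemma exists_swapBlock {e : ℕ} (he : 2 ≤ e) (i : Fin e) (B : Block e) :
    ∃ B' : Block e, B'.1 = {y | ∃ x ∈ B.1, IsSwap e i x y} := by
  obtain ⟨x, hx⟩ := B.nonempty
  obtain ⟨y, hy⟩ := exists_isSwap he i x
  refine ⟨blockOf e y, ?_⟩
  ext z
  rw [Block.mem_iff (mem_blockOf e y)]
  constructor
  · intro hs
    obtain ⟨x', hx'⟩ := exists_isSwap he i z
    exact ⟨x', (Block.mem_iff hx x').2 ((hy.symm he).sim he hx' hs), hx'.symm he⟩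
  · rintro ⟨x', hx', hs⟩
    exact hy.sim he hs ((Block.mem_iff hx x').1 hx')

/-- The block `Φᵢ(B)`. -/
noncomputable def swapBlock {e : ℕ} (he : 2 ≤ e) (i : Fin e) (B : Block e) : Block e :=
  (exists_swapBlock he i B).choose

lemma mem_swapBlock {e : ℕ} (he : 2 ≤ e) (i : Fin e) (B : Block e) (y : Charged) :
    y ∈ (swapBlock he i B).1 ↔ ∃ x ∈ B.1, IsSwap e i x y := by
  rw [swapBlock, (exists_swapBlock he i B).choose_spec]; rfl

lemma scopesMove_iff {e : ℕ} (he : 2 ≤ e) (B B' : Block e) :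
    ScopesMove e B B' ↔ ∃ i, NoAdd e i B ∧ B' = swapBlock he i B := by
  refine exists_congr fun i => and_congr_right fun _ => ?_
  rw [Subtype.ext_iff, swapBlock, (exists_swapBlock he i B).choose_spec]

/-! ### Confluence of the Scopes moves -/

lemma chg_mono {X Y : Set ℤ} (hX : Maya X) (hY : Maya Y) (h : X ⊆ Y) : chg X ≤ chg Y := by
  have h1 : chg Y - chg X = Finsupp.linearCombination ℤ (fun _ => (1 : ℤ)) (beadFun Y - beadFun X) := by
    rw [map_sub]; rfl
  have h2 : 0 ≤ Finsupp.linearCombination ℤ (fun _ => (1 : ℤ)) (beadFun Y - beadFun X) := by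
    rw [Finsupp.linearCombination_apply, Finsupp.sum]
    refine Finset.sum_nonneg fun z _ => ?_
    rw [Finsupp.sub_apply, hX.beadFun_apply, hY.beadFun_apply]
    by_cases hz : z ∈ X
    · rw [beadDiff_of_mem hz, beadDiff_of_mem (h hz)]; simp
    · rw [beadDiff_of_notMem hz]
      by_cases hz' : z ∈ Y
      · rw [beadDiff_of_mem hz']; simp
      · rw [beadDiff_of_notMem hz']; simp
  linarith

lemma Closed.rch_le {e : ℕ} (he : 1 ≤ e) {i : ℤ} {x : Charged} (h : Closed e i x) (k : Fin 2) :
    rch e x k (i - 1) ≤ rch e x k i := by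
  refine chg_mono (maya_runner he (maya_beads x k) _) (maya_runner he (maya_beads x k) _) ?_
  intro b hb
  rw [mem_runner] at *
  refine h k _ (modEq_iff_exists.2 ⟨b, rfl⟩) ?_
  rwa [show i + e * b - 1 = i - 1 + e * b by ring]

lemma Block.size_eq {e : ℕ} {B : Block e} {x y : Charged} (hx : x ∈ B.1) (hy : y ∈ B.1) :
    size x.1 = size y.1 := by
  have : residues e x = residues e y := ((Block.mem_iff hx y).1 hy).2
  rw [← card_residues (e := e), this, card_residues]

/-- The size of the bipartitions in a block. -/
noncomputable def bsize {e : ℕ} (B : Block e) : ℕ := size B.nonempty.choose.1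

lemma bsize_eq {e : ℕ} {B : Block e} {x : Charged} (hx : x ∈ B.1) : bsize B = size x.1 :=
  Block.size_eq B.nonempty.choose_spec hx

lemma bsize_swapBlock {e : ℕ} (he : 2 ≤ e) (i : Fin e) {B : Block e} {x : Charged} (hx : x ∈ B.1) :
    (bsize (swapBlock he i B) : ℤ) = bsize B - (tv e x (i : ℕ) - tv e x ((i : ℕ) - 1)) := by
  obtain ⟨y, hy⟩ := exists_isSwap he i x
  rw [bsize_eq hx, bsize_eq ((mem_swapBlock he i B y).2 ⟨x, hx, hy⟩), hy.size_eq he]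

/-- `Φᵢ` fixes a block exactly if the entries of `tv` at `i - 1` and `i` agree. -/
lemma swapBlock_eq_self_iff {e : ℕ} (he : 2 ≤ e) (i : Fin e) {B : Block e} {x : Charged}
    (hx : x ∈ B.1) : swapBlock he i B = B ↔ tv e x (i : ℕ) = tv e x ((i : ℕ) - 1) := by
  constructor
  · intro h
    have := bsize_swapBlock he i hx
    rw [h] at this; omega
  · intro h
    obtain ⟨y, hy⟩ := exists_isSwap he i x
    refine Block.eq_of_sim ((mem_swapBlock he i B y).2 ⟨x, hx, hy⟩) hx ?_
    rw [sim_iff (by omega)]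
    refine ⟨hy.1, fun j => ?_, hy.wt_eq he⟩
    rw [hy.tv_eq he]
    have hq := tv_quasiPeriodic (by omega : 1 ≤ e) x
    by_cases h1 : j ≡ (i : ℕ) [ZMOD e]
    · obtain ⟨m, rfl⟩ := modEq_iff_exists.1 h1
      rw [sig_of_eq h1, show ((i : ℕ) : ℤ) + e * m - 1 = (i : ℕ) - 1 + e * m by ring, hq.add_mul,
        hq.add_mul, h]
    · by_cases h2 : j ≡ (i : ℕ) - 1 [ZMOD e]
      · obtain ⟨m, rfl⟩ := modEq_iff_exists.1 h2
        rw [sig_of_pred he h2, show ((i : ℕ) : ℤ) - 1 + e * m + 1 = (i : ℕ) + e * m by ring,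
          hq.add_mul, hq.add_mul, h]
      · rw [sig_of_ne h1 h2]

lemma NoAdd.tv_le {e : ℕ} (he : 1 ≤ e) {i : Fin e} {B : Block e} (h : NoAdd e i B) {x : Charged}
    (hx : x ∈ B.1) : tv e x ((i : ℕ) - 1) ≤ tv e x (i : ℕ) := by
  have hc := (noAdd_iff i B).1 h x hx
  have h0 := hc.rch_le he 0
  have h1 := hc.rch_le he 1
  rw [tv, tv]; omega

/-- A Scopes move to a different block. -/
def Red (e : ℕ) (B B' : Block e) : Prop := ScopesMove e B B' ∧ B' ≠ B

lemma Red.bsize_lt {e : ℕ} (he : 2 ≤ e) {B B' : Block e} (h : Red e B B') : bsize B' < bsize B := by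
  obtain ⟨h1, h2⟩ := h
  obtain ⟨i, hi, rfl⟩ := (scopesMove_iff he B B').1 h1
  obtain ⟨x, hx⟩ := B.nonempty
  have h3 := bsize_swapBlock he i hx
  have h4 := hi.tv_le (by omega) hx
  have h5 : tv e x (i : ℕ) ≠ tv e x ((i : ℕ) - 1) := fun h => h2 ((swapBlock_eq_self_iff he i hx).2 h)
  omega

lemma reflTransGen_red {e : ℕ} {B B' : Block e} (h : Relation.ReflTransGen (ScopesMove e) B B') :
    Relation.ReflTransGen (Red e) B B' := by
  induction h with
  | refl => exact Relation.ReflTransGen.refl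
  | @tail b c _ h ih =>
    by_cases hne : c = b
    · rw [hne]; exact ih
    · exact ih.tail ⟨h, hne⟩

lemma sig_comm {e : ℕ} (he : 2 ≤ e) {i j : ℤ} (h0 : ¬ i ≡ j [ZMOD e]) (h1 : ¬ i ≡ j - 1 [ZMOD e])
    (h2 : ¬ j ≡ i - 1 [ZMOD e]) (b : ℤ) : sig e i (sig e j b) = sig e j (sig e i b) := by
  have h3 : ¬ i - 1 ≡ j - 1 [ZMOD e] := fun h => h0 (modEq_pred_iff.1 h)
  by_cases c1 : b ≡ i [ZMOD e]
  · have d1 : b - 1 ≡ i - 1 [ZMOD e] := modEq_pred_iff.2 c1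
    rw [sig_of_eq c1, sig_of_ne (fun h => h0 (c1.symm.trans h)) (fun h => h1 (c1.symm.trans h)),
      sig_of_ne (fun h => h2 ((d1.symm.trans h).symm)) (fun h => h3 (d1.symm.trans h)), sig_of_eq c1]
  · by_cases c2 : b ≡ i - 1 [ZMOD e]
    · have d2 : b + 1 ≡ i [ZMOD e] := modEq_succ_iff.2 c2
      rw [sig_of_pred he c2, sig_of_ne (fun h => h2 ((c2.symm.trans h).symm))
        (fun h => h3 (c2.symm.trans h)), sig_of_ne (fun h => h0 (d2.symm.trans h))
        (fun h => h1 (d2.symm.trans h)), sig_of_pred he c2]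
    · rw [sig_of_ne c1 c2]
      by_cases c3 : b ≡ j [ZMOD e]
      · have d3 : b - 1 ≡ j - 1 [ZMOD e] := modEq_pred_iff.2 c3
        rw [sig_of_eq c3, sig_of_ne (fun h => h1 (h.symm.trans d3)) (fun h => h3 (h.symm.trans d3))]
      · by_cases c4 : b ≡ j - 1 [ZMOD e]
        · have d4 : b + 1 ≡ j [ZMOD e] := modEq_succ_iff.2 c4
          rw [sig_of_pred he c4, sig_of_ne (fun h => h0 (h.symm.trans d4))
            (fun h => h2 (d4.symm.trans h))]
        · rw [sig_of_ne c3 c4, sig_of_ne c1 c2]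

/-- The values of the two neighbouring transpositions on the three residues they move. -/
lemma sig_values {e : ℕ} (he : 3 ≤ e) {i j : ℤ} (hij : i ≡ j - 1 [ZMOD e]) :
    (∀ b, b ≡ j [ZMOD e] → sig e i b = b ∧ sig e j b = b - 1) ∧
    (∀ b, b ≡ i [ZMOD e] → sig e i b = b - 1 ∧ sig e j b = b + 1) ∧
    (∀ b, b ≡ i - 1 [ZMOD e] → sig e i b = b + 1 ∧ sig e j b = b) := by
  have a1 : ¬ j ≡ i [ZMOD e] := fun h => not_modEq_pred (by omega) j (hij.symm.trans h.symm)
  have a2 : ¬ j ≡ i - 1 [ZMOD e] := by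
    intro h
    have := h.trans (modEq_pred_iff.2 hij)
    exact not_modEq_of_lt (e := e) (a := j - 1 - 1) (b := j) (by omega) (by omega) this.symm
  have a3 : ¬ i - 1 ≡ j - 1 [ZMOD e] := fun h => a1 (modEq_pred_iff.1 h).symm
  refine ⟨fun b hb => ⟨?_, sig_of_eq hb⟩, fun b hb => ⟨sig_of_eq hb, ?_⟩,
    fun b hb => ⟨sig_of_pred (by omega) hb, ?_⟩⟩
  · exact sig_of_ne (fun h => a1 (hb.symm.trans h)) (fun h => a2 (hb.symm.trans h))
  · exact sig_of_pred (by omega) (hb.trans hij)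
  · exact sig_of_ne (fun h => a2 (h.symm.trans hb)) (fun h => a3 (hb.symm.trans h))

lemma sig_braid {e : ℕ} (he : 3 ≤ e) {i j : ℤ} (hij : i ≡ j - 1 [ZMOD e]) (b : ℤ) :
    sig e i (sig e j (sig e i b)) = sig e j (sig e i (sig e j b)) := by
  obtain ⟨v1, v2, v3⟩ := sig_values he hij
  by_cases c1 : b ≡ j [ZMOD e]
  · have d1 : b - 1 ≡ i [ZMOD e] := (modEq_pred_iff.2 c1).trans hij.symm
    have d2 : b - 1 - 1 ≡ i - 1 [ZMOD e] := modEq_pred_iff.2 d1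
    rw [(v1 b c1).1, (v1 b c1).2, (v2 _ d1).1, (v3 _ d2).2]
  · by_cases c2 : b ≡ i [ZMOD e]
    · have d1 : b - 1 ≡ i - 1 [ZMOD e] := modEq_pred_iff.2 c2
      have d2 : b + 1 ≡ j [ZMOD e] := modEq_succ_iff.2 (c2.trans hij)
      rw [(v2 b c2).1, (v2 b c2).2, (v3 _ d1).2, (v3 _ d1).1, (v1 _ d2).1, (v1 _ d2).2]
      ring
    · by_cases c3 : b ≡ i - 1 [ZMOD e]
      · have d1 : b + 1 ≡ i [ZMOD e] := modEq_succ_iff.2 c3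
        have d2 : b + 1 + 1 ≡ j [ZMOD e] := modEq_succ_iff.2 (d1.trans hij)
        rw [(v3 b c3).1, (v3 b c3).2, (v2 _ d1).2, (v3 b c3).1, (v2 _ d1).2, (v1 _ d2).1]
      · have c4 : ¬ b ≡ j - 1 [ZMOD e] := fun h => c2 (h.trans hij.symm)
        rw [sig_of_ne c2 c3, sig_of_ne c1 c4, sig_of_ne c2 c3, sig_of_ne c1 c4]

lemma mem_beads_swap {e : ℕ} (he : 2 ≤ e) {i : Fin e} {x y : Charged} (h : IsSwap e i x y)
    (k : Fin 2) (b : ℤ) : b ∈ beads y k ↔ sig e (i : ℕ) b ∈ beads x k := by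
  rw [(isSwap_iff he i x y).1 h, mem_swapBeads he]

lemma swapBlock_comm {e : ℕ} (he : 2 ≤ e) {i j : Fin e} (B : Block e)
    (hs : ∀ b, sig e (i : ℕ) (sig e (j : ℕ) b) = sig e (j : ℕ) (sig e (i : ℕ) b)) :
    swapBlock he i (swapBlock he j B) = swapBlock he j (swapBlock he i B) := by
  obtain ⟨x, hx⟩ := B.nonempty
  obtain ⟨y, hy⟩ := exists_isSwap he i x
  obtain ⟨z, hz⟩ := exists_isSwap he j x
  obtain ⟨y', hy'⟩ := exists_isSwap he j y
  obtain ⟨z', hz'⟩ := exists_isSwap he i z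
  have : y' = z' := beads_injective fun k => by
    ext b
    rw [mem_beads_swap he hy', mem_beads_swap he hy, mem_beads_swap he hz', mem_beads_swap he hz, hs]
  refine Block.eq_of_mem (x := z') ((mem_swapBlock _ _ _ _).2 ⟨z, (mem_swapBlock _ _ _ _).2 ⟨x, hx, hz⟩, hz'⟩) ?_
  rw [← this]
  exact (mem_swapBlock _ _ _ _).2 ⟨y, (mem_swapBlock _ _ _ _).2 ⟨x, hx, hy⟩, hy'⟩

lemma swapBlock_braid {e : ℕ} (he : 2 ≤ e) {i j : Fin e} (B : Block e)
    (hs : ∀ b, sig e (i : ℕ) (sig e (j : ℕ) (sig e (i : ℕ) b)) =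
      sig e (j : ℕ) (sig e (i : ℕ) (sig e (j : ℕ) b))) :
    swapBlock he i (swapBlock he j (swapBlock he i B)) =
      swapBlock he j (swapBlock he i (swapBlock he j B)) := by
  obtain ⟨x, hx⟩ := B.nonempty
  obtain ⟨y, hy⟩ := exists_isSwap he i x
  obtain ⟨z, hz⟩ := exists_isSwap he j x
  obtain ⟨y', hy'⟩ := exists_isSwap he j y
  obtain ⟨z', hz'⟩ := exists_isSwap he i z
  obtain ⟨y'', hy''⟩ := exists_isSwap he i y'
  obtain ⟨z'', hz''⟩ := exists_isSwap he j z'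
  have : y'' = z'' := beads_injective fun k => by
    ext b
    rw [mem_beads_swap he hy'', mem_beads_swap he hy', mem_beads_swap he hy,
      mem_beads_swap he hz'', mem_beads_swap he hz', mem_beads_swap he hz, hs]
  refine Block.eq_of_mem (x := y'') ((mem_swapBlock _ _ _ _).2 ⟨y', (mem_swapBlock _ _ _ _).2
    ⟨y, (mem_swapBlock _ _ _ _).2 ⟨x, hx, hy⟩, hy'⟩, hy''⟩) ?_
  rw [this]
  exact (mem_swapBlock _ _ _ _).2 ⟨z', (mem_swapBlock _ _ _ _).2
    ⟨z, (mem_swapBlock _ _ _ _).2 ⟨x, hx, hz⟩, hz'⟩, hz''⟩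

lemma noAdd_swapBlock {e : ℕ} (he : 2 ≤ e) {i j : Fin e} {B : Block e}
    (h : ∀ x ∈ B.1, ∀ y, IsSwap e i x y → Closed e (j : ℕ) y) : NoAdd e j (swapBlock he i B) := by
  rw [noAdd_iff]
  intro y hy
  obtain ⟨x, hx, hs⟩ := (mem_swapBlock he i B y).1 hy
  exact h x hx y hs

lemma move_swapBlock {e : ℕ} (he : 2 ≤ e) {i : Fin e} {B : Block e} (h : NoAdd e i B) :
    ScopesMove e B (swapBlock he i B) := (scopesMove_iff he _ _).2 ⟨i, h, rfl⟩

/-- Two consecutive runners cannot both be free of addable nodes if there are only two runners. -/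
lemma not_noAdd_two {e : ℕ} (he : e = 2) {i j : Fin e} {B : Block e} (hij : i ≠ j)
    (hi : NoAdd e i B) (hj : NoAdd e j B) : False := by
  obtain ⟨x, hx⟩ := B.nonempty
  have ci := (noAdd_iff i B).1 hi x hx
  have cj := (noAdd_iff j B).1 hj x hx
  have hne : (i : ℕ) ≠ j := fun h => hij (Fin.ext h)
  have h1 : ∀ b, b - 1 ∈ beads x 0 → b ∈ beads x 0 := by
    intro b hb
    have : b ≡ (i : ℕ) [ZMOD e] ∨ b ≡ (j : ℕ) [ZMOD e] := by
      have := i.2; have := j.2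
      subst he
      simp only [Int.ModEq]; omega
    rcases this with h | h
    · exact ci 0 b h hb
    · exact cj 0 b h hb
  obtain ⟨N, n1, n2⟩ := maya_beads x 0
  have : ∀ m : ℕ, -(N : ℤ) - 1 + m ∈ beads x 0 := by
    intro m
    induction m with
    | zero => exact n1 _ (by simp)
    | succ m ih => refine h1 _ ?_; rwa [show -(N : ℤ) - 1 + ((m + 1 : ℕ) : ℤ) - 1 = -(N : ℤ) - 1 + m by push_cast; ring]
  exact n2 _ (by push_cast; omega) (this (2 * N + 1))

/-- The moves at neighbouring positions are joined by the braid relation. -/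
lemma join_braid {e : ℕ} (he : 2 ≤ e) {i j : Fin e} {B : Block e} (hi : NoAdd e i B)
    (hj : NoAdd e j B) (hij : ((i : ℕ) : ℤ) ≡ (j : ℕ) - 1 [ZMOD e]) :
    ∃ D, Relation.ReflTransGen (ScopesMove e) (swapBlock he i B) D ∧
      Relation.ReflTransGen (ScopesMove e) (swapBlock he j B) D := by
  have hne : i ≠ j := by
    rintro rfl; exact not_modEq_pred he _ hij.symm
  have he3 : 3 ≤ e := by
    by_contra h
    exact not_noAdd_two (by omega) hne hi hj
  obtain ⟨v1, v2, v3⟩ := sig_values he3 hij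
  have ci := (noAdd_iff i B).1 hi
  have cj := (noAdd_iff j B).1 hj
  have r1 : ∀ b : ℤ, b ≡ (j : ℕ) [ZMOD e] → b - 1 ≡ (i : ℕ) [ZMOD e] ∧
      b - 1 - 1 ≡ (i : ℕ) - 1 [ZMOD e] := fun b hb =>
    ⟨(modEq_pred_iff.2 hb).trans hij.symm, modEq_pred_iff.2 ((modEq_pred_iff.2 hb).trans hij.symm)⟩
  have r2 : ∀ b : ℤ, b ≡ (i : ℕ) [ZMOD e] → b - 1 ≡ (i : ℕ) - 1 [ZMOD e] ∧
      b + 1 ≡ (j : ℕ) [ZMOD e] := fun b hb =>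
    ⟨modEq_pred_iff.2 hb, modEq_succ_iff.2 (hb.trans hij)⟩
  have m1 : NoAdd e j (swapBlock he i B) := noAdd_swapBlock he fun x hx y hy k b hb h => by
    rw [mem_beads_swap he hy] at *
    rw [(v2 _ (r1 b hb).1).1] at h
    rw [(v1 b hb).1]
    exact cj x hx k b hb (ci x hx k _ (r1 b hb).1 h)
  have m2 : NoAdd e i (swapBlock he j (swapBlock he i B)) :=
    noAdd_swapBlock he fun y hy z hz k b hb h => by
      obtain ⟨x, hx, hxy⟩ := (mem_swapBlock he i B y).1 hy
      rw [mem_beads_swap he hz, mem_beads_swap he hxy] at *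
      rw [(v3 _ (r2 b hb).1).2, (v3 _ (r2 b hb).1).1, sub_add_cancel] at h
      rw [(v2 b hb).2, (v1 _ (r2 b hb).2).1]
      exact cj x hx k _ (r2 b hb).2 (by rwa [add_sub_cancel_right])
  have m3 : NoAdd e i (swapBlock he j B) := noAdd_swapBlock he fun x hx y hy k b hb h => by
    rw [mem_beads_swap he hy] at *
    rw [(v3 _ (r2 b hb).1).2] at h
    rw [(v2 b hb).2]
    exact cj x hx k _ (r2 b hb).2 (by rw [add_sub_cancel_right]; exact ci x hx k b hb h)
  have m4 : NoAdd e j (swapBlock he i (swapBlock he j B)) :=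
    noAdd_swapBlock he fun y hy z hz k b hb h => by
      obtain ⟨x, hx, hxy⟩ := (mem_swapBlock he j B y).1 hy
      rw [mem_beads_swap he hz, mem_beads_swap he hxy] at *
      rw [(v2 _ (r1 b hb).1).1, (v3 _ (r1 b hb).2).2] at h
      rw [(v1 b hb).1, (v1 b hb).2]
      exact ci x hx k _ (r1 b hb).1 h
  refine ⟨swapBlock he i (swapBlock he j (swapBlock he i B)), ?_, ?_⟩
  · exact (Relation.ReflTransGen.single (move_swapBlock he m1)).tail (move_swapBlock he m2)
  · rw [swapBlock_braid he B (sig_braid he3 hij)]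
    exact (Relation.ReflTransGen.single (move_swapBlock he m3)).tail (move_swapBlock he m4)

lemma modEq_fin {e : ℕ} {i j : Fin e} (h : ((i : ℕ) : ℤ) ≡ (j : ℕ) [ZMOD e]) : i = j := by
  have h' := (Int.natCast_modEq_iff).1 h
  exact Fin.ext (Nat.ModEq.eq_of_lt_of_lt h' i.2 j.2)

/-- Scopes moves are locally confluent: moves at distant positions commute, and moves at
neighbouring positions satisfy a braid relation. -/
lemma local_confluence {e : ℕ} (he : 2 ≤ e) {B C C' : Block e} (h : ScopesMove e B C)
    (h' : ScopesMove e B C') : ∃ D, Relation.ReflTransGen (ScopesMove e) C D ∧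
      Relation.ReflTransGen (ScopesMove e) C' D := by
  obtain ⟨i, hi, rfl⟩ := (scopesMove_iff he _ _).1 h
  obtain ⟨j, hj, rfl⟩ := (scopesMove_iff he _ _).1 h'
  by_cases h0 : ((i : ℕ) : ℤ) ≡ (j : ℕ) [ZMOD e]
  · rw [modEq_fin h0]; exact ⟨_, Relation.ReflTransGen.refl, Relation.ReflTransGen.refl⟩
  by_cases h1 : ((i : ℕ) : ℤ) ≡ (j : ℕ) - 1 [ZMOD e]
  · exact join_braid he hi hj h1
  by_cases h2 : ((j : ℕ) : ℤ) ≡ (i : ℕ) - 1 [ZMOD e]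
  · obtain ⟨D, d1, d2⟩ := join_braid he hj hi h2
    exact ⟨D, d2, d1⟩
  have h3 : ¬ ((i : ℕ) : ℤ) - 1 ≡ (j : ℕ) - 1 [ZMOD e] := fun h => h0 (modEq_pred_iff.1 h)
  have h4 : ¬ ((j : ℕ) : ℤ) - 1 ≡ (i : ℕ) - 1 [ZMOD e] := fun h => h3 h.symm
  have key : ∀ (i j : Fin e), ¬ ((i : ℕ) : ℤ) ≡ (j : ℕ) [ZMOD e] →
      ¬ ((i : ℕ) : ℤ) ≡ (j : ℕ) - 1 [ZMOD e] → ¬ ((j : ℕ) : ℤ) ≡ (i : ℕ) - 1 [ZMOD e] →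
      NoAdd e j B → NoAdd e j (swapBlock he i B) := by
    intro i j h0 h1 h2 hj
    refine noAdd_swapBlock he fun x hx y hy k b hb hh => ?_
    have hb' : b - 1 ≡ (j : ℕ) - 1 [ZMOD e] := modEq_pred_iff.2 hb
    rw [mem_beads_swap he hy] at *
    rw [sig_of_ne (fun h => h1 (h.symm.trans hb'))
      (fun h => h0 (modEq_pred_iff.1 (h.symm.trans hb')))] at hh
    rw [sig_of_ne (fun h => h0 (h.symm.trans hb)) (fun h => h2 (hb.symm.trans h))]
    exact (noAdd_iff j B).1 hj x hx k b hb hh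
  refine ⟨swapBlock he j (swapBlock he i B),
    Relation.ReflTransGen.single (move_swapBlock he (key i j h0 h1 h2 hj)), ?_⟩
  rw [swapBlock_comm he B fun b => (sig_comm he h0 h1 h2 b).symm]
  exact Relation.ReflTransGen.single (move_swapBlock he (key j i (fun h => h0 h.symm) h2 h1 hi))

/-- Newman's lemma, for a relation that decreases a natural number. -/
lemma newman {α : Type*} {r : α → α → Prop} (μ : α → ℕ) (hμ : ∀ a b, r a b → μ b < μ a)
    (hloc : ∀ a b c, r a b → r a c →
      ∃ d, Relation.ReflTransGen r b d ∧ Relation.ReflTransGen r c d)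
    {a b c : α} (hb : Relation.ReflTransGen r a b) (hc : Relation.ReflTransGen r a c) :
    ∃ d, Relation.ReflTransGen r b d ∧ Relation.ReflTransGen r c d := by
  induction hn : μ a using Nat.strong_induction_on generalizing a b c with
  | _ n ih =>
    rcases Relation.ReflTransGen.cases_head hb with rfl | ⟨b', hb1, hb2⟩
    · exact ⟨c, hc, Relation.ReflTransGen.refl⟩
    rcases Relation.ReflTransGen.cases_head hc with rfl | ⟨c', hc1, hc2⟩
    · exact ⟨b, Relation.ReflTransGen.refl, hb⟩
    obtain ⟨d, hd1, hd2⟩ := hloc a b' c' hb1 hc1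
    obtain ⟨u, hu1, hu2⟩ := ih (μ b') (hn ▸ hμ _ _ hb1) hb2 hd1 rfl
    obtain ⟨v, hv1, hv2⟩ := ih (μ c') (hn ▸ hμ _ _ hc1) (hd2.trans hu2) hc2 rfl
    exact ⟨v, hu1.trans hv1, hv2⟩

lemma ScopesEquiv.join {e : ℕ} (he : 2 ≤ e) {B C : Block e} (h : ScopesEquiv e B C) :
    ∃ D, Relation.ReflTransGen (Red e) B D ∧ Relation.ReflTransGen (Red e) C D := by
  induction h with
  | rel B C h => exact ⟨C, reflTransGen_red (Relation.ReflTransGen.single h), Relation.ReflTransGen.refl⟩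
  | refl B => exact ⟨B, Relation.ReflTransGen.refl, Relation.ReflTransGen.refl⟩
  | symm B C _ ih => obtain ⟨D, h1, h2⟩ := ih; exact ⟨D, h2, h1⟩
  | trans A B C _ _ ih1 ih2 =>
    obtain ⟨D, h1, h2⟩ := ih1
    obtain ⟨E, h3, h4⟩ := ih2
    obtain ⟨F, h5, h6⟩ := newman bsize (fun _ _ h => h.bsize_lt he) (fun a b c hb hc => by
      obtain ⟨d, d1, d2⟩ := local_confluence he hb.1 hc.1
      exact ⟨d, reflTransGen_red d1, reflTransGen_red d2⟩) h2 h3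
    exact ⟨F, h1.trans h5, h4.trans h6⟩

/-- A block admits no Scopes move to a different block. -/
def Normal (e : ℕ) (B : Block e) : Prop := ∀ C, ¬ Red e B C

lemma Normal.eq {e : ℕ} {B C : Block e} (h : Normal e B) (hr : Relation.ReflTransGen (Red e) B C) :
    B = C := by
  rcases Relation.ReflTransGen.cases_head hr with h' | ⟨D, h1, -⟩
  · exact h'
  · exact absurd h1 (h D)

lemma Normal.unique {e : ℕ} (he : 2 ≤ e) {B C : Block e} (hB : Normal e B) (hC : Normal e C)
    (h : ScopesEquiv e B C) : B = C := by
  obtain ⟨D, h1, h2⟩ := h.join he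
  rw [hB.eq h1, hC.eq h2]

lemma exists_normal {e : ℕ} (he : 2 ≤ e) (B : Block e) :
    ∃ N, Normal e N ∧ Relation.ReflTransGen (Red e) B N := by
  induction hn : bsize B using Nat.strong_induction_on generalizing B with
  | _ n ih =>
    by_cases h : Normal e B
    · exact ⟨B, h, Relation.ReflTransGen.refl⟩
    · simp only [Normal, not_forall, not_not] at h
      obtain ⟨C, hC⟩ := h
      obtain ⟨N, h1, h2⟩ := ih (bsize C) (hn ▸ hC.bsize_lt he) C rfl
      exact ⟨N, h1, Relation.ReflTransGen.head hC h2⟩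

lemma scopesEquiv_of_red {e : ℕ} {B C : Block e} (h : Relation.ReflTransGen (Red e) B C) :
    ScopesEquiv e B C := by
  induction h with
  | refl => exact Relation.EqvGen.refl _
  | tail _ h ih => exact ih.trans _ _ _ (Relation.EqvGen.rel _ _ h.1)

lemma bsize_le_of_red {e : ℕ} (he : 2 ≤ e) {B C : Block e}
    (h : Relation.ReflTransGen (Red e) B C) : bsize C ≤ bsize B := by
  induction h with
  | refl => exact le_rfl
  | tail _ h ih => exact (h.bsize_lt he).le.trans ih

/-- Every class of Scopes equivalence contains exactly one block of least size. -/
lemma existsUnique_min {e : ℕ} (he : 2 ≤ e) (B : Block e) :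
    ∃! D : Block e, ScopesEquiv e D B ∧ ∀ D' : Block e, ScopesEquiv e D' B →
      ∀ x ∈ D.1, ∀ y ∈ D'.1, size x.1 ≤ size y.1 := by
  obtain ⟨N, hN, hr⟩ := exists_normal he B
  have hNB : ScopesEquiv e N B := (scopesEquiv_of_red hr).symm
  have hle : ∀ D, ScopesEquiv e D B → Relation.ReflTransGen (Red e) D N := by
    intro D hD
    obtain ⟨E, h1, h2⟩ := ScopesEquiv.join he (hD.trans _ _ _ hNB.symm)
    rw [hN.eq h2]; exact h1
  refine ⟨N, ⟨hNB, fun D' hD' x hx y hy => ?_⟩, fun D hD => ?_⟩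
  · rw [← bsize_eq hx, ← bsize_eq hy]; exact bsize_le_of_red he (hle D' hD')
  · obtain ⟨x, hx⟩ := D.nonempty
    obtain ⟨y, hy⟩ := N.nonempty
    have h1 := hD.2 N hNB x hx y hy
    rw [← bsize_eq hx, ← bsize_eq hy] at h1
    rcases Relation.ReflTransGen.cases_head (hle D hD.1) with h | ⟨E, h2, h3⟩
    · exact h
    · have := h2.bsize_lt he
      have := bsize_le_of_red he h3
      omega

/-! ### Scopes moves of blocks whose core block has a base tuple -/

lemma sum_ge_pair {e : ℕ} (he : 2 ≤ e) {g : ℤ → ℤ} (hg : QuasiPeriodic e 0 g)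
    (hpos : ∀ j, 0 ≤ g j) (i : ℤ) : g (i - 1) + g i ≤ ∑ m ∈ Finset.range e, g m := by
  have h1 := sum_window hg (i - 1)
  obtain ⟨n, rfl⟩ : ∃ n, e = n + 2 := ⟨e - 2, by omega⟩
  rw [Finset.sum_range_succ', Finset.sum_range_succ'] at h1
  have h2 : 0 ≤ ∑ m ∈ Finset.range n, g (i - 1 + ((m + 1 + 1 : ℕ) : ℤ)) :=
    Finset.sum_nonneg fun m _ => hpos _
  simp only [Nat.cast_zero, zero_add, add_zero, Nat.cast_one, sub_add_cancel, zero_mul,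
    sub_zero] at h1 h2
  linarith

lemma excess_le {e : ℕ} (he : 2 ≤ e) (x : Charged) (i : ℤ) :
    (dl e x (i - 1) ^ 2 - if Odd (dl e x (i - 1)) then 1 else 0) +
      (dl e x i ^ 2 - if Odd (dl e x i) then 1 else 0) ≤ sq e x - od e (tv e x) := by
  have h := sum_ge_pair he (g := fun j => dl e x j ^ 2 - if Odd (dl e x j) then 1 else 0)
    (fun j => by simp only [dl_periodic (by omega : 1 ≤ e) x j, sub_zero])
    (fun j => by have := sq_lower (d := dl e x j); linarith) i
  rw [Finset.sum_sub_distrib] at h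
  rw [od_eq_sum, sq]
  simpa only [odd_dl] using h

lemma two_abs_le (d : ℤ) :
    2 * |d| ≤ d ^ 2 - (if Odd d then 1 else 0) + 2 * (if Odd d then 1 else 0) := by
  split_ifs with h
  · have := sq_nonneg (|d| - 1)
    nlinarith [sq_abs d]
  · rw [Int.not_odd_iff_even] at h
    obtain ⟨r, rfl⟩ := h
    have h1 : |r + r| = 2 * |r| := by rw [← two_mul, abs_mul]; rfl
    have h2 : |r| ≤ r ^ 2 := by
      rw [← sq_abs]
      rcases eq_or_lt_of_le (abs_nonneg r) with h | h
      · rw [← h]; norm_num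
      · nlinarith
    rw [h1]; nlinarith

/-- With least sum of squares, differences of both signs occur only if both `n` and `p` are
positive. -/
lemma signs {e : ℕ} (he : 1 ≤ e) {x : Charged} {T : Triple e} (hT : Matches T x)
    (hs : sq e x = od e (tv e x)) {u v : ℤ} (hu : dl e x u = 1) (hv : dl e x v = -1) :
    0 < min T.n T.p := by
  have hcard := hT.card
  have hdiff := hT.2
  rw [← sum_dl he] at hdiff
  have hod := od_eq_sum e (tv e x)
  have he' : (0 : ℤ) < e := by exact_mod_cast he
  have hmod : ∀ w, dl e x w = dl e x ((w % e).toNat : ℕ) ∧ (w % e).toNat < e := by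
    intro w
    have h0 := Int.emod_nonneg w he'.ne'
    have h1 := Int.emod_lt_of_pos w he'
    refine ⟨?_, by omega⟩
    have := (dl_periodic he x).eq_emod w
    rw [Int.toNat_of_nonneg h0]; linarith
  have hle : ∀ i ∈ Finset.range e, dl e x i ≤ if Odd (tv e x i) then 1 else 0 := by
    intro i hi
    have := abs_dl_le_one hs (Finset.mem_range.1 hi)
    rw [abs_le] at this
    simp only [← odd_dl]
    have : dl e x i = -1 ∨ dl e x i = 0 ∨ dl e x i = 1 := by omega
    rcases this with h | h | h <;> rw [h] <;> decide
  have hge : ∀ i ∈ Finset.range e, -dl e x i ≤ if Odd (tv e x i) then 1 else 0 := by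
    intro i hi
    have := abs_dl_le_one hs (Finset.mem_range.1 hi)
    rw [abs_le] at this
    simp only [← odd_dl]
    have : dl e x i = -1 ∨ dl e x i = 0 ∨ dl e x i = 1 := by omega
    rcases this with h | h | h <;> rw [h] <;> decide
  rw [lt_min_iff]
  constructor
  · by_contra hn
    have : ∑ i ∈ Finset.range e, -dl e x i = ∑ i ∈ Finset.range e, if Odd (tv e x i) then 1 else 0 := by
      rw [Finset.sum_neg_distrib, ← hod]; omega
    have h1 := (Finset.sum_eq_sum_iff_of_le hge).1 this _ (Finset.mem_range.2 (hmod u).2)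
    rw [← (hmod u).1, hu] at h1
    split_ifs at h1
  · by_contra hp
    have : ∑ i ∈ Finset.range e, dl e x i = ∑ i ∈ Finset.range e, if Odd (tv e x i) then 1 else 0 := by
      rw [← hod]; omega
    have h1 := (Finset.sum_eq_sum_iff_of_le hle).1 this _ (Finset.mem_range.2 (hmod v).2)
    rw [← (hmod v).1, hv] at h1
    split_ifs at h1

/-- If the runner `i` is sufficiently longer than its predecessor, there is no addable `i`-node. -/
lemma closed_of_le {e : ℕ} (he : 2 ≤ e) {y : Charged} {T : Triple e} (hT : Matches T y) {h : ℕ}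
    (hw : wt e y = 4 * h + od e (tv e y)) {i : ℤ}
    (hD : 2 * h + dTerm T.n T.p (tv e y (i - 1)) (tv e y i) ≤ tv e y i - tv e y (i - 1)) :
    Closed e i y := by
  have he1 : 1 ≤ e := by omega
  intro k b hb hb1
  by_contra hb2
  obtain ⟨m, rfl⟩ := modEq_iff_exists.1 hb
  have hk := le_hooks he1 y k (not_modEq_pred he _) hb1 hb2
  have hq := rch_quasiPeriodic he1 y k
  rw [hq.add_mul, show i + e * m - 1 = i - 1 + e * m by ring, hq.add_mul] at hk
  have hex := excess_le he y i
  have hwt : wt e y = 4 * hooks e y.1 + sq e y := rfl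
  have a1 := two_abs_le (dl e y (i - 1))
  have a2 := two_abs_le (dl e y i)
  set u := dl e y (i - 1) with hu
  set v := dl e y i with hv
  have huv : 2 * (rch e y k i - rch e y k (i - 1)) ≥ tv e y i - tv e y (i - 1) - |u - v| := by
    have e1 : u - v ≤ |u - v| := le_abs_self _
    have e2 : -(u - v) ≤ |u - v| := neg_le_abs _
    rw [tv, tv]
    rw [dl] at hu hv
    fin_cases k
    · simp only [Fin.zero_eta]; omega
    · simp only [Fin.mk_one]; omega
  have htri : |u - v| ≤ |u| + |v| := abs_sub _ _
  have hdn : 0 ≤ dTerm T.n T.p (tv e y (i - 1)) (tv e y i) := by rw [dTerm]; split_ifs <;> norm_num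
  have ou : Odd u ↔ Odd (tv e y (i - 1)) := odd_dl e y _
  have ov : Odd v ↔ Odd (tv e y i) := odd_dl e y _
  by_cases hou : Odd u
  · by_cases hov : Odd v
    · rw [if_pos hou] at a1 hex
      rw [if_pos hov] at a2 hex
      -- equality holds everywhere, so that the two differences are `1` and `-1`
      have hu1 : |u| = 1 := by
        have h1 : u ^ 2 - 1 + 2 = 2 * |u| := by linarith
        rw [← sq_abs] at h1
        have : (|u| - 1) ^ 2 = 0 := by linarith [h1, show (|u| - 1) ^ 2 = |u| ^ 2 - 2 * |u| + 1 by ring]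
        have := pow_eq_zero_iff (two_ne_zero) |>.1 this
        linarith
      have hv1 : |v| = 1 := by
        have h1 : v ^ 2 - 1 + 2 = 2 * |v| := by linarith
        rw [← sq_abs] at h1
        have : (|v| - 1) ^ 2 = 0 := by linarith [h1, show (|v| - 1) ^ 2 = |v| ^ 2 - 2 * |v| + 1 by ring]
        have := pow_eq_zero_iff (two_ne_zero) |>.1 this
        linarith
      have hsq : sq e y = od e (tv e y) := by
        have := od_le_sq e y
        linarith
      have hd0 : dTerm T.n T.p (tv e y (i - 1)) (tv e y i) = 0 := by linarith
      have hne : |u - v| = 2 := by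
        have := od_le_sq e y
        linarith
      have hmin : 0 < min T.n T.p := by
        rcases (abs_eq (by norm_num)).1 hu1 with h1 | h1 <;>
          rcases (abs_eq (by norm_num)).1 hv1 with h2 | h2
        · rw [h1, h2] at hne; norm_num at hne
        · exact signs he1 hT hsq h1 h2
        · exact signs he1 hT hsq h2 h1
        · rw [h1, h2] at hne; norm_num at hne
      rw [dTerm, if_pos ⟨hmin, ou.1 hou, ov.1 hov⟩] at hd0
      norm_num at hd0
    · rw [if_pos hou] at a1 hex
      rw [if_neg hov] at a2 hex
      linarith
  · rw [if_neg hou] at a1 hex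
    split_ifs at a2 hex <;> linarith

/-- All hooks on the runner `i - 1` produce an addable `i`-node, unless the runner `i` is
sufficiently longer. -/
lemma exists_not_closed {e : ℕ} (he : 2 ≤ e) (y : Charged) (h : ℕ) {i : ℤ} {k : Fin 2}
    (hD : rch e y k i - rch e y k (i - 1) < h) :
    ∃ z : Charged, (∀ k j, rch e z k j = rch e y k j) ∧ hooks e z.1 = h ∧ ¬ Closed e i z := by
  have he1 : 1 ≤ e := by omega
  obtain ⟨z, h1, h2, h3, h4⟩ := exists_charged he1 (rch e y) (rch_quasiPeriodic he1 y) h k (i - 1)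
  refine ⟨z, h1, h2, fun hc => ?_⟩
  have hq := rch_quasiPeriodic he1 y k
  have hmod : i + e * (rch e y k (i - 1) - 1 + h) ≡ i [ZMOD e] := modEq_iff_exists.2 ⟨_, rfl⟩
  have := hc k (i + e * (rch e y k (i - 1) - 1 + h)) hmod
    (by rwa [show i + e * (rch e y k (i - 1) - 1 + h) - 1 =
      i - 1 + e * (rch e y k (i - 1) - 1 + h) by ring])
  rw [h4 _ (fun hh => not_modEq_pred he i (hh.symm.trans hmod)), hq.add_mul] at this
  omega

/-- A move at `i` applies exactly if `2 h + dᵢ ≤ tᵢ - tᵢ₋₁`. Below this bound an element with an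
addable `i`-node arises from the least favourable distribution of the differences, by putting all
`h` hooks on one runner `i - 1`. -/
lemma noAdd_iff_le {e : ℕ} (he : 2 ≤ e) {B : Block e} {x : Charged} (hx : x ∈ B.1) {T : Triple e}
    (hT : Matches T x) {h : ℕ} (hw : wt e x = 4 * h + od e (tv e x)) (i : Fin e) :
    NoAdd e i B ↔ 2 * h + dTerm T.n T.p (tv e x ((i : ℕ) - 1)) (tv e x (i : ℕ)) ≤
      tv e x (i : ℕ) - tv e x ((i : ℕ) - 1) := by
  have he1 : 1 ≤ e := by omega
  have he' : (0 : ℤ) < e := by exact_mod_cast he1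
  rw [noAdd_iff]
  constructor
  · intro hc
    by_contra hD
    push Not at hD
    obtain ⟨y, k, hya, hyt, hys, hyD⟩ : ∃ (y : Charged) (k : Fin 2), y.2 = x.2 ∧
        (∀ j, tv e y j = tv e x j) ∧ sq e y = od e (tv e x) ∧
        rch e y k (i : ℕ) - rch e y k ((i : ℕ) - 1) < h := by
      by_cases hd : 0 < min T.n T.p ∧ Odd (tv e x ((i : ℕ) - 1)) ∧ Odd (tv e x (i : ℕ))
      · -- a difference `-1` on the runner `i - 1` and `1` on the runner `i`
        rw [dTerm, if_pos hd] at hD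
        obtain ⟨hmin, ho1, ho2⟩ := hd
        rw [lt_min_iff] at hmin
        have hq := tv_quasiPeriodic he1 x
        set i' : ℕ := ((((i : ℕ) : ℤ) - 1) % e).toNat with hi'
        have h0 := Int.emod_nonneg (((i : ℕ) : ℤ) - 1) he'.ne'
        have h1 := Int.emod_lt_of_pos (((i : ℕ) : ℤ) - 1) he'
        have hi'c : (i' : ℤ) = (((i : ℕ) : ℤ) - 1) % e := Int.toNat_of_nonneg h0
        have hi'e : i' < e := by omega
        have hmod : ((i' : ℕ) : ℤ) ≡ (i : ℕ) - 1 [ZMOD e] := by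
          rw [hi'c]; exact Int.mod_modEq _ _
        have hne : (i : ℕ) ≠ i' := by
          intro hh
          rw [← hh] at hmod
          exact not_modEq_pred he _ hmod.symm
        have ho1' : Odd (tv e x i') := by rw [hi'c, odd_emod hq]; exact ho1
        have hcard := hT.card
        obtain ⟨P, hP1, hP2, hP3⟩ := Finset.exists_subsuperset_card_eq
          (s := {(i : ℕ)}) (t := ((Finset.range e).filter fun m : ℕ => Odd (tv e x m)).erase i')
          (n := T.n) (by
            rw [Finset.singleton_subset_iff, Finset.mem_erase, Finset.mem_filter, Finset.mem_range]
            exact ⟨hne, i.2, ho2⟩) (by rw [Finset.card_singleton]; omega) (by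
            rw [Finset.card_erase_of_mem (by
              rw [Finset.mem_filter, Finset.mem_range]; exact ⟨hi'e, ho1'⟩), ← od]
            omega)
        obtain ⟨y, y1, y2, y3, y4, -⟩ := exists_flat he1 x.2 hq (sum_tv he1 x)
          (hP2.trans (Finset.erase_subset _ _)) (by rw [hP3, ← hT.2, ← hcard]; push_cast; ring) h 0 0
        refine ⟨y, 1, y1, y2, y3, ?_⟩
        have e1 := y4 i i.2
        rw [if_pos (Finset.singleton_subset_iff.1 hP1)] at e1
        have e2 := y4 i' hi'e
        rw [if_neg (fun hh => (Finset.mem_erase.1 (hP2 hh)).1 rfl), if_pos ho1'] at e2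
        have e3 : dl e y ((i : ℕ) - 1) = -1 := by
          have := (dl_periodic he1 y).eq_emod (((i : ℕ) : ℤ) - 1)
          rw [this, ← hi'c, e2]; ring
        have e4 := y2 (i : ℕ)
        have e5 := y2 ((i : ℕ) - 1)
        rw [tv] at e4 e5
        rw [dl] at e1 e3
        omega
      · rw [dTerm, if_neg hd] at hD
        obtain ⟨y, y1, y2, y3, -⟩ := exists_flat' he1 x.2 (tv_quasiPeriodic he1 x) (sum_tv he1 x)
          hT.flat 0
        have e4 := y2 (i : ℕ)
        have e5 := y2 ((i : ℕ) - 1)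
        rw [tv] at e4 e5
        by_cases h0 : rch e y 0 (i : ℕ) - rch e y 0 ((i : ℕ) - 1) < h
        · exact ⟨y, 0, y1, y2, y3, h0⟩
        · exact ⟨y, 1, y1, y2, y3, by omega⟩
    obtain ⟨z, z1, z2, z3⟩ := exists_not_closed he y h hyD
    refine z3 (hc z ((Block.mem_iff hx z).2 ((sim_iff he1 x z).2 ⟨?_, fun j => ?_, ?_⟩)))
    · rw [← hya]; exact charge_eq_of_rch he1 fun k j => (z1 k j).symm
    · rw [← hyt, tv, tv, z1, z1]
    · have : sq e z = sq e y := by simp only [sq, dl, z1]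
      rw [hw, wt, z2, this, hys]
  · intro hD y hy
    obtain ⟨s1, s2, s3⟩ := (sim_iff he1 x y).1 ((Block.mem_iff hx y).1 hy)
    have hTy : Matches T y := ⟨fun m => by rw [← s2]; exact hT.1 m, by rw [← s1]; exact hT.2⟩
    refine closed_of_le he hTy (h := h) ?_ ?_
    · rw [← s3, hw, od_congr s2]
    · rw [← s2, ← s2]; exact hD

lemma dTerm_shift (n p : ℕ) (u v : ℤ) : dTerm n p (u + 2) v = dTerm n p u v := by
  have : Odd (u + 2) ↔ Odd u := by rw [Int.odd_add]; simp
  simp only [dTerm, this]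

lemma scopesMinimal_iff {e : ℕ} (he : 2 ≤ e) {x : Charged} {T : Triple e} (hT : Matches T x)
    (h : ℕ) : ScopesMinimal h T ↔ ∀ i : Fin e, tv e x (i : ℕ) = tv e x ((i : ℕ) - 1) ∨
      tv e x (i : ℕ) - tv e x ((i : ℕ) - 1) <
        2 * h + dTerm T.n T.p (tv e x ((i : ℕ) - 1)) (tv e x (i : ℕ)) := by
  have hq := tv_quasiPeriodic (by omega : 1 ≤ e) x
  have hlast : ∀ j : Fin e, (j : ℕ) + 1 = e → tv e x (-1) = tv e x (j : ℕ) + 2 := by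
    intro j hj
    have := hq (-1)
    rw [show (-1 : ℤ) + e = (j : ℕ) by omega] at this
    omega
  constructor
  · rintro ⟨h1, h2⟩ i
    by_cases hi : (i : ℕ) = 0
    · have hj := hlast ⟨e - 1, by omega⟩ (by simp only; omega)
      have := h2 i ⟨e - 1, by omega⟩ hi (by simp only; omega)
      rw [hT.1, hT.1] at this
      rw [hi] at this ⊢
      simp only [Nat.cast_zero, zero_sub] at *
      rw [hj, dTerm_shift]
      omega
    · have := h1 i ⟨(i : ℕ) - 1, by omega⟩ (by simp only; omega)
      rw [hT.1, hT.1] at this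
      simp only at this
      rw [Nat.cast_sub (by omega), Nat.cast_one] at this
      exact this
  · intro H
    refine ⟨fun i j hij => ?_, fun i j hi hj => ?_⟩
    · have := H i
      rw [show ((i : ℕ) : ℤ) - 1 = (j : ℕ) by omega] at this
      rw [hT.1, hT.1]; exact this
    · have := H i
      have hj' := hlast j hj
      rw [hi] at this
      simp only [Nat.cast_zero, zero_sub] at this
      rw [hj', dTerm_shift] at this
      rw [hT.1, hT.1, hi]
      simp only [Nat.cast_zero]
      omega

lemma normal_iff {e : ℕ} (he : 2 ≤ e) (B : Block e) :
    Normal e B ↔ ∀ i, NoAdd e i B → swapBlock he i B = B := by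
  constructor
  · intro h i hi
    by_contra hne
    exact h _ ⟨move_swapBlock he hi, hne⟩
  · rintro h C ⟨h1, h2⟩
    obtain ⟨i, hi, rfl⟩ := (scopesMove_iff he B C).1 h1
    exact h2 (h i hi)

/-- The `h`-Scopes-minimal parameters belong to the blocks without a proper Scopes move. -/
lemma normal_iff_scopesMinimal {e : ℕ} (he : 2 ≤ e) {h : ℕ} {B : Block e}
    (hB : B ∈ circBlocksH e h) {T : Triple e} (hT : IsPsi e B T) :
    Normal e B ↔ ScopesMinimal h T := by
  have he1 : 1 ≤ e := by omega
  obtain ⟨x, hx⟩ := B.nonempty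
  obtain ⟨hh, hf⟩ := (mem_circBlocksH_iff he1 hx h).1 hB
  have hm := (isPsi_iff he1 hx hf T).1 hT
  have hw := (hf.hasHooks_iff he1 hx h).1 hh
  rw [normal_iff he, scopesMinimal_iff he hm]
  refine forall_congr' fun i => ?_
  rw [noAdd_iff_le he hx hm hw i, swapBlock_eq_self_iff he i hx, ← not_lt]
  tauto

/-- A move permutes the entries of `tv` up to quasi-periodicity, so it preserves the number of odd
entries. -/
lemma circ_of_move {e : ℕ} (he : 2 ≤ e) {h : ℕ} {B C : Block e} (hB : B ∈ circBlocksH e h)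
    (hm : ScopesMove e B C) : C ∈ circBlocksH e h := by
  have he1 : 1 ≤ e := by omega
  obtain ⟨i, -, rfl⟩ := (scopesMove_iff he B C).1 hm
  obtain ⟨x, hx⟩ := B.nonempty
  obtain ⟨y, hy⟩ := exists_isSwap he i x
  have hyB : y ∈ (swapBlock he i B).1 := (mem_swapBlock he i B y).2 ⟨x, hx, hy⟩
  obtain ⟨hh, hf⟩ := (mem_circBlocksH_iff he1 hx h).1 hB
  have hod : od e (tv e y) = od e (tv e x) := by
    have : (od e (tv e y) : ℤ) = od e (tv e x) := by
      rw [od_eq_sum, od_eq_sum]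
      simp only [hy.tv_eq he]
      refine sum_comp_sig he (c := 0) (q := fun j => if Odd (tv e x j) then 1 else 0) (fun j => ?_) _
      have : Odd (tv e x (j + e)) ↔ Odd (tv e x j) := by
        rw [tv_quasiPeriodic he1, Int.odd_sub]; simp
      simp only [this, sub_zero]
    exact_mod_cast this
  have hfy : Flat e y := by
    rw [Flat, hod, hy.1]; exact hf
  refine (mem_circBlocksH_iff he1 hyB h).2 ⟨(hfy.hasHooks_iff he1 hyB h).2 ?_, hfy⟩
  rw [hy.wt_eq he, hod]; exact (hf.hasHooks_iff he1 hx h).1 hh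

lemma circ_of_red {e : ℕ} (he : 2 ≤ e) {h : ℕ} {B C : Block e} (hB : B ∈ circBlocksH e h)
    (hr : Relation.ReflTransGen (Red e) B C) : C ∈ circBlocksH e h := by
  induction hr with
  | refl => exact hB
  | tail _ h ih => exact circ_of_move he ih h.1

/-- The `h`-Scopes-minimal parameters classify the blocks in question up to Scopes equivalence. -/
lemma isReps_scopes {e : ℕ} (he : 2 ≤ e) (h : ℕ) :
    IsReps (ScopesEquiv e) (circBlocksH e h) (blocksWith e h (ScopesMinimal h)) := by
  refine ⟨fun B hB => hB.1, fun B hB => ?_⟩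
  obtain ⟨N, hN, hr⟩ := exists_normal he B
  have hNc := circ_of_red he hB hr
  obtain ⟨T, hT, -⟩ := existsUnique_isPsi (by omega) hNc
  refine ⟨N, ⟨⟨hNc, T, hT, (normal_iff_scopesMinimal he hNc hT).1 hN⟩,
    Relation.EqvGen.symm _ _ (scopesEquiv_of_red hr)⟩, ?_⟩
  rintro D ⟨⟨hD, T', hT', hmin⟩, hDB⟩
  exact ((normal_iff_scopesMinimal he hD hT').2 hmin).unique he hN
    (Relation.EqvGen.trans _ _ _ hDB (scopesEquiv_of_red hr))

/-! ### Shift equivalence -/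

lemma mem_beads_recharge (l : Bipartition) (a a' : Bicharge) (k : Fin 2) (b : ℤ) :
    b ∈ beads (l, a') k ↔ b - (a' k - a k) ∈ beads (l, a) k := by
  show b ∈ betaSet (a' k) (l k) ↔ b - (a' k - a k) ∈ betaSet (a k) (l k)
  rw [mem_betaSet_shift, mem_betaSet_shift (a := a k)]
  ring_nf

lemma rch_recharge (e : ℕ) (l : Bipartition) (a a' : Bicharge) (k : Fin 2) (j : ℤ) :
    rch e (l, a') k j = rch e (l, a) k (j - (a' k - a k)) := by
  rw [rch, rch, rc, rc]
  congr 1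
  ext b
  rw [mem_runner, mem_runner, mem_beads_recharge l a a']
  ring_nf

lemma residues_recharge {e : ℕ} (l : Bipartition) {a a' : Bicharge} {s : ℤ}
    (h : ∀ k, a' k ≡ a k + s [ZMOD e]) :
    residues e (l, a') = (residues e (l, a)).map (· + (s : ZMod e)) := by
  have hr : ∀ k n, residue e (a' k) n = residue e (a k) n + s := by
    intro k n
    have := (ZMod.intCast_eq_intCast_iff _ _ _).2 (h k)
    simp only [residue]
    push_cast at this ⊢
    rw [this]; ring
  simp only [residues, Fin.sum_univ_two, Multiset.map_add, Multiset.map_map, Function.comp_def, hr]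

lemma modEq_of_sub {e : ℕ} {a a' : Bicharge} (h : a 0 - a 1 ≡ a' 0 - a' 1 [ZMOD e]) (k : Fin 2) :
    a' k ≡ a k + (a' 0 - a 0) [ZMOD e] := by
  obtain ⟨m, hm⟩ := modEq_iff_exists.1 h
  refine modEq_iff_exists.2 ?_
  fin_cases k
  · exact ⟨0, by simp⟩
  · exact ⟨m, by simp; linarith⟩

/-- Adding the same amount modulo `e` to both charges translates all residues, so it respects the
residue multisets. -/
lemma sim_recharge {e : ℕ} {x y : Charged} (h : sim e x y) {a' : Bicharge}
    (hc : x.2 0 - x.2 1 ≡ a' 0 - a' 1 [ZMOD e]) : sim e (x.1, a') (y.1, a') := by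
  refine ⟨rfl, ?_⟩
  have h1 := modEq_of_sub hc
  have h2 := residues_recharge y.1 (h.1 ▸ h1)
  rw [residues_recharge x.1 h1]
  refine Eq.trans ?_ h2.symm
  rw [show residues e (x.1, x.2) = residues e (y.1, y.2) from h.2, h.1]

/-- Every block can be shifted to any bicharge with the right difference modulo `e`. -/
lemma exists_shiftEquiv {e : ℕ} (B : Block e) {x : Charged} (hx : x ∈ B.1) {a' : Bicharge}
    (hc : x.2 0 - x.2 1 ≡ a' 0 - a' 1 [ZMOD e]) :
    ∃ C : Block e, (x.1, a') ∈ C.1 ∧ ShiftEquiv e B C := by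
  refine ⟨blockOf e (x.1, a'), mem_blockOf _ _, x.2, a', fun y hy => ?_, fun y hy => ?_, hc, ?_⟩
  · exact ((Block.mem_iff hx y).1 hy).1.symm
  · exact ((Block.mem_iff (mem_blockOf e _) y).1 hy).1.symm
  · ext y
    rw [Block.mem_iff (mem_blockOf e _) y]
    constructor
    · intro h
      have h1 : y.2 = a' := h.1.symm
      refine ⟨(y.1, x.2), (Block.mem_iff hx _).2 ?_, Prod.ext rfl h1⟩
      exact sim_recharge h (a' := x.2) hc.symm
    · rintro ⟨z, hz, rfl⟩
      exact sim_recharge ((Block.mem_iff hx z).1 hz) hc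

lemma ShiftEquiv.exists_mem {e : ℕ} {B C : Block e} (h : ShiftEquiv e B C) {x : Charged}
    (hx : x ∈ B.1) : ∃ y ∈ C.1, y.1 = x.1 ∧ x.2 0 - x.2 1 ≡ y.2 0 - y.2 1 [ZMOD e] := by
  obtain ⟨a, a', ha, ha', hc, hC⟩ := h
  refine ⟨(x.1, a'), hC ▸ ⟨x, hx, rfl⟩, rfl, ?_⟩
  rwa [ha x hx]

lemma shiftEquiv_of_mem {e : ℕ} {B C : Block e} {x y : Charged} (hx : x ∈ B.1) (hy : y ∈ C.1)
    (h : y.1 = x.1) (hc : x.2 0 - x.2 1 ≡ y.2 0 - y.2 1 [ZMOD e]) : ShiftEquiv e B C := by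
  obtain ⟨C', hC', hs⟩ := exists_shiftEquiv B hx hc
  rwa [Block.eq_of_mem hy (show y ∈ C'.1 by rwa [← h] at hC')]

lemma ShiftEquiv.symm {e : ℕ} {B C : Block e} (h : ShiftEquiv e B C) : ShiftEquiv e C B := by
  obtain ⟨x, hx⟩ := B.nonempty
  obtain ⟨y, hy, h1, h2⟩ := h.exists_mem hx
  exact shiftEquiv_of_mem hy hx h1.symm h2.symm

lemma ShiftEquiv.refl {e : ℕ} (B : Block e) : ShiftEquiv e B B := by
  obtain ⟨x, hx⟩ := B.nonempty
  exact shiftEquiv_of_mem hx hx rfl rfl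

lemma ShiftEquiv.trans {e : ℕ} {B C D : Block e} (h : ShiftEquiv e B C) (h' : ShiftEquiv e C D) :
    ShiftEquiv e B D := by
  obtain ⟨x, hx⟩ := B.nonempty
  obtain ⟨y, hy, h1, h2⟩ := h.exists_mem hx
  obtain ⟨z, hz, h3, h4⟩ := h'.exists_mem hy
  exact shiftEquiv_of_mem hx hz (h3.trans h1) (h2.trans h4)

lemma ShiftEquiv.eq_of_charge {e : ℕ} {B C : Block e} (h : ShiftEquiv e B C) {x y : Charged}
    (hx : x ∈ B.1) (hy : y ∈ C.1) (hxy : x.2 = y.2) : B = C := by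
  obtain ⟨z, hz, h1, -⟩ := h.exists_mem hx
  have : z.2 = x.2 := ((Block.mem_iff hy z).1 hz).1.symm.trans hxy.symm
  have hzx : z = x := Prod.ext h1 this
  exact Block.eq_of_mem hx (hzx ▸ hz)

lemma ShiftEquiv.hasHooks {e : ℕ} (he : 1 ≤ e) {B C : Block e} (h : ShiftEquiv e B C) {w : ℕ}
    (hB : HasHooks e B w) : HasHooks e C w := by
  rw [hasHooks_iff_hooks he] at hB ⊢
  convert hB using 1
  ext v
  constructor
  · rintro ⟨y, hy, rfl⟩
    obtain ⟨x, hx, h1, -⟩ := h.symm.exists_mem hy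
    exact ⟨x, hx, by rw [h1]⟩
  · rintro ⟨x, hx, rfl⟩
    obtain ⟨y, hy, h1, -⟩ := h.exists_mem hx
    exact ⟨y, hy, by rw [h1]⟩

lemma sig_add_of_modEq {e : ℕ} {i i' c : ℤ} (h : i' ≡ i + c [ZMOD e]) (b : ℤ) :
    sig e i' (b + c) = sig e i b + c := by
  have h1 : b + c ≡ i' [ZMOD e] ↔ b ≡ i [ZMOD e] :=
    ⟨fun H => (modEq_add_iff c).1 (H.trans h), fun H => ((modEq_add_iff c).2 H).trans h.symm⟩
  have h2 : b + c ≡ i' - 1 [ZMOD e] ↔ b ≡ i - 1 [ZMOD e] := by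
    have h3 : i' - 1 ≡ i - 1 + c [ZMOD e] := by
      have := modEq_pred_iff.2 h
      rwa [show i + c - 1 = i - 1 + c by ring] at this
    exact ⟨fun H => (modEq_add_iff c).1 (H.trans h3),
      fun H => ((modEq_add_iff c).2 H).trans h3.symm⟩
  simp only [sig, h1, h2]
  split_ifs <;> ring

/-- Shifting the bicharge by `c` modulo `e` turns addable `i`-nodes into addable `i + c`-nodes. -/
lemma hasAddable_recharge {e : ℕ} (l : Bipartition) {a a' : Bicharge} {i i' : Fin e}
    (h : ∀ k, ((i' : ℕ) : ℤ) ≡ (i : ℕ) + (a' k - a k) [ZMOD e]) :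
    HasAddable e i' (l, a') ↔ HasAddable e i (l, a) := by
  rw [hasAddable_iff, hasAddable_iff]
  refine exists_congr fun k => ?_
  constructor
  · rintro ⟨b, h1, h2, h3⟩
    rw [mem_beads_recharge l a a'] at h2 h3
    refine ⟨b - (a' k - a k), ?_, by convert h2 using 1; ring, h3⟩
    rw [← modEq_add_iff (a' k - a k), sub_add_cancel]
    exact h1.trans (h k)
  · rintro ⟨b, h1, h2, h3⟩
    refine ⟨b + (a' k - a k), ((modEq_add_iff _).2 h1).trans (h k).symm, ?_, ?_⟩
    · rw [mem_beads_recharge l a a']; convert h2 using 1; ring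
    · rwa [mem_beads_recharge l a a', add_sub_cancel_right]

lemma isSwap_recharge {e : ℕ} (he : 2 ≤ e) {l l' : Bipartition} {a a' : Bicharge} {i i' : Fin e}
    (h : ∀ k, ((i' : ℕ) : ℤ) ≡ (i : ℕ) + (a' k - a k) [ZMOD e])
    (hs : IsSwap e i (l, a) (l', a)) : IsSwap e i' (l, a') (l', a') := by
  rw [isSwap_iff he] at hs ⊢
  intro k
  ext b
  have := Set.ext_iff.1 (hs k) (b - (a' k - a k))
  rw [mem_swapBeads he] at this ⊢
  rw [mem_beads_recharge l' a a', this, mem_beads_recharge l a a']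
  have h1 := sig_add_of_modEq (h k) (b - (a' k - a k))
  rw [sub_add_cancel] at h1
  rw [h1, add_sub_cancel_right]

/-- Shifts carry Scopes moves to Scopes moves. -/
lemma ShiftEquiv.scopesMove {e : ℕ} (he : 2 ≤ e) {B C C' : Block e} (h : ShiftEquiv e B C)
    (hm : ScopesMove e C C') : ∃ B', ScopesMove e B B' ∧ ShiftEquiv e B' C' := by
  obtain ⟨i, hi, rfl⟩ := (scopesMove_iff he _ _).1 hm
  obtain ⟨⟨l, a⟩, hx⟩ := C.nonempty
  obtain ⟨⟨l1, a'⟩, hy, h1, h2⟩ := h.symm.exists_mem hx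
  obtain rfl : l1 = l := h1
  have h2 : a 0 - a 1 ≡ a' 0 - a' 1 [ZMOD e] := h2
  have he' : (0 : ℤ) < e := by exact_mod_cast (by omega : 0 < e)
  obtain ⟨i', hi'⟩ : ∃ i' : Fin e, ((i' : ℕ) : ℤ) ≡ (i : ℕ) + (a' 0 - a 0) [ZMOD e] := by
    set r := ((i : ℕ) + (a' 0 - a 0) : ℤ) % e with hr
    have h0 : 0 ≤ r := Int.emod_nonneg _ he'.ne'
    have h1 : r < e := Int.emod_lt_of_pos _ he'
    refine ⟨⟨r.toNat, by omega⟩, ?_⟩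
    simp only [Int.toNat_of_nonneg h0]
    exact Int.mod_modEq _ _
  have hk : ∀ k, ((i' : ℕ) : ℤ) ≡ (i : ℕ) + (a' k - a k) [ZMOD e] := by
    intro k
    refine hi'.trans ?_
    have := (modEq_of_sub h2 k).symm.sub_right (a k)
    rw [add_sub_cancel_left] at this
    exact this.add_left _
  have hna : NoAdd e i' B := by
    rintro ⟨m, c⟩ hy' hadd
    obtain ⟨⟨m', c'⟩, hz, h3, -⟩ := h.exists_mem hy'
    obtain rfl : m' = m := h3
    obtain rfl : a' = c := ((Block.mem_iff hy _).1 hy').1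
    obtain rfl : a = c' := ((Block.mem_iff hx _).1 hz).1
    exact hi _ hz ((hasAddable_recharge _ hk).1 hadd)
  refine ⟨swapBlock he i' B, move_swapBlock he hna, ?_⟩
  obtain ⟨⟨l', c⟩, hz⟩ := exists_isSwap he i (l1, a)
  obtain rfl : c = a := hz.1
  refine ShiftEquiv.symm (shiftEquiv_of_mem ((mem_swapBlock he i C _).2 ⟨_, hx, hz⟩)
    ((mem_swapBlock he i' B _).2 ⟨_, hy, isSwap_recharge he hk hz⟩) rfl h2)

lemma ScopesMove.charge_eq {e : ℕ} {B C : Block e} (h : ScopesMove e B C) {x y : Charged}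
    (hx : x ∈ B.1) (hy : y ∈ C.1) : y.2 = x.2 := by
  obtain ⟨i, -, hC⟩ := h
  rw [hC] at hy
  obtain ⟨z, hz, hs⟩ := hy
  exact hs.1.trans ((Block.mem_iff hx z).1 hz).1.symm

lemma ShiftEquiv.scopesMove' {e : ℕ} (he : 2 ≤ e) {B C C' : Block e} (h : ShiftEquiv e B C)
    (hm : ScopesMove e C' C) : ∃ B', ScopesMove e B' B ∧ ShiftEquiv e B' C' := by
  obtain ⟨x, hx⟩ := B.nonempty
  obtain ⟨y, hy, h1, h2⟩ := h.exists_mem hx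
  obtain ⟨y', hy'⟩ := C'.nonempty
  have hc := hm.charge_eq hy' hy
  obtain ⟨B', hB', hs⟩ := exists_shiftEquiv C' hy' (a' := x.2) (by rw [← hc]; exact h2.symm)
  obtain ⟨B'', hm', hs'⟩ := hs.symm.scopesMove he hm
  obtain ⟨z, hz⟩ := B''.nonempty
  have hzx : z.2 = x.2 := (hm'.charge_eq hB' hz :)
  have := (hs'.trans h.symm).eq_of_charge hz hx hzx
  exact ⟨B', this ▸ hm', hs.symm⟩

lemma ShiftEquiv.scopesEquiv {e : ℕ} (he : 2 ≤ e) {B C C' : Block e} (h : ShiftEquiv e B C)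
    (hm : ScopesEquiv e C C') : ∃ B', ScopesEquiv e B B' ∧ ShiftEquiv e B' C' := by
  -- the symmetric form of the statement is what survives the induction
  suffices H : (∀ B, ShiftEquiv e B C → ∃ B', ScopesEquiv e B B' ∧ ShiftEquiv e B' C') ∧
      ∀ B, ShiftEquiv e B C' → ∃ B', ScopesEquiv e B B' ∧ ShiftEquiv e B' C from H.1 B h
  clear h
  induction hm with
  | rel C C' hm =>
    refine ⟨fun B h => ?_, fun B h => ?_⟩
    · obtain ⟨B', h1, h2⟩ := h.scopesMove he hm
      exact ⟨B', .rel _ _ h1, h2⟩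
    · obtain ⟨B', h1, h2⟩ := h.scopesMove' he hm
      exact ⟨B', .symm _ _ (.rel _ _ h1), h2⟩
  | refl C => exact ⟨fun B h => ⟨B, .refl _, h⟩, fun B h => ⟨B, .refl _, h⟩⟩
  | symm C C' _ ih => exact ih.symm
  | trans C C' C'' _ _ ih ih' =>
    refine ⟨fun B h => ?_, fun B h => ?_⟩
    · obtain ⟨B', h1, h2⟩ := ih.1 B h
      obtain ⟨B'', h3, h4⟩ := ih'.1 B' h2
      exact ⟨B'', .trans _ _ _ h1 h3, h4⟩
    · obtain ⟨B', h1, h2⟩ := ih'.2 B h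
      obtain ⟨B'', h3, h4⟩ := ih.2 B' h2
      exact ⟨B'', .trans _ _ _ h1 h3, h4⟩

/-- A chain of Scopes and shift equivalences can be sorted: Scopes moves first, then one shift. -/
lemma SEquiv.exists_scopes_shift {e : ℕ} (he : 2 ≤ e) {B B' : Block e} (h : SEquiv e B B') :
    ∃ C, ScopesEquiv e B C ∧ ShiftEquiv e C B' := by
  induction h with
  | rel B B' h =>
    rcases h with h | h
    · exact ⟨B', h, .refl _⟩
    · exact ⟨B, .refl _, h⟩
  | refl B => exact ⟨B, .refl _, .refl _⟩
  | symm B B' _ ih =>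
    obtain ⟨C, h1, h2⟩ := ih
    exact h2.symm.scopesEquiv he (.symm _ _ h1)
  | trans B C D _ _ ih ih' =>
    obtain ⟨X, h1, h2⟩ := ih
    obtain ⟨Y, h3, h4⟩ := ih'
    obtain ⟨Z, h5, h6⟩ := h2.scopesEquiv he h3
    exact ⟨Z, .trans _ _ _ h1 h5, h6.trans h4⟩

lemma Normal.of_shiftEquiv {e : ℕ} (he : 2 ≤ e) {B C : Block e} (hB : Normal e B)
    (h : ShiftEquiv e B C) : Normal e C := by
  rintro C' ⟨hm, hne⟩
  obtain ⟨B', h1, h2⟩ := h.scopesMove he hm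
  refine hB B' ⟨h1, ?_⟩
  rintro rfl
  obtain ⟨x, hx⟩ := C.nonempty
  obtain ⟨y, hy⟩ := C'.nonempty
  exact hne ((h2.symm.trans h).eq_of_charge hy hx (hm.charge_eq hx hy))

/-- Normal blocks in the same `≡_S`-class are shifts of each other. -/
lemma Normal.shiftEquiv {e : ℕ} (he : 2 ≤ e) {B C : Block e} (hB : Normal e B) (hC : Normal e C)
    (h : SEquiv e B C) : ShiftEquiv e B C := by
  obtain ⟨D, h1, h2⟩ := h.exists_scopes_shift he
  rwa [hB.unique he (hC.of_shiftEquiv he h2.symm) h1]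

/-- The numerical effect of a shift: `s` is the change of the first charge and `s + e m` that of the
second. -/
lemma tv_recharge {e : ℕ} (he : 1 ≤ e) (l : Bipartition) {a a' : Bicharge} {s m : ℤ}
    (h0 : a' 0 = a 0 + s) (h1 : a' 1 = a 1 + s + e * m) (j : ℤ) :
    tv e (l, a') j = tv e (l, a) (j - s) + m := by
  rw [tv, tv, rch_recharge e l a a', rch_recharge e l a a', h0, h1,
    show j - (a 0 + s - a 0) = j - s by ring,
    show j - (a 1 + s + e * m - a 1) = (j - s) + e * (-m) by ring,
    (rch_quasiPeriodic he (l, a) 1).add_mul]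
  ring

/-! ### Normalising the bicharge difference -/

lemma od_comp_sub {e : ℕ} {t : ℤ → ℤ} (ht : QuasiPeriodic e 2 t) (s : ℤ) :
    od e (fun j => t (j - s)) = od e t := by
  have h : QuasiPeriodic e 0 fun j => if Odd (t j) then (1 : ℤ) else 0 := by
    intro j
    have : Odd (t j - 2) ↔ Odd (t j) := by
      rw [Int.odd_sub]; simp
    simp only [ht j, this, sub_zero]
  have h1 := sum_window h (-s)
  zify
  rw [od_eq_sum, od_eq_sum]
  simpa [sub_eq_neg_add] using h1

lemma od_add_even {e : ℕ} {t : ℤ → ℤ} {m : ℤ} (hm : Even m) :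
    od e (fun j => t j + m) = od e t := by
  simp only [od, Int.odd_add, hm, iff_true]

lemma od_add_odd {e : ℕ} {t : ℤ → ℤ} {m : ℤ} (hm : Odd m) :
    od e (fun j => t j + m) + od e t = e := by
  have h : ∀ i : ℕ, Odd (t i + m) ↔ ¬ Odd (t i) := by
    intro i
    rw [Int.odd_add, ← Int.not_odd_iff_even]
    simp [hm]
  simp only [od, h]
  rw [add_comm, Finset.card_filter_add_card_filter_not, Finset.card_range]

lemma od_le (e : ℕ) (t : ℤ → ℤ) : od e t ≤ e := by
  have := Finset.card_filter_le (Finset.range e) fun i : ℕ => Odd (t i)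
  rwa [Finset.card_range] at this

/-- The intervals `(-o, o]` and `(o, 2e - o]` tile the integers modulo `2e`, so some translate of
`d` satisfies the normalisation; `o'` stands for the number of odd entries after the shift. -/
lemma exists_normal_translate {e : ℕ} (he : 1 ≤ e) {o d : ℤ} (h1 : o ≤ e) :
    ∃ m o' : ℤ, (Even m ∧ o' = o ∨ Odd m ∧ o' = e - o) ∧ |d - e * m| ≤ o' ∧
      (-o' < d - e * m ∨ o' = 0) ∧ ¬ (d - e * m = e ∧ o' = e) := by
  have he' : (0 : ℤ) < 2 * e := by exact_mod_cast (by omega : 0 < 2 * e)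
  obtain ⟨r, q, hr0, hr1, hd⟩ : ∃ r q : ℤ, o - 2 * e < r ∧ r ≤ o ∧ d = r + e * (2 * q) := by
    have ha := Int.emod_nonneg (o - d) he'.ne'
    have hb := Int.emod_lt_of_pos (o - d) he'
    have hc := Int.emod_add_mul_ediv (o - d) (2 * e)
    exact ⟨o - (o - d) % (2 * e), -((o - d) / (2 * e)), by linarith, by linarith, by linarith⟩
  have e0 : d - e * (2 * q) = r := by linarith
  have e1 : d - e * (2 * q + 1) = r - e := by linarith
  have e2 : d - e * (2 * q - 1) = r + e := by linarith
  have hev : Even (2 * q) := even_two_mul q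
  by_cases c1 : o = e ∧ r = e
  · refine ⟨2 * q + 1, e - o, .inr ⟨hev.add_one, rfl⟩, ?_, ?_, ?_⟩ <;> rw [e1]
    · rw [abs_le]; omega
    · omega
    · omega
  by_cases c2 : o = 0 ∧ r = 0
  · refine ⟨2 * q, o, .inl ⟨hev, rfl⟩, ?_, ?_, ?_⟩ <;> rw [e0]
    · rw [abs_le]; omega
    · omega
    · omega
  by_cases c3 : -o < r
  · refine ⟨2 * q, o, .inl ⟨hev, rfl⟩, ?_, ?_, ?_⟩ <;> rw [e0]
    · rw [abs_le]; omega
    · omega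
    · omega
  · refine ⟨2 * q - 1, e - o, .inr ⟨hev.sub_odd odd_one, rfl⟩, ?_, ?_, ?_⟩ <;> rw [e2]
    · rw [abs_le]; omega
    · omega
    · omega

/-- Two normalised bicharge differences `n - p` and `n' - p'` that differ by `e m` agree. -/
lemma normal_translate_unique {e n p n' p' : ℕ} {m : ℤ} (h : (n : ℤ) - p - (n' - p') = e * m)
    (hle : n + p ≤ e) (hle' : n' + p' ≤ e) (hodd : Odd m → n + p + (n' + p') = e)
    (hn : (0 < p → 0 < n) ∧ (p = 0 → n < e)) (hn' : (0 < p' → 0 < n') ∧ (p' = 0 → n' < e)) :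
    m = 0 := by
  have he : (0 : ℤ) ≤ e := Int.natCast_nonneg e
  rcases lt_trichotomy m 0 with hm | hm | hm
  · rcases eq_or_lt_of_le (Int.le_sub_one_of_lt hm) with hm' | hm'
    · obtain rfl : m = -1 := by omega
      have := hodd (by decide)
      omega
    · have : (e : ℤ) * m ≤ e * (-2) := mul_le_mul_of_nonneg_left (by omega) he
      omega
  · exact hm
  · rcases eq_or_lt_of_le (Int.add_one_le_of_lt hm) with hm' | hm'
    · obtain rfl : m = 1 := by omega
      have := hodd (by decide)
      omega
    · have : (e : ℤ) * 2 ≤ e * m := mul_le_mul_of_nonneg_left (by omega) he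
      omega

lemma ShiftEquiv.exists_data {e : ℕ} {B C : Block e} (h : ShiftEquiv e B C) {x y : Charged}
    (hx : x ∈ B.1) (hy : y ∈ C.1) : ∃ s m : ℤ, y.2 0 = x.2 0 + s ∧ y.2 1 = x.2 1 + s + e * m := by
  obtain ⟨z, hz, -, h2⟩ := h.exists_mem hx
  rw [← ((Block.mem_iff hy z).1 hz).1] at h2
  obtain ⟨m, hm⟩ := modEq_iff_exists.1 h2
  exact ⟨y.2 0 - x.2 0, m, by ring, by linarith⟩

lemma ShiftEquiv.tv_eq {e : ℕ} (he : 1 ≤ e) {B C : Block e} (h : ShiftEquiv e B C) {x y : Charged}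
    (hx : x ∈ B.1) (hy : y ∈ C.1) {s m : ℤ} (h0 : y.2 0 = x.2 0 + s)
    (h1 : y.2 1 = x.2 1 + s + e * m) (j : ℤ) : tv e y j = tv e x (j - s) + m := by
  obtain ⟨z, hz, h3, -⟩ := h.exists_mem hx
  have hs := (Block.mem_iff hy z).1 hz
  have hzy : z = (x.1, y.2) := Prod.ext h3 hs.1.symm
  rw [((sim_iff he y z).1 hs).2.1 j, hzy]
  exact tv_recharge he x.1 h0 h1 j

/-- A normalised bicharge difference is rigid under shifts. -/
lemma ShiftEquiv.charge_diff_eq {e : ℕ} (he : 1 ≤ e) {B C : Block e} (h : ShiftEquiv e B C)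
    {x y : Charged} (hx : x ∈ B.1) (hy : y ∈ C.1) {T T' : Triple e} (hT : Matches T x)
    (hT' : Matches T' y) (hn : NormalCharge T) (hn' : NormalCharge T') :
    ∃ s : ℤ, ∀ k, y.2 k = x.2 k + s := by
  obtain ⟨s, m, h0, h1⟩ := h.exists_data hx hy
  have ht := h.tv_eq he hx hy h0 h1
  have hm : m = 0 := by
    have hd := hT.2
    have hd' := hT'.2
    refine normal_translate_unique (n := T.n) (p := T.p) (n' := T'.n) (p' := T'.p) (by linarith)
      (hT.card ▸ od_le _ _) (hT'.card ▸ od_le _ _) (fun hm => ?_) hn hn'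
    rw [hT.card, hT'.card, od_congr ht, ← od_comp_sub (tv_quasiPeriodic he x) s, add_comm]
    exact od_add_odd hm
  subst hm
  refine ⟨s, fun k => ?_⟩
  fin_cases k
  · exact h0
  · simpa using h1

/-- Every block, whatever its core block, has a shift with normalised bicharge difference. -/
lemma exists_shift_normalCharge {e : ℕ} (he : 1 ≤ e) (B : Block e) :
    ∃ C, ShiftEquiv e B C ∧ ∃ x ∈ C.1, ∃ T : Triple e, Matches T x ∧ NormalCharge T := by
  obtain ⟨x, hx⟩ := B.nonempty
  obtain ⟨m, o', ho, hle, hlt, hne⟩ := exists_normal_translate he (o := od e (tv e x))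
    (d := x.2 0 - x.2 1) (by exact_mod_cast od_le _ _)
  obtain ⟨C, hC, hs⟩ := exists_shiftEquiv B hx (a' := ![x.2 0, x.2 1 + e * m])
    (modEq_iff_exists.2 ⟨m, by simp; ring⟩)
  set y : Charged := (x.1, ![x.2 0, x.2 1 + e * m]) with hy
  have hd : y.2 0 - y.2 1 = x.2 0 - x.2 1 - e * m := by simp [hy]; ring
  have ht := hs.tv_eq he hx hC (s := 0) (m := m) (by simp [hy]) (by simp [hy])
  have hod : (od e (tv e y) : ℤ) = o' := by
    rw [od_congr ht]
    simp only [sub_zero]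
    rcases ho with ⟨hm, rfl⟩ | ⟨hm, rfl⟩
    · rw [od_add_even hm]
    · have : ((od e (fun j => tv e x j + m) + od e (tv e x) : ℕ) : ℤ) = e :=
        congrArg _ (od_add_odd hm)
      push_cast at this
      linarith
  have hf : Flat e y := by
    rw [Flat, hd, hod]; exact hle
  obtain ⟨T, hT⟩ := hf.exists_matches he
  refine ⟨C, hs, y, hC, T, hT, ?_, ?_⟩
  all_goals
    have h1 := hT.card
    have h2 := hT.2
    have h3 := od_le e (tv e y)
    rw [hd] at h2
    intro hp
    omega

/-! ### Normalising the rotation -/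

/-- The last condition in Type 1 minimality, for the minimum over the indices in `I`. -/
def Rotation1 (e : ℕ) (I : Finset ℕ) (t : ℤ → ℤ) (d : ℤ) : Prop :=
  (∃ m : ℤ, (m = 1 ∨ m = 2) ∧ IsLeast {u | ∃ i ∈ I, t (i : ℕ) = u} m) ∧
    2 * (e : ℤ) ∣ ∑ i ∈ Finset.range e, t i + d

/-- The last condition in Type 2 minimality. -/
def Rotation2 (e : ℕ) (t : ℤ → ℤ) : Prop :=
  (t 0 = 1 ∨ t 0 = 2) ∧ ∀ i : ℕ, 1 ≤ i → i < e → 1 ≤ t i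

/-- Rotating by `1` adds `2` to the sum, which determines the rotation modulo `e`; rotating by `e`
adds `2` to all entries, and the minimum decides the rest. -/
lemma existsUnique_rotation1 {e : ℕ} (he : 1 ≤ e) {I : Finset ℕ} (hI : I.Nonempty) {t : ℤ → ℤ}
    (ht : QuasiPeriodic e 2 t) {d : ℤ} (hd : 2 ∣ ∑ i ∈ Finset.range e, t i + d) :
    ∃! s : ℤ, Rotation1 e I (fun j => t (j - s)) d := by
  have he' : (0 : ℤ) < e := by exact_mod_cast he
  have hsum : ∀ s : ℤ, ∑ i ∈ Finset.range e, t (i - s) = ∑ i ∈ Finset.range e, t i + 2 * s := by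
    intro s
    have := sum_window ht (-s)
    simp only [sub_eq_neg_add]
    rw [this]; ring
  obtain ⟨c, hc⟩ := hd
  have hdvd : ∀ s : ℤ, 2 * (e : ℤ) ∣ ∑ i ∈ Finset.range e, t (i - s) + d ↔ (e : ℤ) ∣ c + s := by
    intro s
    rw [hsum, show ∑ i ∈ Finset.range e, t i + 2 * s + d = 2 * (c + s) by linarith]
    exact mul_dvd_mul_iff_left two_ne_zero
  obtain ⟨i₀, hi₀, hmin⟩ := I.exists_min_image (fun i : ℕ => t (i + c)) hI
  -- the minimum after rotating by `e * k - c`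
  have hleast : ∀ k : ℤ, IsLeast {u | ∃ i ∈ I, t ((i : ℕ) - (e * k - c)) = u}
      (t (i₀ + c) + 2 * k) := by
    intro k
    have hk : ∀ i : ℕ, t (i - (e * k - c)) = t (i + c) + 2 * k := by
      intro i
      rw [show (i : ℤ) - (e * k - c) = (i + c) + e * (-k) by ring, ht.add_mul]; ring
    refine ⟨⟨i₀, hi₀, hk _⟩, ?_⟩
    rintro _ ⟨i, hi, rfl⟩
    rw [hk]
    linarith [hmin i hi]
  refine ⟨e * ((2 - t (i₀ + c)) / 2) - c, ⟨⟨_, ?_, hleast _⟩, ?_⟩, ?_⟩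
  · omega
  · rw [hdvd]; exact ⟨(2 - t (i₀ + c)) / 2, by ring⟩
  · rintro s ⟨⟨m, hm, hm'⟩, hs⟩
    obtain ⟨k, hk⟩ := (hdvd s).1 hs
    obtain rfl : s = e * k - c := by linarith
    have := hm'.unique (hleast k)
    rw [show (2 - t (i₀ + c)) / 2 = k by omega]

/-- Type 2 picks the window of length `e` that ends just before the first nonpositive entry. -/
lemma existsUnique_rotation2 {e : ℕ} (he : 1 ≤ e) {t : ℤ → ℤ} (ht : QuasiPeriodic e 2 t) :
    ∃! s : ℤ, Rotation2 e fun j => t (j - s) := by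
  have he' : (0 : ℤ) < e := by exact_mod_cast he
  -- by quasi-periodicity the condition on one window extends to all earlier entries
  have key : ∀ s : ℤ, Rotation2 e (fun j => t (j - s)) ↔
      t (e - s) ≤ 0 ∧ ∀ j : ℤ, j < e - s → 1 ≤ t j := by
    intro s
    have h0 : t (e - s) = t (0 - s) - 2 := by
      rw [← ht (0 - s)]; ring_nf
    constructor
    · rintro ⟨h1, h2⟩
      have h1 : t (0 - s) = 1 ∨ t (0 - s) = 2 := h1
      refine ⟨by omega, fun j hj => ?_⟩
      have ha := Int.emod_nonneg (j + s) he'.ne'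
      have hb := Int.emod_lt_of_pos (j + s) he'
      have hc := Int.emod_add_mul_ediv (j + s) e
      have hq : (j + s) / e ≤ 0 := by
        by_contra hq
        have : (e : ℤ) * 1 ≤ e * ((j + s) / e) :=
          mul_le_mul_of_nonneg_left (by omega) he'.le
        linarith
      have hw : 1 ≤ t ((j + s) % e - s) := by
        obtain ⟨n, hn⟩ := Int.eq_ofNat_of_zero_le ha
        rw [hn]
        rcases Nat.eq_zero_or_pos n with rfl | hpos
        · have : t ((0 : ℕ) - s) = t (0 - s) := by simp
          omega
        · exact h2 n hpos (by omega)
      rw [show j = (j + s) % e - s + e * ((j + s) / e) by linarith, ht.add_mul]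
      omega
    · rintro ⟨h1, h2⟩
      refine ⟨?_, fun i _ hi => h2 _ (by omega)⟩
      have := h2 (0 - s) (by omega)
      show t (0 - s) = 1 ∨ t (0 - s) = 2
      omega
  obtain ⟨i₀, -, hmin⟩ := (Finset.range e).exists_min_image (fun i : ℕ => t i)
    ⟨0, Finset.mem_range.2 he⟩
  obtain ⟨u, hu, hu'⟩ := Int.exists_least_of_bdd (P := fun j => t j ≤ 0)
    ⟨e * (t i₀ / 2), fun j hj => by
      have ha := Int.emod_nonneg j he'.ne'
      have hb := Int.emod_lt_of_pos j he'
      have h1 := hmin (j % e).toNat (Finset.mem_range.2 (by omega))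
      rw [Int.toNat_of_nonneg ha] at h1
      rw [ht.eq_emod] at hj
      have h2 : (e : ℤ) * (t i₀ / 2) ≤ e * (j / e) :=
        mul_le_mul_of_nonneg_left (by omega) he'.le
      linarith [Int.emod_add_mul_ediv j e]⟩
    ⟨e * |t 0|, by
      have := ht.add_mul 0 |t 0|
      rw [zero_add] at this
      rw [this]
      have := le_abs_self (t 0)
      have := abs_nonneg (t 0)
      linarith⟩
  refine ⟨e - u, (key _).2 ⟨by rwa [sub_sub_cancel], fun j hj => ?_⟩, fun s hs => ?_⟩
  · by_contra hj'
    have := hu' j (by omega)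
    omega
  · obtain ⟨h1, h2⟩ := (key s).1 hs
    have := hu' _ h1
    rcases lt_or_ge u (e - s) with hlt | hge
    · have := h2 u hlt
      omega
    · omega

/-! ### Representatives of the classes -/

lemma HasHooks.swapBlock {e : ℕ} (he : 2 ≤ e) {B : Block e} {h : ℕ} (hB : HasHooks e B h)
    (i : Fin e) : HasHooks e (swapBlock he i B) h := by
  rw [hasHooks_iff_hooks (by omega)] at hB ⊢
  convert hB using 1
  ext v
  constructor
  · rintro ⟨y, hy, rfl⟩
    obtain ⟨x, hx, hs⟩ := (mem_swapBlock he i B y).1 hy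
    exact ⟨x, hx, (hs.hooks_eq he).symm⟩
  · rintro ⟨x, hx, rfl⟩
    obtain ⟨y, hs⟩ := exists_isSwap he i x
    exact ⟨y, (mem_swapBlock he i B y).2 ⟨x, hx, hs⟩, hs.hooks_eq he⟩

lemma HasHooks.of_red {e : ℕ} (he : 2 ≤ e) {B C : Block e} {h : ℕ} (hB : HasHooks e B h)
    (hr : Relation.ReflTransGen (Red e) B C) : HasHooks e C h := by
  induction hr with
  | refl => exact hB
  | tail _ hm ih =>
    obtain ⟨i, -, rfl⟩ := (scopesMove_iff he _ _).1 hm.1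
    exact ih.swapBlock he i

/-- Every block is `≡_S`-equivalent to one that is reduced for Scopes moves and has a normalised
bicharge difference. -/
lemma exists_normal_normalCharge {e : ℕ} (he : 2 ≤ e) {h : ℕ} {B : Block e}
    (hB : B ∈ blocksH e h) : ∃ C ∈ circBlocksH e h, SEquiv e B C ∧ Normal e C ∧
      ∃ x ∈ C.1, ∃ T : Triple e, Matches T x ∧ NormalCharge T := by
  obtain ⟨N, hN, hr⟩ := exists_normal he B
  obtain ⟨C, hs, x, hx, T, hT, hn⟩ := exists_shift_normalCharge (by omega) N
  refine ⟨C, (mem_circBlocksH_iff (by omega) hx h).2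
    ⟨hs.hasHooks (by omega) (HasHooks.of_red he hB hr), hT.flat⟩,
    .trans _ _ _ (.rel _ _ (.inl (scopesEquiv_of_red hr))) (.rel _ _ (.inr hs)),
    hN.of_shiftEquiv he hs, x, hx, T, hT, hn⟩

/-- A rule `R` that selects one rotation of the sequence `t` selects, among the Scopes-minimal
triples with normalised bicharge difference, representatives of the `≡_S`-classes. -/
theorem isReps_of_rotation {e : ℕ} (he : 2 ≤ e) (h : ℕ) {P : Triple e → Prop}
    {R : (ℤ → ℤ) → ℤ → Prop}
    (hP : ∀ T x, Matches T x →
      (P T ↔ ScopesMinimal h T ∧ NormalCharge T ∧ R (tv e x) (x.2 0 - x.2 1)))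
    (hR : ∀ (t : ℤ → ℤ) (d : ℤ), QuasiPeriodic e 2 t → 2 ∣ ∑ i ∈ Finset.range e, t i + d →
      ∃! s : ℤ, R (fun j => t (j - s)) d) :
    IsReps (SEquiv e) (blocksH e h) (blocksWith e h P) := by
  have he1 : 1 ≤ e := by omega
  have hpar : ∀ x : Charged, 2 ∣ ∑ i ∈ Finset.range e, tv e x i + (x.2 0 - x.2 1) := fun x =>
    ⟨x.2 0 - e, by rw [sum_tv he1]; ring⟩
  refine ⟨fun B hB => hB.1.1, fun B hB => ?_⟩
  obtain ⟨C, hC, hBC, hCn, x, hx, T, hT, hn⟩ := exists_normal_normalCharge he hB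
  obtain ⟨s, hs, -⟩ := hR _ _ (tv_quasiPeriodic he1 x) (hpar x)
  obtain ⟨D, hD, hCD⟩ := exists_shiftEquiv C hx (a' := fun k => x.2 k + s)
    (by rw [add_sub_add_right_eq_sub])
  set y : Charged := (x.1, fun k => x.2 k + s) with hy
  have hyd : y.2 0 - y.2 1 = x.2 0 - x.2 1 := add_sub_add_right_eq_sub _ _ _
  have htv : tv e y = fun j => tv e x (j - s) := by
    ext j
    have := hCD.tv_eq he1 hx hD (s := s) (m := 0) rfl (by simp [hy]) j
    rwa [add_zero] at this
  have hod : od e (tv e y) = od e (tv e x) := by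
    rw [htv]; exact od_comp_sub (tv_quasiPeriodic he1 x) s
  have hDf : Flat e y := by
    rw [Flat, hyd, hod]; exact hT.flat
  obtain ⟨T', hT'⟩ := hDf.exists_matches he1
  have hDc : D ∈ circBlocksH e h :=
    (mem_circBlocksH_iff he1 hD h).2 ⟨hCD.hasHooks he1 hC.1, hDf⟩
  have hn' : NormalCharge T' := by
    have h1 := hT.card
    have h2 := hT'.card
    have h3 := hT.2
    have h4 := hT'.2
    rw [NormalCharge, show T'.n = T.n by omega, show T'.p = T.p by omega]
    exact hn
  have hDp : IsPsi e D T' := (isPsi_iff he1 hD hDf T').2 hT'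
  have hDn : Normal e D := hCn.of_shiftEquiv he hCD
  have hBD : SEquiv e B D := .trans _ _ _ hBC (.rel _ _ (.inr hCD))
  have hPT' : P T' := (hP T' y hT').2
    ⟨(normal_iff_scopesMinimal he hDc hDp).1 hDn, hn', by rw [hyd, htv]; exact hs⟩
  refine ⟨D, ⟨⟨hDc, T', hDp, hPT'⟩, .symm _ _ hBD⟩, ?_⟩
  rintro E ⟨⟨hEc, T'', hEp, hPE⟩, hEB⟩
  obtain ⟨z, hz⟩ := E.nonempty
  have hEf := ((mem_circBlocksH_iff he1 hz h).1 hEc).2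
  have hT'' := (isPsi_iff he1 hz hEf T'').1 hEp
  obtain ⟨hE1, hE2, hE3⟩ := (hP T'' z hT'').1 hPE
  have hEn : Normal e E := (normal_iff_scopesMinimal he hEc hEp).2 hE1
  -- two representatives are shifts of each other, in fact rotations by some `r`
  have hDE : ShiftEquiv e D E := hDn.shiftEquiv he hEn (.symm _ _ (.trans _ _ _ hEB hBD))
  obtain ⟨r, hr⟩ := hDE.charge_diff_eq he1 hD hz hT' hT'' hn' hE2
  have htz : tv e z = fun j => tv e y (j - r) := by
    ext j
    have := hDE.tv_eq he1 hD hz (s := r) (m := 0) (hr 0) (by rw [hr 1]; ring) j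
    rwa [add_zero] at this
  have hr0 : r = 0 := by
    refine (hR _ (y.2 0 - y.2 1) (tv_quasiPeriodic he1 y) (hpar y)).unique ?_ ?_
    · rw [htz, hr, hr, add_sub_add_right_eq_sub] at hE3
      exact hE3
    · simp only [sub_zero]
      exact ((hP T' y hT').1 hPT').2.2
  refine (hDE.eq_of_charge hD hz ?_).symm
  ext k
  rw [hr, hr0, add_zero]

lemma sum_matches {e : ℕ} {T : Triple e} {x : Charged} (hT : Matches T x) :
    ∑ i, T.t i = ∑ i ∈ Finset.range e, tv e x i := by
  rw [← Fin.sum_univ_eq_sum_range (fun i : ℕ => tv e x i) e]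
  exact Finset.sum_congr rfl fun i _ => hT.1 i

lemma modEq_charge_iff {e : ℕ} {T : Triple e} {x : Charged} (hT : Matches T x) :
    (∑ i, T.t i) ≡ (T.p : ℤ) - (T.n : ℤ) [ZMOD 2 * e] ↔
      2 * (e : ℤ) ∣ ∑ i ∈ Finset.range e, tv e x i + (x.2 0 - x.2 1) := by
  rw [Int.modEq_comm, Int.modEq_iff_dvd, sum_matches hT, ← hT.2,
    show ∀ S : ℤ, S - ((T.p : ℤ) - T.n) = S + (T.n - T.p) from fun S => by ring]

lemma isReps_type1 {e : ℕ} (he : 2 ≤ e) (h : ℕ) :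
    IsReps (SEquiv e) (blocksH e h) (blocksWith e h (Type1Minimal h)) := by
  refine isReps_of_rotation he h (R := Rotation1 e (Finset.range e)) (fun T x hT => ?_)
    fun t d ht hd => existsUnique_rotation1 (by omega) ⟨0, Finset.mem_range.2 (by omega)⟩ ht hd
  have hset : {u | ∃ i : Fin e, T.t i = u} = {u | ∃ i ∈ Finset.range e, tv e x (i : ℕ) = u} := by
    ext u
    constructor
    · rintro ⟨i, rfl⟩
      exact ⟨i, Finset.mem_range.2 i.2, (hT.1 i).symm⟩
    · rintro ⟨i, hi, rfl⟩
      exact ⟨⟨i, Finset.mem_range.1 hi⟩, hT.1 _⟩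
  rw [Type1Minimal, Rotation1, modEq_charge_iff hT, hset]

lemma isReps_type1Alt {e : ℕ} (he : 2 ≤ e) (h : ℕ) :
    IsReps (SEquiv e) (blocksH e h) (blocksWith e h (Type1MinimalAlt h)) := by
  refine isReps_of_rotation he h (R := Rotation1 e (Finset.Ico 1 e)) (fun T x hT => ?_)
    fun t d ht hd => existsUnique_rotation1 (by omega) ⟨1, Finset.mem_Ico.2 (by omega)⟩ ht hd
  have hset : {u | ∃ i : Fin e, 1 ≤ (i : ℕ) ∧ T.t i = u} =
      {u | ∃ i ∈ Finset.Ico 1 e, tv e x (i : ℕ) = u} := by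
    ext u
    constructor
    · rintro ⟨i, hi, rfl⟩
      exact ⟨i, Finset.mem_Ico.2 ⟨hi, i.2⟩, (hT.1 i).symm⟩
    · rintro ⟨i, hi, rfl⟩
      exact ⟨⟨i, (Finset.mem_Ico.1 hi).2⟩, (Finset.mem_Ico.1 hi).1, hT.1 _⟩
  rw [Type1MinimalAlt, Rotation1, modEq_charge_iff hT, hset]

lemma isReps_type2 {e : ℕ} (he : 2 ≤ e) (h : ℕ) :
    IsReps (SEquiv e) (blocksH e h) (blocksWith e h (Type2Minimal h)) := by
  refine isReps_of_rotation he h (R := fun t _ => Rotation2 e t) (fun T x hT => ?_)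
    fun t d ht _ => existsUnique_rotation2 (by omega) ht
  rw [Type2Minimal, Rotation2]
  refine and_congr_right' (and_congr_right' (and_congr ?_ ?_))
  · constructor
    · intro H
      have := H ⟨0, by omega⟩ rfl
      rwa [hT.1] at this
    · intro H i hi
      rw [hT.1, hi]
      exact H
  · constructor
    · intro H i hi hie
      have := H ⟨i, hie⟩ hi
      rwa [hT.1] at this
    · intro H i hi
      rw [hT.1]
      exact H i hi i.2

/-- Representatives described by triples index the classes. -/
lemma classesIndexedBy_of_isReps {e : ℕ} (he : 1 ≤ e) {h : ℕ} {P : Triple e → Prop}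
    (H : IsReps (SEquiv e) (blocksH e h) (blocksWith e h P)) : ClassesIndexedBy e h P := by
  refine ⟨fun T _ => existsUnique_block he h T, fun B hB => ?_⟩
  obtain ⟨D, ⟨⟨hD, T, hT, hPT⟩, hDB⟩, hu⟩ := H.2 B hB
  refine ⟨T, ⟨hPT, D, hD, hT, hDB⟩, ?_⟩
  rintro T' ⟨hPT', D', hD', hT', hDB'⟩
  obtain rfl := hu D' ⟨⟨hD', T', hT', hPT'⟩, hDB'⟩
  exact (existsUnique_isPsi he hD).unique hT' hT

end CombBlock

theorem theoremT (e : ℕ) (he : 2 ≤ e) (h : ℕ) :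
    -- `ψ` is well defined on the blocks in question
    (∀ B ∈ CombBlock.circBlocksH e h, ∃! T, CombBlock.IsPsi e B T) ∧
    -- Type 1
    CombBlock.IsReps (CombBlock.SEquiv e) (CombBlock.blocksH e h)
      (CombBlock.blocksWith e h (CombBlock.Type1Minimal h)) ∧
    CombBlock.ClassesIndexedBy e h (CombBlock.Type1Minimal h) ∧
    CombBlock.IsReps (CombBlock.SEquiv e) (CombBlock.blocksH e h)
      (CombBlock.blocksWith e h (CombBlock.Type1MinimalAlt h)) ∧
    CombBlock.ClassesIndexedBy e h (CombBlock.Type1MinimalAlt h) ∧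
    -- Type 2
    CombBlock.IsReps (CombBlock.SEquiv e) (CombBlock.blocksH e h)
      (CombBlock.blocksWith e h (CombBlock.Type2Minimal h)) ∧
    CombBlock.ClassesIndexedBy e h (CombBlock.Type2Minimal h) ∧
    -- Scopes classes
    CombBlock.IsReps (CombBlock.ScopesEquiv e) (CombBlock.circBlocksH e h)
      (CombBlock.blocksWith e h (CombBlock.ScopesMinimal h)) ∧
    -- every Scopes class contains a unique block whose bipartitions have the least size
    (∀ B : CombBlock.Block e, ∃! D : CombBlock.Block e, CombBlock.ScopesEquiv e D B ∧
      ∀ D' : CombBlock.Block e, CombBlock.ScopesEquiv e D' B →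
        ∀ x ∈ D.1, ∀ y ∈ D'.1, CombBlock.size x.1 ≤ CombBlock.size y.1) := by
  have he1 : 1 ≤ e := by omega
  have h1 := CombBlock.isReps_type1 he h
  have h1' := CombBlock.isReps_type1Alt he h
  have h2 := CombBlock.isReps_type2 he h
  exact ⟨fun B hB => CombBlock.existsUnique_isPsi he1 hB,
    h1, CombBlock.classesIndexedBy_of_isReps he1 h1,
    h1', CombBlock.classesIndexedBy_of_isReps he1 h1',
    h2, CombBlock.classesIndexedBy_of_isReps he1 h2,
    CombBlock.isReps_scopes he h, CombBlock.existsUnique_min he⟩
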